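/- Let $d$ be a nonnegative integer, $(\Omega,\mathcal F,\mathbb P)$ a probability space and $(\Xi,\mathfrak S)$ a measurable space. Operations and inequalities between vectors of $\mathbb R^d$ (product, quotient, square $x^{\odot 2}$, square root, $\le$, $>$) are componentwise and $\|\cdot\|$ is the Euclidean norm. Let $f:\mathbb R^d\times\Xi\to\mathbb R$ be measurable and such that $f(\cdot,s)$ is differentiable for every $s\in\Xi$; $\nabla f(x,s)$ is its gradient with respect to $x$. Let $\xi$ be a random variable on $\Omega$ with values in $\Xi$, and set $$F(x)=\mathbb E\big(f(x,\xi)\big),\qquad S(x)=\mathbb E\big(\nabla f(x,\xi)^{\odot 2}\big).$$ Let $\varepsilon>0$ and assume the following. 1. For every $x$, $f(x,\cdot)$ is $\mathfrak S$-measurable; for almost every $s$ (for the law of $\xi$), $f(\cdot,s)$ is continuously differentiable; there is $x_*\in\mathbb R^d$ with $\mathbb E|f(x_*,\xi)|<\infty$ and $\mathbb E\|\nabla f(x_*,\xi)\|^2<\infty$; for every compact $K\subset\mathbb R^d$ there is $L_K>0$ such that $\mathbb E\|\nabla f(x,\xi)-\nabla f(y,\xi)\|^2\le L_K^2\|x-y\|^2$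 for all $x,y\in K$. 2. $F$ is coercive: $F(x)\to+\infty$ as $\|x\|\to\infty$. 3. $S(x)>0$ for every $x\in\mathbb R^d$. 4. $\bar\alpha,\bar\beta$ are functions defined for $\gamma>0$ with values in $[0,1)$ such that the limits $a=\lim_{\gamma\downarrow0}(1-\bar\alpha(\gamma))/\gamma$ and $b=\lim_{\gamma\downarrow0}(1-\bar\beta(\gamma))/\gamma$ exist, are finite, and satisfy $a>0$, $b>0$, $b\le 4a$. 5. $(\xi_n)_{n\ge1}$ are i.i.d. random variables on $\Omega$ with the same distribution as $\xi$. 6. For every compact $K\subset\mathbb R^d$ there is $p_K>2$ with $\sup_{x\in K}\mathbb E\|\nabla f(x,\xi)\|^{p_K}<\infty$. Let $x_0\in\mathbb R^d$. For every $\gamma>0$, with $\alpha=\bar\alpha(\gamma)$ and $\beta=\bar\beta(\gamma)$, let $z^\gamma_n=(x_n,m_n,v_n)$ be the Adam iterates given by $z_0^\gamma=(x_0,0,0)$ and, for $n\ge1$, $$m_n=\alpha m_{n-1}+(1-\alpha)\nabla f(x_{n-1},\xi_n),\qquad v_n=\beta v_{n-1}+(1-\beta)\nabla f(x_{n-1},\xi_n)^{\odot2},$$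 $$x_n=x_{n-1}-\gamma\,\frac{m_n/(1-\alpha^n)}{\varepsilon+\sqrt{v_n/(1-\beta^n)}},$$ and let $\mathsf z^\gamma:[0,\infty)\to\mathbb R^d\times\mathbb R^d\times[0,\infty)^d$ be the interpolated process $$\mathsf z^\gamma(t)=z_n^\gamma+(z_{n+1}^\gamma-z_n^\gamma)\,\frac{t-n\gamma}{\gamma},\qquad t\in[n\gamma,(n+1)\gamma),\ n\ge 0.$$ For $t>0$ and $(x,m,v)\in\mathbb R^d\times\mathbb R^d\times[0,\infty)^d$ put $$h(t,(x,m,v))=\left(-\frac{(1-e^{-at})^{-1}m}{\varepsilon+\sqrt{(1-e^{-bt})^{-1}v}},\ a(\nabla F(x)-m),\ b(S(x)-v)\right).$$ Then there is a unique continuous map $z:[0,\infty)\to\mathbb R^d\times\mathbb R^d\times[0,\infty)^d$ that is continuously differentiable on $(0,\infty)$ and satisfies $z(0)=(x_0,0,0)$ and $\dot z(t)=h(t,z(t))$ for all $t>0$; and for this $z$, $$\forall\,T>0,\ \forall\,\delta>0,\qquad \lim_{\gamma\downarrow0}\mathbb P\Big(\sup_{t\in[0,T]}\|\mathsf z^\gamma(t)-z(t)\|>\delta\Big)=0.$$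 -/

import Mathlib

open Filter Topology MeasureTheory ProbabilityTheory
open scoped ENNReal

namespace Adam

/-- `ℝ^d` with its Euclidean norm. -/
abbrev E (d : ℕ) : Type := EuclideanSpace ℝ (Fin d)

/-- The state space `ℝ^d × ℝ^d × ℝ^d` of triples `(x, m, v)`.  Only the topological vector space
structure of this product is used below; distances are measured with `Adam.znorm`. -/
abbrev Z (d : ℕ) : Type := E d × E d × E d

/-- The Euclidean norm on `ℝ^d × ℝ^d × ℝ^d ≃ ℝ^{3d}`. -/
noncomputable def znorm {d : ℕ} (z : Z d) : ℝ :=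
  √(‖z.1‖ ^ 2 + ‖z.2.1‖ ^ 2 + ‖z.2.2‖ ^ 2)

section Algorithm

variable {d : ℕ} {Ξ : Type*}

/-- The gradient `∇f(x, s)` of `f` with respect to its first variable. -/
noncomputable def gradf (f : E d → Ξ → ℝ) (x : E d) (s : Ξ) : E d :=
  gradient (fun y => f y s) x

/-- The `n`-th update `(x, m, v) ↦ T_{γ,α,β}(n, (x, m, v), s)` of the algorithm (used for `n ≥ 1`),
with `m' = α m + (1 - α) ∇f(x, s)`, `v' = β v + (1 - β) ∇f(x, s)^{⊙2}`, and
`x' = x - γ m̂ / (ε + √v̂)` where `m̂ = m' / (1 - α^n)`, `v̂ = v' / (1 - β^n)`;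
operations on vectors are componentwise. -/
noncomputable def step (f : E d → Ξ → ℝ) (ε γ α β : ℝ) (n : ℕ) (z : Z d) (s : Ξ) : Z d :=
  let g : E d := gradf f z.1 s
  let m' : E d := WithLp.toLp 2 fun i => α * z.2.1 i + (1 - α) * g i
  let v' : E d := WithLp.toLp 2 fun i => β * z.2.2 i + (1 - β) * g i ^ 2
  let x' : E d := WithLp.toLp 2 fun i =>
    z.1 i - γ * (m' i / (1 - α ^ n)) / (ε + √(v' i / (1 - β ^ n)))
  (x', m', v')

/-- The iterates `z_n` driven by a sequence `s` (whose terms `s 1, s 2, …` are used):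
`z_0 = (x₀, 0, 0)` and `z_n = T_{γ,α,β}(n, z_{n-1}, s n)` for `n ≥ 1`. -/
noncomputable def iterates (f : E d → Ξ → ℝ) (ε γ α β : ℝ) (x₀ : E d) (s : ℕ → Ξ) : ℕ → Z d
  | 0 => (x₀, 0, 0)
  | n + 1 => step f ε γ α β (n + 1) (iterates f ε γ α β x₀ s n) (s (n + 1))

/-- Piecewise linear interpolation of a sequence on the grid `γ ℕ`: for `t ∈ [nγ, (n+1)γ)` its value
is `z_n + (z_{n+1} - z_n) (t - nγ)/γ`. -/
noncomputable def interp (γ : ℝ) (z : ℕ → Z d) (t : ℝ) : Z d :=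
  let n : ℕ := ⌊t / γ⌋₊
  z n + ((t - n * γ) / γ) • (z (n + 1) - z n)

end Algorithm

section Assumptions

variable {d : ℕ} {Ω Ξ : Type*} [MeasurableSpace Ω] [MeasurableSpace Ξ]

/-- `F(x) = 𝔼 f(x, ξ)`. -/
noncomputable def F (P : Measure Ω) (ξ : Ω → Ξ) (f : E d → Ξ → ℝ) (x : E d) : ℝ :=
  ∫ ω, f x (ξ ω) ∂P

/-- `S(x) = 𝔼 (∇f(x, ξ)^{⊙2})`, coordinate by coordinate. -/
noncomputable def S (P : Measure Ω) (ξ : Ω → Ξ) (f : E d → Ξ → ℝ) (x : E d) : E d :=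
  WithLp.toLp 2 fun i => ∫ ω, (gradf f x (ξ ω) i) ^ 2 ∂P

/-- Regularity of the model.  Expectations of nonnegative quantities are `[0, ∞]`-valued. -/
structure Model (P : Measure Ω) (ξ : Ω → Ξ) (f : E d → Ξ → ℝ) : Prop where
  measurable : ∀ x, Measurable (f x)
  contDiff : ∀ᵐ s ∂(P.map ξ), ContDiff ℝ 1 (fun x => f x s)
  moments : ∃ x : E d, ∫⁻ ω, ‖f x (ξ ω)‖ₑ ∂P < ∞ ∧ ∫⁻ ω, ‖gradf f x (ξ ω)‖ₑ ^ 2 ∂P < ∞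
  lipschitz : ∀ K : Set (E d), IsCompact K → ∃ L : ℝ, 0 < L ∧ ∀ x ∈ K, ∀ y ∈ K,
    ∫⁻ ω, ‖gradf f x (ξ ω) - gradf f y (ξ ω)‖ₑ ^ 2 ∂P ≤ ENNReal.ofReal (L ^ 2 * ‖x - y‖ ^ 2)

/-- The joint regime of `α(γ), β(γ)`: values in `[0, 1)`, `(1 - α(γ))/γ → a > 0` and
`(1 - β(γ))/γ → b > 0` as `γ ↓ 0`, and `b ≤ 4a`. -/
structure Regime (α β : ℝ → ℝ) (a b : ℝ) : Prop where
  alpha_mem : ∀ γ, 0 < γ → α γ ∈ Set.Ico (0 : ℝ) 1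
  beta_mem : ∀ γ, 0 < γ → β γ ∈ Set.Ico (0 : ℝ) 1
  alpha_lim : Tendsto (fun γ => (1 - α γ) / γ) (𝓝[>] 0) (𝓝 a)
  beta_lim : Tendsto (fun γ => (1 - β γ) / γ) (𝓝[>] 0) (𝓝 b)
  a_pos : 0 < a
  b_pos : 0 < b
  le : b ≤ 4 * a

/-- Locally uniform moments of order strictly larger than `p`. -/
def MomentsAbove (P : Measure Ω) (ξ : Ω → Ξ) (f : E d → Ξ → ℝ) (p : ℝ) : Prop :=
  ∀ K : Set (E d), IsCompact K → ∃ q : ℝ, p < q ∧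
    (⨆ x ∈ K, ∫⁻ ω, ‖gradf f x (ξ ω)‖ₑ ^ q ∂P) < ∞

end Assumptions

section ODE

variable {d : ℕ}

/-- The vector field
`h(t, (x, m, v)) = (- ((1 - e^{-at})⁻¹ m) / (ε + √((1 - e^{-bt})⁻¹ v)), a (∇F(x) - m), b (S(x) - v))`
(operations componentwise), used for `t > 0` and `v ≥ 0`. -/
noncomputable def field (F : E d → ℝ) (S : E d → E d) (ε a b : ℝ) (t : ℝ) (z : Z d) : Z d :=
  (WithLp.toLp 2 fun i =>
      -((z.2.1 i / (1 - Real.exp (-a * t))) / (ε + √(z.2.2 i / (1 - Real.exp (-b * t))))),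
    a • (gradient F z.1 - z.2.1),
    b • (S z.1 - z.2.2))

/-- `z : [0, ∞) → ℝ^d × ℝ^d × [0, ∞)^d` is a global solution of `z'(t) = h(t, z(t))`, `t > 0`, with
`z(0) = (x₀, 0, 0)` (the values of `z` on negative reals are irrelevant). -/
structure IsGlobalSolution (F : E d → ℝ) (S : E d → E d) (ε a b : ℝ) (x₀ : E d) (z : ℝ → Z d) :
    Prop where
  nonneg : ∀ t, 0 ≤ t → ∀ i, 0 ≤ (z t).2.2 i
  continuousOn : ContinuousOn z (Set.Ici 0)
  contDiffOn : ContDiffOn ℝ 1 z (Set.Ioi 0)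
  hasDerivAt : ∀ t, 0 < t → HasDerivAt z (field F S ε a b t (z t)) t
  init : z 0 = (x₀, 0, 0)

end ODE

end Adam

/-!
The iterates of Adam, interpolated on a grid of step `γ`, follow a non-autonomous differential
equation that is singular at `t = 0`.  The proof treats both the algorithm and the equation as
Volterra equations for the position `x` alone.  Solving the linear equations for `m` and `v` turns
the bias-corrected moments into weighted averages of the gradient and of its square along the path;
for the equation the averages are `expAvg a (G ∘ x)` and `expAvg b (S ∘ x)`, with `G` the mean
gradient and `S` the mean squared gradient.  After rescaling to `[0, 1]` these averages are
continuous up to `t = 0`, so the singularity disappears.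

The second point is an a priori bound.  On a bounded time interval the two weights are comparable,
so that `G² ≤ S` and the Cauchy–Schwarz inequality bound the quotient of the averaged gradient by
the square root of the averaged square (`Drift.abs_velocity_le`).  The same computation bounds the
updates of the algorithm for every realization of the gradients (`abs_update_le`).  Hence all
positions up to time `T` lie in a fixed ball, no localization is needed, and the solution cannot
explode.  On this ball `G` and `S` are Lipschitz and `S` is bounded below by a positive constant, so
the square root causes no trouble; existence and uniqueness follow by Picard iteration
(`CausalField.exists_fixedPoint`, `CausalField.unique`, `Drift.exists_unique_solution`).

For the convergence, `IsIID.measure_exists_le` shows that, uniformly up to time `T`, the partial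
sums of `γ (∇f(x_k, ξ_{k+1}) - G(x_k))` and of the corresponding noise in the squares are small with
probability close to one: the moments of order larger than two allow a truncation, and the truncated
martingale is controlled by its fourth moment and a union bound.  The rest is deterministic.
Summation by parts transfers the bound to the moving averages, a moving average is the Euler scheme
of `m' = c (φ - m)`, and a discrete Grönwall argument compares the positions
(`Drift.exists_norm_sub_le`).  Near `t = 0`, where dividing by `1 - αⁿ` amplifies the noise, both
paths have moved little because their speeds are bounded; the Grönwall rate does not depend on the
time up to which this crude estimate is used.
-/

namespace Adam

/-! ### Exponentially weighted averages -/

/-- The average of `φ` on `[0, t]` with weight proportional to `e^{c s}`.  Rescaling the interval of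
integration to `[0, 1]` removes the singularity at `t = 0`, where the value is `φ 0`. -/
noncomputable def expAvg (c : ℝ) (φ : ℝ → ℝ) (t : ℝ) : ℝ :=
  (∫ u in (0 : ℝ)..1, Real.exp (c * t * u) * φ (t * u)) / ∫ u in (0 : ℝ)..1, Real.exp (c * t * u)

lemma integral_exp_pos (r : ℝ) : 0 < ∫ u in (0 : ℝ)..1, Real.exp (r * u) :=
  intervalIntegral.intervalIntegral_pos_of_pos (Continuous.intervalIntegrable (by fun_prop) _ _)
    (fun _ => Real.exp_pos _) zero_lt_one

lemma continuous_expAvg (c : ℝ) {φ : ℝ → ℝ} (hφ : Continuous φ) : Continuous (expAvg c φ) := by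
  unfold expAvg
  refine Continuous.div ?_ ?_ fun t => (integral_exp_pos _).ne'
  · exact intervalIntegral.continuous_parametric_intervalIntegral_of_continuous (by fun_prop)
      continuous_const
  · exact intervalIntegral.continuous_parametric_intervalIntegral_of_continuous (by fun_prop)
      continuous_const

lemma expAvg_mono (c : ℝ) {φ ψ : ℝ → ℝ} (hφ : Continuous φ) (hψ : Continuous ψ) {t : ℝ}
    (ht : 0 ≤ t) (h : ∀ s ∈ Set.Icc 0 t, φ s ≤ ψ s) : expAvg c φ t ≤ expAvg c ψ t := by
  unfold expAvg
  refine div_le_div_of_nonneg_right ?_ (integral_exp_pos _).le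
  refine intervalIntegral.integral_mono_on zero_le_one
    (Continuous.intervalIntegrable (by fun_prop) _ _)
    (Continuous.intervalIntegrable (by fun_prop) _ _) fun u hu => ?_
  exact mul_le_mul_of_nonneg_left (h _ ⟨mul_nonneg ht hu.1, mul_le_of_le_one_right ht hu.2⟩)
    (Real.exp_pos _).le

lemma expAvg_add (c : ℝ) {φ ψ : ℝ → ℝ} (hφ : Continuous φ) (hψ : Continuous ψ) (t : ℝ) :
    expAvg c (fun s => φ s + ψ s) t = expAvg c φ t + expAvg c ψ t := by
  unfold expAvg
  rw [← add_div, ← intervalIntegral.integral_add (Continuous.intervalIntegrable (by fun_prop) _ _)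
    (Continuous.intervalIntegrable (by fun_prop) _ _)]
  simp only [mul_add]

lemma expAvg_const_mul (c k : ℝ) (φ : ℝ → ℝ) (t : ℝ) :
    expAvg c (fun s => k * φ s) t = k * expAvg c φ t := by
  unfold expAvg
  rw [← mul_div_assoc, ← intervalIntegral.integral_const_mul]
  simp only [mul_left_comm]

lemma expAvg_const (c k t : ℝ) : expAvg c (fun _ => k) t = k := by
  unfold expAvg
  rw [intervalIntegral.integral_mul_const, mul_div_cancel_left₀ _ (integral_exp_pos _).ne']

lemma abs_expAvg_sub_le (c : ℝ) {φ ψ : ℝ → ℝ} (hφ : Continuous φ) (hψ : Continuous ψ) {t D : ℝ}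
    (ht : 0 ≤ t) (h : ∀ s ∈ Set.Icc 0 t, |φ s - ψ s| ≤ D) :
    |expAvg c φ t - expAvg c ψ t| ≤ D := by
  have key : ∀ {φ ψ : ℝ → ℝ}, Continuous φ → Continuous ψ →
      (∀ s ∈ Set.Icc 0 t, |φ s - ψ s| ≤ D) → expAvg c φ t - expAvg c ψ t ≤ D := by
    intro φ ψ hφ hψ h
    have := expAvg_mono c hφ (ψ := fun s => ψ s + D) (by fun_prop) ht
      fun s hs => by have := (abs_le.1 (h s hs)).2; linarith
    rw [expAvg_add c hψ continuous_const, expAvg_const] at this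
    linarith
  refine abs_le.2 ⟨?_, key hφ hψ h⟩
  have := key hψ hφ fun s hs => by rw [abs_sub_comm]; exact h s hs
  linarith

/-- Jensen's inequality for the square: the variance `avg ((φ - avg φ)²)` is nonnegative. -/
lemma sq_expAvg_le (c : ℝ) {φ : ℝ → ℝ} (hφ : Continuous φ) {t : ℝ} (ht : 0 ≤ t) :
    expAvg c φ t ^ 2 ≤ expAvg c (fun s => φ s ^ 2) t := by
  set k := expAvg c φ t with hk
  have h0 : 0 ≤ expAvg c (fun s => φ s ^ 2 + (-(2 * k) * φ s + k ^ 2)) t := by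
    rw [← expAvg_const c 0 t]
    exact expAvg_mono c continuous_const (by fun_prop) ht fun s _ => by
      nlinarith [sq_nonneg (φ s - k)]
  rw [expAvg_add c (by fun_prop) (by fun_prop), expAvg_add c (by fun_prop) (by fun_prop),
    expAvg_const_mul, expAvg_const, ← hk] at h0
  nlinarith

/-- On a bounded time interval, averages with different rates are comparable. -/
lemma expAvg_le_mul_expAvg {a b : ℝ} (ha : 0 ≤ a) (hb : 0 ≤ b) {ψ : ℝ → ℝ} (hψ : Continuous ψ)
    (h0 : ∀ s, 0 ≤ ψ s) {t T : ℝ} (ht : t ∈ Set.Icc 0 T) :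
    expAvg a ψ t ≤ Real.exp ((a + b) * T) * expAvg b ψ t := by
  have hexp : ∀ c u, 0 ≤ c → u ∈ Set.Icc (0 : ℝ) 1 →
      1 ≤ Real.exp (c * t * u) ∧ Real.exp (c * t * u) ≤ Real.exp (c * T) := by
    intro c u hc hu
    have h1 : 0 ≤ c * t := mul_nonneg hc ht.1
    refine ⟨Real.one_le_exp (mul_nonneg h1 hu.1), Real.exp_le_exp.2 ?_⟩
    exact (mul_le_of_le_one_right h1 hu.2).trans (mul_le_mul_of_nonneg_left ht.2 hc)
  have hden : ∀ c, 0 ≤ c → 1 ≤ (∫ u in (0 : ℝ)..1, Real.exp (c * t * u)) ∧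
      (∫ u in (0 : ℝ)..1, Real.exp (c * t * u)) ≤ Real.exp (c * T) := by
    intro c hc
    have hi : IntervalIntegrable (fun u => Real.exp (c * t * u)) volume 0 1 :=
      Continuous.intervalIntegrable (by fun_prop) _ _
    constructor
    · simpa using intervalIntegral.integral_mono_on zero_le_one
        (intervalIntegrable_const (c := (1 : ℝ))) hi fun u hu => (hexp c u hc hu).1
    · simpa using intervalIntegral.integral_mono_on zero_le_one hi
        (intervalIntegrable_const (c := Real.exp (c * T))) fun u hu => (hexp c u hc hu).2
  set I := ∫ u in (0 : ℝ)..1, ψ (t * u) with hI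
  have hI0 : 0 ≤ I := intervalIntegral.integral_nonneg zero_le_one fun u _ => h0 _
  have h1 : expAvg a ψ t ≤ Real.exp (a * T) * I := by
    unfold expAvg
    rw [div_le_iff₀ (integral_exp_pos _)]
    refine le_trans ?_ (le_mul_of_one_le_right (by positivity) (hden a ha).1)
    rw [hI, ← intervalIntegral.integral_const_mul]
    exact intervalIntegral.integral_mono_on zero_le_one
      (Continuous.intervalIntegrable (by fun_prop) _ _)
      (Continuous.intervalIntegrable (by fun_prop) _ _) fun u hu =>
        mul_le_mul_of_nonneg_right (hexp a u ha hu).2 (h0 _)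
  have h2 : I ≤ Real.exp (b * T) * expAvg b ψ t := by
    unfold expAvg
    rw [mul_div_assoc', le_div_iff₀ (integral_exp_pos _), mul_comm]
    refine mul_le_mul (hden b hb).2 ?_ hI0 (Real.exp_pos _).le
    exact intervalIntegral.integral_mono_on zero_le_one
      (Continuous.intervalIntegrable (by fun_prop) _ _)
      (Continuous.intervalIntegrable (by fun_prop) _ _) fun u hu =>
        le_mul_of_one_le_left (h0 _) (hexp b u hb hu).1
  calc expAvg a ψ t ≤ Real.exp (a * T) * I := h1
    _ ≤ Real.exp (a * T) * (Real.exp (b * T) * expAvg b ψ t) := by gcongr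
    _ = _ := by rw [← mul_assoc, ← Real.exp_add, add_mul]

/-- The solution `m` of `m' = c (φ - m)`, `m 0 = 0`. -/
noncomputable def relax (c : ℝ) (φ : ℝ → ℝ) (t : ℝ) : ℝ :=
  Real.exp (-c * t) * ∫ s in (0 : ℝ)..t, c * Real.exp (c * s) * φ s

lemma relax_zero (c : ℝ) (φ : ℝ → ℝ) : relax c φ 0 = 0 := by simp [relax]

lemma hasDerivAt_relax (c : ℝ) {φ : ℝ → ℝ} (hφ : Continuous φ) (t : ℝ) :
    HasDerivAt (relax c φ) (c * (φ t - relax c φ t)) t := by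
  have h1 : HasDerivAt (fun t => Real.exp (-c * t)) (Real.exp (-c * t) * (-c * 1)) t :=
    ((hasDerivAt_id t).const_mul (-c)).exp
  have h2 : HasDerivAt (fun t => ∫ s in (0 : ℝ)..t, c * Real.exp (c * s) * φ s)
      (c * Real.exp (c * t) * φ t) t :=
    intervalIntegral.integral_hasDerivAt_right (Continuous.intervalIntegrable (by fun_prop) _ _)
      (Continuous.stronglyMeasurableAtFilter (by fun_prop) _ _)
      (Continuous.continuousAt (by fun_prop))
  refine (h1.mul h2).congr_deriv ?_
  unfold relax
  have h3 : Real.exp (-c * t) * Real.exp (c * t) = 1 := by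
    rw [← Real.exp_add]; simp
  linear_combination c * φ t * h3

/-- The moment `relax c φ` is an average up to the bias-correction factor `1 - e^{-c t}`. -/
lemma relax_eq_mul_expAvg {c : ℝ} (φ : ℝ → ℝ) (t : ℝ) :
    relax c φ t = (1 - Real.exp (-c * t)) * expAvg c φ t := by
  have h1 : t * ∫ u in (0 : ℝ)..1, c * Real.exp (c * (t * u)) * φ (t * u) =
      ∫ s in (0 : ℝ)..t, c * Real.exp (c * s) * φ s := by
    have := intervalIntegral.mul_integral_comp_mul_left (a := 0) (b := 1)
      (f := fun s => c * Real.exp (c * s) * φ s) t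
    rwa [mul_zero, mul_one] at this
  have h2 : c * t * ∫ u in (0 : ℝ)..1, Real.exp (c * t * u) = Real.exp (c * t) - 1 := by
    simp
  have h3 : ∫ u in (0 : ℝ)..1, c * Real.exp (c * (t * u)) * φ (t * u) =
      c * ∫ u in (0 : ℝ)..1, Real.exp (c * t * u) * φ (t * u) := by
    rw [← intervalIntegral.integral_const_mul]
    simp only [mul_assoc]
  have h4 : 1 - Real.exp (-c * t) =
      Real.exp (-c * t) * (c * t * ∫ u in (0 : ℝ)..1, Real.exp (c * t * u)) := by
    rw [h2, mul_sub, ← Real.exp_add]; simp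
  unfold relax expAvg
  rw [← h1, h3, h4]
  field_simp [(integral_exp_pos (c * t)).ne']

lemma expAvg_eq_relax_div {c : ℝ} (hc : 0 < c) (φ : ℝ → ℝ) {t : ℝ} (ht : 0 < t) :
    expAvg c φ t = relax c φ t / (1 - Real.exp (-c * t)) := by
  have : Real.exp (-c * t) < 1 := Real.exp_lt_one_iff.2 (by nlinarith [mul_pos hc ht])
  rw [relax_eq_mul_expAvg, mul_div_cancel_left₀ _ (by linarith : 1 - Real.exp (-c * t) ≠ 0)]

/-- Uniqueness for `y' = c (φ - y)` when the equation holds for positive times only. -/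
lemma eqOn_relax {c : ℝ} {φ y : ℝ → ℝ} (hφ : Continuous φ) (hy : ContinuousOn y (Set.Ici 0))
    (hy0 : y 0 = 0) (hd : ∀ t, 0 < t → HasDerivAt y (c * (φ t - y t)) t) :
    Set.EqOn y (relax c φ) (Set.Ici 0) := by
  intro t ht
  -- The integrating factor `e^{c s}` makes the difference of two solutions constant.
  set w : ℝ → ℝ := fun s => Real.exp (c * s) * (y s - relax c φ s) with hw
  have hrel : Continuous (relax c φ) :=
    continuous_iff_continuousAt.2 fun s => (hasDerivAt_relax c hφ s).continuousAt
  have hwc : ContinuousOn w (Set.Icc 0 t) :=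
    ContinuousOn.mul (by fun_prop) ((hy.mono Set.Icc_subset_Ici_self).sub hrel.continuousOn)
  have hwd : ∀ s ∈ Set.Ioo 0 t, HasDerivAt w 0 s := by
    intro s hs
    have h1 : HasDerivAt (fun s => Real.exp (c * s)) (Real.exp (c * s) * (c * 1)) s :=
      ((hasDerivAt_id s).const_mul c).exp
    refine (h1.mul ((hd s hs.1).sub (hasDerivAt_relax c hφ s))).congr_deriv ?_
    simp only [Pi.sub_apply]
    ring
  have hconst : w t = w 0 := by
    have := intervalIntegral.integral_eq_sub_of_hasDerivAt_of_le ht hwc hwd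
      (intervalIntegrable_const)
    simp at this
    linarith
  have h0 : w 0 = 0 := by simp [hw, hy0, relax_zero]
  rw [h0] at hconst
  have := (mul_eq_zero.1 hconst).resolve_left (Real.exp_pos _).ne'
  linarith

/-! ### Volterra equations `x' = Φ[x]` -/

section Volterra

variable {V : Type*} [NormedAddCommGroup V] [NormedSpace ℝ V]

/-- A causal vector field on paths: the velocity `Φ x t` may depend on the whole path `x` on
`[0, t]`.  It is bounded on bounded time intervals, and there it is Lipschitz for the uniform
distance of paths that stay in a ball around `x₀`. -/
structure CausalField (x₀ : V) (Φ : (ℝ → V) → ℝ → V) : Prop where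
  continuous : ∀ x, Continuous x → Continuous (Φ x)
  bounded : ∀ T, 0 ≤ T → ∃ C, 0 ≤ C ∧ ∀ x, Continuous x → ∀ t ∈ Set.Icc 0 T, ‖Φ x t‖ ≤ C
  lipschitz : ∀ T R, 0 ≤ T → ∃ L, 0 < L ∧ ∀ x y, Continuous x → Continuous y →
    (∀ s ∈ Set.Icc 0 T, ‖x s - x₀‖ ≤ R) → (∀ s ∈ Set.Icc 0 T, ‖y s - x₀‖ ≤ R) →
    ∀ t ∈ Set.Icc 0 T, ∀ D, (∀ s ∈ Set.Icc 0 t, ‖x s - y s‖ ≤ D) → ‖Φ x t - Φ y t‖ ≤ L * D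

/-- The Picard map.  Paths are defined on the whole line; the image is constant on
`(-∞, 0]`. -/
noncomputable def picard (x₀ : V) (Φ : (ℝ → V) → ℝ → V) (x : ℝ → V) (t : ℝ) : V :=
  x₀ + ∫ s in (0 : ℝ)..max t 0, Φ x s

variable {x₀ : V} {Φ : (ℝ → V) → ℝ → V}

lemma CausalField.continuous_picard [CompleteSpace V] (h : CausalField x₀ Φ) {x : ℝ → V}
    (hx : Continuous x) : Continuous (picard x₀ Φ x) := by
  have h1 : Continuous fun t => ∫ s in (0 : ℝ)..t, Φ x s :=
    continuous_iff_continuousAt.2 fun t =>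
      (intervalIntegral.integral_hasDerivAt_right ((h.continuous x hx).intervalIntegrable _ _)
        ((h.continuous x hx).stronglyMeasurableAtFilter _ _)
        (h.continuous x hx).continuousAt).continuousAt
  exact continuous_const.add (h1.comp (continuous_id.max continuous_const))

lemma norm_picard_sub_le {T C : ℝ} (hC0 : 0 ≤ C) {x : ℝ → V}
    (hC : ∀ t ∈ Set.Icc 0 T, ‖Φ x t‖ ≤ C) {t : ℝ} (ht : t ∈ Set.Icc 0 T) :
    ‖picard x₀ Φ x t - x₀‖ ≤ C * T := by
  rw [picard, add_sub_cancel_left, max_eq_left ht.1]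
  refine (intervalIntegral.norm_integral_le_of_norm_le_const (C := C) fun s hs => ?_).trans ?_
  · rw [Set.uIoc_of_le ht.1] at hs
    exact hC s ⟨hs.1.le, hs.2.trans ht.2⟩
  · rw [sub_zero, abs_of_nonneg ht.1]
    exact mul_le_mul_of_nonneg_left ht.2 hC0

/-- In the norm `sup e^{-2Lt} ‖x t‖` the Picard map halves distances. -/
lemma norm_picard_sub_picard_le (hΦ : ∀ x, Continuous x → Continuous (Φ x)) {T L A : ℝ}
    (hL : 0 < L) {x y : ℝ → V} (hx : Continuous x) (hy : Continuous y)
    (hlip : ∀ t ∈ Set.Icc 0 T, ∀ D, (∀ s ∈ Set.Icc 0 t, ‖x s - y s‖ ≤ D) →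
      ‖Φ x t - Φ y t‖ ≤ L * D)
    (hA : 0 ≤ A) (h : ∀ s ∈ Set.Icc 0 T, ‖x s - y s‖ ≤ A * Real.exp (2 * L * s))
    {t : ℝ} (ht : t ∈ Set.Icc 0 T) :
    ‖picard x₀ Φ x t - picard x₀ Φ y t‖ ≤ A / 2 * Real.exp (2 * L * t) := by
  rw [picard, picard, add_sub_add_left_eq_sub, max_eq_left ht.1,
    ← intervalIntegral.integral_sub ((hΦ x hx).intervalIntegrable _ _)
      ((hΦ y hy).intervalIntegrable _ _)]
  have hd : ∀ s, HasDerivAt (fun s => A / 2 * Real.exp (2 * L * s))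
      (L * (A * Real.exp (2 * L * s))) s := by
    intro s
    refine ((((hasDerivAt_id s).const_mul (2 * L)).exp).const_mul (A / 2)).congr_deriv ?_
    simp only [id]; ring
  have hint : ∫ s in (0 : ℝ)..t, L * (A * Real.exp (2 * L * s)) =
      A / 2 * Real.exp (2 * L * t) - A / 2 := by
    rw [intervalIntegral.integral_eq_sub_of_hasDerivAt (fun s _ => hd s)
      (Continuous.intervalIntegrable (by fun_prop) _ _)]
    simp
  refine (intervalIntegral.norm_integral_le_of_norm_le ht.1
    (g := fun s => L * (A * Real.exp (2 * L * s))) ?_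
    (Continuous.intervalIntegrable (by fun_prop) _ _)).trans ?_
  · refine Eventually.of_forall fun s hs => ?_
    refine hlip s ⟨hs.1.le, hs.2.trans ht.2⟩ _ fun r hr => ?_
    refine (h r ⟨hr.1, hr.2.trans (hs.2.trans ht.2)⟩).trans ?_
    exact mul_le_mul_of_nonneg_left
      (Real.exp_le_exp.2 (mul_le_mul_of_nonneg_left hr.2 (by positivity))) hA
  · rw [hint]; linarith

/-- Two fixed points of the Picard map on `[0, T]`, that is, two solutions of `x' = Φ[x]` in
integrated form, coincide. -/
lemma CausalField.unique (h : CausalField x₀ Φ) {x y : ℝ → V} (hx : Continuous x)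
    (hy : Continuous y) {T : ℝ} (hT : 0 ≤ T) (hxe : ∀ t ∈ Set.Icc 0 T, x t = picard x₀ Φ x t)
    (hye : ∀ t ∈ Set.Icc 0 T, y t = picard x₀ Φ y t) : Set.EqOn x y (Set.Icc 0 T) := by
  obtain ⟨C, hC0, hC⟩ := h.bounded T hT
  obtain ⟨L, hL, hlip⟩ := h.lipschitz T (C * T) hT
  have hbx : ∀ s ∈ Set.Icc 0 T, ‖x s - x₀‖ ≤ C * T := fun s hs => by
    rw [hxe s hs]; exact norm_picard_sub_le hC0 (hC x hx) hs
  have hby : ∀ s ∈ Set.Icc 0 T, ‖y s - x₀‖ ≤ C * T := fun s hs => by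
    rw [hye s hs]; exact norm_picard_sub_le hC0 (hC y hy) hs
  have key : ∀ k : ℕ, ∀ s ∈ Set.Icc 0 T,
      ‖x s - y s‖ ≤ (2 * (C * T)) / 2 ^ k * Real.exp (2 * L * s) := by
    intro k
    induction k with
    | zero =>
      intro s hs
      have h1 : ‖x s - y s‖ ≤ 2 * (C * T) := by
        have := norm_sub_le (x s - x₀) (y s - x₀)
        rw [sub_sub_sub_cancel_right] at this
        linarith [hbx s hs, hby s hs]
      simpa using h1.trans (le_mul_of_one_le_right (by positivity)
        (Real.one_le_exp (mul_nonneg (by positivity) hs.1)))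
    | succ k ih =>
      intro s hs
      rw [hxe s hs, hye s hs, pow_succ, ← div_div]
      exact norm_picard_sub_picard_le h.continuous hL hx hy (hlip x y hx hy hbx hby)
        (by positivity) ih hs
  intro t ht
  have hlim : Tendsto (fun k : ℕ => (2 * (C * T)) / 2 ^ k * Real.exp (2 * L * t)) atTop (𝓝 0) := by
    have : Tendsto (fun k : ℕ => (2 * (C * T)) / 2 ^ k) atTop (𝓝 0) :=
      tendsto_const_nhds.div_atTop (tendsto_pow_atTop_atTop_of_one_lt one_lt_two)
    simpa using this.mul_const (Real.exp (2 * L * t))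
  have := ge_of_tendsto' hlim fun k => key k t ht
  exact sub_eq_zero.1 (norm_le_zero_iff.1 this)

/-- Existence by Picard iteration, which converges uniformly on bounded time intervals. -/
lemma CausalField.exists_fixedPoint [CompleteSpace V] (h : CausalField x₀ Φ) :
    ∃ x : ℝ → V, Continuous x ∧ ∀ t, x t = picard x₀ Φ x t := by
  set X : ℕ → ℝ → V := fun k => (picard x₀ Φ)^[k] fun _ => x₀ with hX
  have hXs : ∀ k, X (k + 1) = picard x₀ Φ (X k) := fun k => Function.iterate_succ_apply' _ _ _
  have hXc : ∀ k, Continuous (X k) := by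
    intro k
    induction k with
    | zero => exact continuous_const
    | succ k ih => rw [hXs]; exact h.continuous_picard ih
  have hXmax : ∀ k t, X k t = X k (max t 0) := by
    intro k t
    cases k with
    | zero => rfl
    | succ k => rw [hXs]; simp [picard]
  have hball : ∀ T C, 0 ≤ T → 0 ≤ C →
      (∀ x, Continuous x → ∀ t ∈ Set.Icc 0 T, ‖Φ x t‖ ≤ C) → ∀ k, ∀ t ∈ Set.Icc 0 T,
      ‖X k t - x₀‖ ≤ C * T := by
    intro T C hT hC0 hC k t ht
    cases k with
    | zero => simpa [hX] using mul_nonneg hC0 hT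
    | succ k => rw [hXs]; exact norm_picard_sub_le hC0 (hC _ (hXc k)) ht
  have hgeom : ∀ T, 0 ≤ T → ∃ B, 0 ≤ B ∧ ∀ k, ∀ t ∈ Set.Icc 0 T,
      dist (X k t) (X (k + 1) t) ≤ B / 2 / 2 ^ k := by
    intro T hT
    obtain ⟨C, hC0, hC⟩ := h.bounded T hT
    obtain ⟨L, hL, hlip⟩ := h.lipschitz T (C * T) hT
    have hb := hball T C hT hC0 hC
    have key : ∀ k, ∀ t ∈ Set.Icc 0 T,
        ‖X k t - X (k + 1) t‖ ≤ (C * T) / 2 ^ k * Real.exp (2 * L * t) := by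
      intro k
      induction k with
      | zero =>
        intro t ht
        have h1 : ‖X 0 t - X 1 t‖ ≤ C * T := by rw [norm_sub_rev]; exact hb 1 t ht
        simpa using h1.trans (le_mul_of_one_le_right (by positivity)
          (Real.one_le_exp (mul_nonneg (by positivity) ht.1)))
      | succ k ih =>
        intro t ht
        rw [hXs (k + 1), hXs k, pow_succ, ← div_div]
        rw [hXs k] at ih
        refine norm_picard_sub_picard_le h.continuous hL (hXc k)
          (h.continuous_picard (hXc k)) (hlip _ _ (hXc k) (h.continuous_picard (hXc k)) (hb k)
          ?_) (by positivity) ih ht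
        rw [← hXs k]; exact hb (k + 1)
    refine ⟨2 * (C * T * Real.exp (2 * L * T)), by positivity, fun k t ht => ?_⟩
    rw [dist_eq_norm]
    refine (key k t ht).trans ?_
    rw [mul_div_cancel_left₀ _ (two_ne_zero' ℝ), div_mul_eq_mul_div]
    have : Real.exp (2 * L * t) ≤ Real.exp (2 * L * T) :=
      Real.exp_le_exp.2 (mul_le_mul_of_nonneg_left ht.2 (by positivity))
    gcongr
  have hlimex : ∀ t, ∃ y, Tendsto (fun k => X k t) atTop (𝓝 y) := by
    intro t
    obtain ⟨B, -, hB⟩ := hgeom (max t 0) (le_max_right _ _)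
    refine cauchySeq_tendsto_of_complete (cauchySeq_of_le_geometric_two (C := B) fun k => ?_)
    rw [hXmax k t, hXmax (k + 1) t]
    exact hB k _ ⟨le_max_right _ _, le_rfl⟩
  choose x hx using hlimex
  have hrate : ∀ T, 0 ≤ T → ∃ B, 0 ≤ B ∧ ∀ k, ∀ t ≤ T, dist (X k t) (x t) ≤ B / 2 ^ k := by
    intro T hT
    obtain ⟨B, hB0, hB⟩ := hgeom T hT
    refine ⟨B, hB0, fun k t ht => ?_⟩
    refine dist_le_of_le_geometric_two_of_tendsto (fun k => ?_) (hx t) k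
    rw [hXmax k t, hXmax (k + 1) t]
    exact hB k _ ⟨le_max_right _ _, max_le ht hT⟩
  have hpow : ∀ B : ℝ, Tendsto (fun k : ℕ => B / 2 ^ k) atTop (𝓝 0) := fun B =>
    tendsto_const_nhds.div_atTop (tendsto_pow_atTop_atTop_of_one_lt one_lt_two)
  have hxc : Continuous x := by
    refine continuous_iff_continuousAt.2 fun t => ?_
    obtain ⟨B, -, hB⟩ := hrate (|t| + 1) (by positivity)
    have hu : TendstoUniformlyOn X x atTop (Set.Iio (|t| + 1)) := by
      refine Metric.tendstoUniformlyOn_iff.2 fun η hη => ?_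
      filter_upwards [(hpow B).eventually_lt_const hη] with k hk s hs
      rw [dist_comm]
      exact (hB k s (le_of_lt hs)).trans_lt hk
    exact (hu.continuousOn (Frequently.of_forall fun k => (hXc k).continuousOn)).continuousAt
      (Iio_mem_nhds (by linarith [le_abs_self t]))
  refine ⟨x, hxc, fun t => ?_⟩
  have ht0 : max t 0 ∈ Set.Icc 0 (max t 0) := ⟨le_max_right _ _, le_rfl⟩
  obtain ⟨C, hC0, hC⟩ := h.bounded (max t 0) ht0.1
  obtain ⟨L, hL, hlip⟩ := h.lipschitz (max t 0) (C * max t 0) ht0.1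
  obtain ⟨B, hB0, hB⟩ := hrate (max t 0) ht0.1
  have hb := hball _ C ht0.1 hC0 hC
  have hbx : ∀ s ∈ Set.Icc 0 (max t 0), ‖x s - x₀‖ ≤ C * max t 0 := fun s hs =>
    le_of_tendsto (((hx s).sub_const x₀).norm) (Eventually.of_forall fun k => hb k s hs)
  have h1 : Tendsto (fun k => X (k + 1) t) atTop (𝓝 (x t)) := (hx t).comp (tendsto_add_atTop_nat 1)
  refine tendsto_nhds_unique h1 ?_
  rw [tendsto_iff_norm_sub_tendsto_zero]
  refine squeeze_zero (fun _ => norm_nonneg _) (fun k => ?_)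
    ((hpow B).div_const 2 |>.mul_const (Real.exp (2 * L * max t 0)) |>.trans (by simp))
  have := norm_picard_sub_picard_le (x₀ := x₀) h.continuous hL (hXc k) hxc
    (hlip _ _ (hXc k) hxc (hb k) hbx) (A := B / 2 ^ k) (by positivity) (fun s hs => ?_) ht0
  · rw [hXs]
    simpa [picard] using this
  · rw [← dist_eq_norm]
    exact (hB k s hs.2).trans (le_mul_of_one_le_right (by positivity)
        (Real.one_le_exp (mul_nonneg (by positivity) hs.1)))

end Volterra

/-! ### The limiting differential equation -/

section Limit

variable {d : ℕ}

/-- Lipschitz continuity on every compact set. -/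
def LipOnCompacts (G : E d → E d) : Prop :=
  ∀ K, IsCompact K → ∃ L, 0 ≤ L ∧ ∀ x ∈ K, ∀ y ∈ K, ‖G x - G y‖ ≤ L * ‖x - y‖

/-- The properties of the mean gradient `G` and of the mean squared gradient `S` that are used in
the analysis of the limiting equation. -/
structure Drift (G S : E d → E d) : Prop where
  lipG : LipOnCompacts G
  lipS : LipOnCompacts S
  pos : ∀ x i, 0 < S x i
  sq_le : ∀ x i, G x i ^ 2 ≤ S x i

lemma abs_apply_le_norm (w : E d) (i : Fin d) : |w i| ≤ ‖w‖ := by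
  simpa using PiLp.norm_apply_le w i

lemma norm_le_mul_of_forall_abs_le {w : E d} {c : ℝ} (h : ∀ i, |w i| ≤ c) : ‖w‖ ≤ d * c := by
  calc ‖w‖ = ‖∑ i, EuclideanSpace.single i (w i)‖ := by
        congr 1
        ext j
        simp [Finset.sum_apply]
    _ ≤ ∑ i, ‖EuclideanSpace.single i (w i)‖ := norm_sum_le _ _
    _ ≤ ∑ _i : Fin d, c := Finset.sum_le_sum fun i _ => by simpa using h i
    _ = d * c := by simp

lemma LipOnCompacts.continuous {G : E d → E d} (h : LipOnCompacts G) : Continuous G := by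
  refine continuous_iff_continuousAt.2 fun x => ?_
  obtain ⟨L, hL0, hL⟩ := h _ (isCompact_closedBall x 1)
  have hlip : LipschitzOnWith ⟨L, hL0⟩ G (Metric.closedBall x 1) :=
    LipschitzOnWith.of_dist_le_mul fun y hy z hz => by
      rw [dist_eq_norm, dist_eq_norm]; exact hL y hy z hz
  exact hlip.continuousOn.continuousAt (Metric.closedBall_mem_nhds x one_pos)

/-- Positivity of `S` is uniform on compact sets. -/
lemma Drift.exists_lower_bound {G S : E d → E d} (h : Drift G S) {K : Set (E d)}
    (hK : IsCompact K) : ∃ c, 0 < c ∧ ∀ x ∈ K, ∀ i, c ≤ S x i := by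
  have h1 : ∀ i, ∀ᶠ c in 𝓝[>] (0 : ℝ), ∀ x ∈ K, c ≤ S x i := by
    intro i
    rcases K.eq_empty_or_nonempty with rfl | hne
    · simp
    have hcont : Continuous fun x => S x i := by
      have := h.lipS.continuous
      fun_prop
    obtain ⟨y, hy, hmin⟩ := hK.exists_isMinOn hne hcont.continuousOn
    filter_upwards [Ioo_mem_nhdsGT (h.pos y i)] with c hc x hx
    exact hc.2.le.trans (hmin hx)
  obtain ⟨c, hc, hc0⟩ := ((eventually_all.2 h1).and self_mem_nhdsWithin).exists
  exact ⟨c, hc0, fun x hx i => hc i x hx⟩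

/-- The Lipschitz estimate for the square root needs a lower bound on only one of the two points. -/
lemma abs_sqrt_sub_sqrt_le {c q q' : ℝ} (hc : 0 < c) (hq : 0 ≤ q) (hq' : c ≤ q') :
    |√q - √q'| ≤ |q - q'| / √c := by
  have h1 : 0 < √c := Real.sqrt_pos.2 hc
  have h2 : √c ≤ √q' := Real.sqrt_le_sqrt hq'
  have h3 : q - q' = (√q - √q') * (√q + √q') := by
    nlinarith [Real.mul_self_sqrt hq, Real.mul_self_sqrt (hc.le.trans hq')]
  rw [le_div_iff₀ h1, h3, abs_mul, abs_of_nonneg (by positivity : 0 ≤ √q + √q')]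
  exact mul_le_mul_of_nonneg_left (by linarith [Real.sqrt_nonneg q]) (abs_nonneg _)

lemma abs_div_sub_div_le {ε c p p' q q' B : ℝ} (hε : 0 < ε) (hc : 0 < c) (hq : 0 ≤ q)
    (hq' : c ≤ q') (hp' : |p'| ≤ B) :
    |p / (ε + √q) - p' / (ε + √q')| ≤ |p - p'| / ε + B / (ε ^ 2 * √c) * |q - q'| := by
  have h1 : 0 ≤ √q := Real.sqrt_nonneg _
  have h2 : 0 ≤ √q' := Real.sqrt_nonneg _
  have hB : 0 ≤ B := (abs_nonneg _).trans hp'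
  have h0 : 0 < √c := Real.sqrt_pos.2 hc
  have e : p / (ε + √q) - p' / (ε + √q') =
      (p - p') / (ε + √q) + p' * (√q' - √q) / ((ε + √q) * (ε + √q')) := by
    field_simp; ring
  rw [e]
  refine (abs_add_le _ _).trans (add_le_add ?_ ?_)
  · rw [abs_div, abs_of_pos (by positivity : 0 < ε + √q)]
    exact div_le_div_of_nonneg_left (abs_nonneg _) hε (by linarith)
  · rw [abs_div, abs_mul, abs_of_pos (by positivity : 0 < (ε + √q) * (ε + √q')), abs_sub_comm]
    calc |p'| * |√q - √q'| / ((ε + √q) * (ε + √q'))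
        ≤ B * (|q - q'| / √c) / (ε * ε) := by
          gcongr
          · exact abs_sqrt_sub_sqrt_le hc hq hq'
          · linarith
          · linarith
      _ = B / (ε ^ 2 * √c) * |q - q'| := by field_simp

/-- The velocity of `x` in the limiting equation, as a functional of the path `x` alone: the moment
estimates are eliminated by writing them as averages of `G` and `S` along the path. -/
noncomputable def velocity (G S : E d → E d) (ε a b : ℝ) (x : ℝ → E d) (t : ℝ) : E d :=
  WithLp.toLp 2 fun i =>
    -(expAvg a (fun s => G (x s) i) t / (ε + √(expAvg b (fun s => S (x s) i) t)))

variable {G S : E d → E d} {ε a b : ℝ}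

lemma Drift.continuous_comp (h : Drift G S) {x : ℝ → E d} (hx : Continuous x) (i : Fin d) :
    (Continuous fun s => G (x s) i) ∧ Continuous fun s => S (x s) i := by
  have h1 := h.lipG.continuous
  have h2 := h.lipS.continuous
  exact ⟨by fun_prop, by fun_prop⟩

lemma Drift.expAvg_nonneg (h : Drift G S) {x : ℝ → E d} (hx : Continuous x) (i : Fin d) {t : ℝ}
    (ht : 0 ≤ t) : 0 ≤ expAvg b (fun s => S (x s) i) t := by
  have := expAvg_mono b continuous_const (h.continuous_comp hx i).2 ht
    fun s _ => (h.pos (x s) i).le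
  rwa [expAvg_const] at this

/-- The velocity is a bounded functional, without any condition on the path: by the
Cauchy–Schwarz inequality and `G² ≤ S`, the averaged gradient is controlled by the square root of
the averaged squared gradient. -/
lemma Drift.abs_velocity_le (h : Drift G S) (hε : 0 < ε) (ha : 0 ≤ a) (hb : 0 ≤ b) {x : ℝ → E d}
    (hx : Continuous x) {t T : ℝ} (ht : t ∈ Set.Icc 0 T) (i : Fin d) :
    |velocity G S ε a b x t i| ≤ √(Real.exp ((a + b) * T)) := by
  obtain ⟨hG, hS⟩ := h.continuous_comp hx i
  have hv : 0 ≤ expAvg b (fun s => S (x s) i) t := h.expAvg_nonneg hx i ht.1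
  have h1 : expAvg a (fun s => G (x s) i) t ^ 2 ≤
      Real.exp ((a + b) * T) * expAvg b (fun s => S (x s) i) t := by
    refine (sq_expAvg_le a hG ht.1).trans (le_trans ?_ (expAvg_le_mul_expAvg ha hb hS
      (fun s => (h.pos (x s) i).le) ht))
    exact expAvg_mono a (hG.pow 2) hS ht.1 fun s _ => h.sq_le (x s) i
  have h2 := Real.abs_le_sqrt h1
  rw [Real.sqrt_mul (Real.exp_pos _).le] at h2
  simp only [velocity]
  have h3 : 0 ≤ √(expAvg b (fun s => S (x s) i) t) := Real.sqrt_nonneg _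
  rw [abs_neg, abs_div, abs_of_pos (by positivity : 0 < ε + √(expAvg b (fun s => S (x s) i) t)),
    div_le_iff₀ (by positivity)]
  exact h2.trans (mul_le_mul_of_nonneg_left (by linarith) (Real.sqrt_nonneg _))

lemma Drift.continuous_velocity (h : Drift G S) (hε : 0 < ε) {x : ℝ → E d}
    (hx : Continuous x) : Continuous (velocity G S ε a b x) := by
  refine (PiLp.continuous_toLp 2 _).comp (continuous_pi fun i => ?_)
  refine (Continuous.div (continuous_expAvg a (h.continuous_comp hx i).1)
    (continuous_const.add (continuous_expAvg b (h.continuous_comp hx i).2).sqrt) fun t => ?_).neg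
  exact (add_pos_of_pos_of_nonneg hε (Real.sqrt_nonneg _)).ne'

lemma Drift.causalField (h : Drift G S) (hε : 0 < ε) (ha : 0 ≤ a) (hb : 0 ≤ b) (x₀ : E d) :
    CausalField x₀ (velocity G S ε a b) where
  continuous x hx := h.continuous_velocity hε hx
  bounded T hT := ⟨d * √(Real.exp ((a + b) * T)), by positivity, fun x hx t ht =>
    norm_le_mul_of_forall_abs_le (h.abs_velocity_le hε ha hb hx ht)⟩
  lipschitz T R hT := by
    have hK := isCompact_closedBall x₀ R
    obtain ⟨L₁, hL₁0, hL₁⟩ := h.lipG _ hK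
    obtain ⟨L₂, hL₂0, hL₂⟩ := h.lipS _ hK
    obtain ⟨c, hc0, hc⟩ := h.exists_lower_bound hK
    obtain ⟨B, hB⟩ := hK.exists_bound_of_continuousOn h.lipG.continuous.continuousOn
    refine ⟨d * (L₁ / ε + |B| / (ε ^ 2 * √c) * L₂) + 1, by positivity,
      fun x y hx hy hxb hyb t ht D hD => ?_⟩
    have hD0 : 0 ≤ D := (norm_nonneg _).trans (hD 0 ⟨le_rfl, ht.1⟩)
    have hsub : ∀ s ∈ Set.Icc 0 t, x s ∈ Metric.closedBall x₀ R ∧ y s ∈ Metric.closedBall x₀ R := by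
      intro s hs
      have hs' : s ∈ Set.Icc 0 T := ⟨hs.1, hs.2.trans ht.2⟩
      simp only [mem_closedBall_iff_norm]
      exact ⟨hxb s hs', hyb s hs'⟩
    have key : ∀ i, |(velocity G S ε a b x t - velocity G S ε a b y t) i| ≤
        (L₁ / ε + |B| / (ε ^ 2 * √c) * L₂) * D := by
      intro i
      obtain ⟨hGx, hSx⟩ := h.continuous_comp hx i
      obtain ⟨hGy, hSy⟩ := h.continuous_comp hy i
      have h1 : |expAvg a (fun s => G (x s) i) t - expAvg a (fun s => G (y s) i) t| ≤ L₁ * D := by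
        refine abs_expAvg_sub_le a hGx hGy ht.1 fun s hs => ?_
        refine (abs_apply_le_norm (G (x s) - G (y s)) i).trans ?_
        exact (hL₁ _ (hsub s hs).1 _ (hsub s hs).2).trans
          (mul_le_mul_of_nonneg_left (hD s hs) hL₁0)
      have h2 : |expAvg b (fun s => S (x s) i) t - expAvg b (fun s => S (y s) i) t| ≤ L₂ * D := by
        refine abs_expAvg_sub_le b hSx hSy ht.1 fun s hs => ?_
        refine (abs_apply_le_norm (S (x s) - S (y s)) i).trans ?_
        exact (hL₂ _ (hsub s hs).1 _ (hsub s hs).2).trans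
          (mul_le_mul_of_nonneg_left (hD s hs) hL₂0)
      have h3 : |expAvg a (fun s => G (y s) i) t| ≤ |B| := by
        have := abs_expAvg_sub_le a hGy (continuous_const (y := (0 : ℝ))) ht.1 (D := |B|)
          fun s hs => by
            rw [sub_zero]
            exact (abs_apply_le_norm _ i).trans ((hB _ (hsub s hs).2).trans (le_abs_self B))
        rwa [expAvg_const, sub_zero] at this
      have h4 : c ≤ expAvg b (fun s => S (y s) i) t := by
        have := expAvg_mono b (continuous_const (y := c)) hSy ht.1
          fun s hs => hc _ (hsub s hs).2 i
        rwa [expAvg_const] at this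
      have h5 := abs_div_sub_div_le hε hc0 (h.expAvg_nonneg (b := b) hx i ht.1) h4 h3
        (p := expAvg a (fun s => G (x s) i) t)
      simp only [PiLp.sub_apply, velocity]
      rw [neg_sub_neg, abs_sub_comm]
      refine h5.trans ?_
      calc _ ≤ L₁ * D / ε + |B| / (ε ^ 2 * √c) * (L₂ * D) := by gcongr
        _ = _ := by ring
    refine (norm_le_mul_of_forall_abs_le key).trans ?_
    nlinarith

lemma hasDerivAt_of_forall_apply {y : ℝ → E d} {y' : E d} {t : ℝ}
    (h : ∀ i, HasDerivAt (fun t => y t i) (y' i) t) : HasDerivAt y y' t := by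
  have h1 : HasDerivAt (fun t => (fun i => y t i)) (fun i => y' i) t := hasDerivAt_pi.2 h
  exact ((EuclideanSpace.equiv (Fin d) ℝ).symm.toContinuousLinearMap.hasFDerivAt).comp_hasDerivAt
    t h1

lemma hasDerivAt_apply {y : ℝ → E d} {y' : E d} {t : ℝ} (h : HasDerivAt y y' t) (i : Fin d) :
    HasDerivAt (fun t => y t i) (y' i) t :=
  ((EuclideanSpace.proj (𝕜 := ℝ) i : E d →L[ℝ] ℝ).hasFDerivAt).comp_hasDerivAt t h

lemma hasDerivAt_components {w : ℝ → Z d} {w' : Z d} {t : ℝ} (h : HasDerivAt w w' t) :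
    HasDerivAt (fun t => (w t).1) w'.1 t ∧ (∀ i, HasDerivAt (fun t => (w t).2.1 i) (w'.2.1 i) t) ∧
      ∀ i, HasDerivAt (fun t => (w t).2.2 i) (w'.2.2 i) t := by
  have h1 := h.hasFDerivAt
  exact ⟨by simpa using h1.fst.hasDerivAt,
    fun i => hasDerivAt_apply (by simpa using h1.snd.fst.hasDerivAt) i,
    fun i => hasDerivAt_apply (by simpa using h1.snd.snd.hasDerivAt) i⟩

/-- The triple `(x, m, v)` obtained from a path `x` by adding the moment estimates. -/
noncomputable def lift (G S : E d → E d) (a b : ℝ) (x : ℝ → E d) (t : ℝ) : Z d :=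
  (x t, WithLp.toLp 2 fun i => relax a (fun s => G (x s) i) t,
    WithLp.toLp 2 fun i => relax b (fun s => S (x s) i) t)

lemma one_sub_exp_pos {c t : ℝ} (hc : 0 < c) (ht : 0 < t) : 0 < 1 - Real.exp (-c * t) := by
  have : Real.exp (-c * t) < 1 := Real.exp_lt_one_iff.2 (by nlinarith [mul_pos hc ht])
  linarith

variable {F : E d → ℝ} {x₀ : E d}

lemma Drift.hasDerivAt_lift (h : Drift G S) (hε : 0 < ε) (ha : 0 < a) (hb : 0 < b)
    (hF : ∀ x, gradient F x = G x) {x : ℝ → E d} (hx : Continuous x)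
    (hfix : ∀ t, x t = picard x₀ (velocity G S ε a b) x t) {t : ℝ} (ht : 0 < t) :
    HasDerivAt (lift G S a b x) (field F S ε a b t (lift G S a b x t)) t := by
  have hvel := h.continuous_velocity (a := a) (b := b) hε hx
  refine HasDerivAt.prodMk ?_ (HasDerivAt.prodMk ?_ ?_)
  · have h1 : HasDerivAt (fun t => x₀ + ∫ s in (0 : ℝ)..t, velocity G S ε a b x s)
        (velocity G S ε a b x t) t :=
      (intervalIntegral.integral_hasDerivAt_right (hvel.intervalIntegrable _ _)
        (hvel.stronglyMeasurableAtFilter _ _) hvel.continuousAt).const_add x₀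
    have h2 : HasDerivAt x (velocity G S ε a b x t) t := by
      refine h1.congr_of_eventuallyEq ?_
      filter_upwards [Ioi_mem_nhds ht] with s hs
      rw [hfix s, picard, max_eq_left (le_of_lt hs)]
    refine h2.congr_deriv ?_
    ext i
    simp [velocity, lift, expAvg_eq_relax_div ha _ ht, expAvg_eq_relax_div hb _ ht]
  · refine hasDerivAt_of_forall_apply fun i => ?_
    simpa [lift, hF] using hasDerivAt_relax a (h.continuous_comp hx i).1 t
  · refine hasDerivAt_of_forall_apply fun i => ?_
    simpa [lift] using hasDerivAt_relax b (h.continuous_comp hx i).2 t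

lemma Drift.continuous_lift (h : Drift G S) {x : ℝ → E d} (hx : Continuous x) :
    Continuous (lift G S a b x) := by
  have hrel : ∀ c {φ : ℝ → ℝ}, Continuous φ → Continuous (relax c φ) := fun c φ hφ =>
    continuous_iff_continuousAt.2 fun s => (hasDerivAt_relax c hφ s).continuousAt
  refine hx.prodMk (Continuous.prodMk ?_ ?_)
  · exact (PiLp.continuous_toLp 2 _).comp
      (continuous_pi fun i => hrel a (h.continuous_comp hx i).1)
  · exact (PiLp.continuous_toLp 2 _).comp
      (continuous_pi fun i => hrel b (h.continuous_comp hx i).2)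

lemma Drift.isGlobalSolution_lift (h : Drift G S) (hε : 0 < ε) (ha : 0 < a) (hb : 0 < b)
    (hF : ∀ x, gradient F x = G x) {x : ℝ → E d} (hx : Continuous x)
    (hfix : ∀ t, x t = picard x₀ (velocity G S ε a b) x t) :
    IsGlobalSolution F S ε a b x₀ (lift G S a b x) := by
  have hder := fun t (ht : 0 < t) => h.hasDerivAt_lift hε ha hb hF hx hfix ht
  have hcont := h.continuous_lift (a := a) (b := b) hx
  refine ⟨fun t ht i => ?_, hcont.continuousOn, ?_, hder, ?_⟩
  · rcases ht.eq_or_lt with rfl | ht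
    · simp [lift, relax_zero]
    · simp only [lift]
      rw [relax_eq_mul_expAvg]
      exact mul_nonneg (one_sub_exp_pos hb ht).le (h.expAvg_nonneg hx i ht.le)
  · refine (contDiffOn_one_iff_derivWithin (uniqueDiffOn_Ioi 0)).2
      ⟨fun t ht => (hder t ht).differentiableAt.differentiableWithinAt, ?_⟩
    have hG := h.lipG.continuous
    have hS := h.lipS.continuous
    have h1 : ContinuousOn (fun t => ((velocity G S ε a b x t,
        a • (G (lift G S a b x t).1 - (lift G S a b x t).2.1),
        b • (S (lift G S a b x t).1 - (lift G S a b x t).2.2)) : Z d)) (Set.Ioi 0) := by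
      refine Continuous.continuousOn ?_
      have := h.continuous_velocity (a := a) (b := b) hε hx
      have hfst := hcont.fst
      have hsnd := hcont.snd
      have h21 := hsnd.fst
      have h22 := hsnd.snd
      exact this.prodMk (((hG.comp hfst).sub h21).const_smul a |>.prodMk
        (((hS.comp hfst).sub h22).const_smul b))
    refine h1.congr fun t ht => ?_
    rw [HasDerivWithinAt.derivWithin (hder t ht).hasDerivWithinAt (uniqueDiffOn_Ioi 0 t ht)]
    ext i
    · simp [field, velocity, lift, expAvg_eq_relax_div ha _ ht, expAvg_eq_relax_div hb _ ht]
    · simp [field, hF]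
    · simp [field]
  · have : x 0 = x₀ := by rw [hfix 0]; simp [picard]
    simp only [lift, relax_zero, this]
    rfl

/-- Global well-posedness of the limiting equation.  The solution is the lift of a path that is a
fixed point of the Picard map. -/
lemma Drift.exists_unique_solution (h : Drift G S) (hε : 0 < ε) (ha : 0 < a) (hb : 0 < b)
    (hF : ∀ x, gradient F x = G x) (x₀ : E d) :
    ∃ x : ℝ → E d, Continuous x ∧ (∀ t, x t = picard x₀ (velocity G S ε a b) x t) ∧
      IsGlobalSolution F S ε a b x₀ (lift G S a b x) ∧
      ∀ w, IsGlobalSolution F S ε a b x₀ w → Set.EqOn w (lift G S a b x) (Set.Ici 0) := by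
  have hc := h.causalField hε ha.le hb.le x₀
  obtain ⟨x, hx, hfix⟩ := hc.exists_fixedPoint
  refine ⟨x, hx, hfix, h.isGlobalSolution_lift hε ha hb hF hx hfix, fun w hw => ?_⟩
  -- A solution is only controlled on `[0, ∞)`; freezing it at negative times makes it continuous.
  set y : ℝ → E d := fun t => (w (max t 0)).1 with hy
  have hwc : Continuous fun t => w (max t 0) :=
    hw.continuousOn.comp_continuous (by fun_prop) fun t => Set.mem_Ici.2 (le_max_right _ _)
  have hyc : Continuous y := hwc.fst
  have hywt : ∀ t, 0 ≤ t → y t = (w t).1 := fun t ht => by simp [hy, max_eq_left ht]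
  have hm : ∀ i, Set.EqOn (fun t => (w t).2.1 i) (relax a fun s => G (y s) i) (Set.Ici 0) := by
    intro i
    refine eqOn_relax (h.continuous_comp hyc i).1 ?_ (by simp [hw.init]) fun t ht => ?_
    · have := hw.continuousOn
      fun_prop
    · have := (hasDerivAt_components (hw.hasDerivAt t ht)).2.1 i
      simpa [field, hF, hywt t ht.le] using this
  have hv : ∀ i, Set.EqOn (fun t => (w t).2.2 i) (relax b fun s => S (y s) i) (Set.Ici 0) := by
    intro i
    refine eqOn_relax (h.continuous_comp hyc i).2 ?_ (by simp [hw.init]) fun t ht => ?_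
    · have := hw.continuousOn
      fun_prop
    · have := (hasDerivAt_components (hw.hasDerivAt t ht)).2.2 i
      simpa [field, hywt t ht.le] using this
  have hyd : ∀ t, 0 < t → HasDerivAt (fun t => (w t).1) (velocity G S ε a b y t) t := by
    intro t ht
    refine (hasDerivAt_components (hw.hasDerivAt t ht)).1.congr_deriv ?_
    ext i
    have h1 := hm i ht.le
    have h2 := hv i ht.le
    simp only at h1 h2
    simp [field, velocity, expAvg_eq_relax_div ha _ ht, expAvg_eq_relax_div hb _ ht, h1, h2]
  have hyfix : ∀ t, 0 ≤ t → y t = picard x₀ (velocity G S ε a b) y t := by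
    intro t ht
    have := intervalIntegral.integral_eq_sub_of_hasDerivAt_of_le ht
      ((continuous_fst.comp_continuousOn hw.continuousOn).mono Set.Icc_subset_Ici_self)
      (fun s hs => hyd s hs.1) ((hc.continuous y hyc).intervalIntegrable _ _)
    rw [picard, max_eq_left ht, this, hywt t ht]
    simp [hw.init]
  intro t ht
  have hxy : ∀ s, 0 ≤ s → y s = x s := fun s hs =>
    hc.unique hyc hx hs (fun r hr => hyfix r hr.1) (fun r _ => hfix r) ⟨hs, le_rfl⟩
  have hrel : ∀ c (H : E d → E d) (i : Fin d), relax c (fun s => H (y s) i) t =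
      relax c (fun s => H (x s) i) t := by
    intro c H i
    unfold relax
    congr 1
    refine intervalIntegral.integral_congr fun s hs => ?_
    rw [Set.uIcc_of_le ht] at hs
    simp only [hxy s hs.1]
  have h1 : (w t).1 = x t := by rw [← hywt t ht, hxy t ht]
  ext i
  · simp [lift, h1]
  · have := hm i ht
    simp only [hrel] at this
    simpa [lift] using this
  · have := hv i ht
    simp only [hrel] at this
    simpa [lift] using this

end Limit

/-! ### The mean gradient and the mean squared gradient -/

section MeanGradient

variable {d : ℕ} {Ξ : Type*}

open scoped InnerProductSpace RealInnerProductSpace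

/-- The Cauchy–Schwarz inequality, in the squared form. -/
lemma sq_integral_mul_le {X : Type*} [MeasurableSpace X] {μ : Measure X} {U V : X → ℝ}
    (hU : MemLp U 2 μ) (hV : MemLp V 2 μ) :
    (∫ x, U x * V x ∂μ) ^ 2 ≤ (∫ x, U x ^ 2 ∂μ) * ∫ x, V x ^ 2 ∂μ := by
  have hUV : Integrable (fun x => U x * V x) μ := hU.integrable_mul hV
  have h : ∀ t : ℝ, 0 ≤ (∫ x, V x ^ 2 ∂μ) * (t * t) + (-2 * ∫ x, U x * V x ∂μ) * t +
      ∫ x, U x ^ 2 ∂μ := by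
    intro t
    have h1 : 0 ≤ ∫ x, (U x - t * V x) ^ 2 ∂μ := integral_nonneg fun x => sq_nonneg _
    have h2 : ∫ x, (U x - t * V x) ^ 2 ∂μ =
        ∫ x, (t * t * V x ^ 2 + (-2 * t) * (U x * V x) + U x ^ 2) ∂μ :=
      integral_congr_ae (ae_of_all _ fun x => by ring)
    have hi1 : Integrable (fun x => t * t * V x ^ 2) μ := hV.integrable_sq.const_mul _
    have hi2 : Integrable (fun x => -2 * t * (U x * V x)) μ := hUV.const_mul _
    have hi3 : Integrable (fun x => t * t * V x ^ 2 + -2 * t * (U x * V x)) μ := hi1.add hi2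
    rw [h2, integral_add hi3 hU.integrable_sq, integral_add hi1 hi2, integral_const_mul,
      integral_const_mul] at h1
    linarith
  have := discrim_le_zero h
  rw [discrim] at this
  nlinarith

lemma inner_gradf {f : E d → Ξ → ℝ} {s : Ξ} (hdiff : Differentiable ℝ fun x => f x s) (x w : E d) :
    ⟪gradf f x s, w⟫_ℝ = fderiv ℝ (fun x => f x s) x w := by
  have h := (hdiff x).hasGradientAt.hasFDerivAt.fderiv
  rw [h]
  simp [gradf]

/-- First-order Taylor formula with integral remainder. -/
lemma gradf_contDiff_integral {f : E d → Ξ → ℝ} {s : Ξ} (hs : ContDiff ℝ 1 fun x => f x s)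
    (x y : E d) :
    f y s - f x s - ⟪gradf f x s, y - x⟫_ℝ =
      ∫ t in (0 : ℝ)..1, ⟪gradf f (x + t • (y - x)) s - gradf f x s, y - x⟫_ℝ := by
  have hd : Differentiable ℝ fun x => f x s := hs.differentiable one_ne_zero
  have hc : Continuous fun t : ℝ => ⟪gradf f (x + t • (y - x)) s, y - x⟫_ℝ := by
    simp only [inner_gradf hd]
    have := hs.continuous_fderiv one_ne_zero
    fun_prop
  have hder : ∀ t : ℝ, HasDerivAt (fun t => f (x + t • (y - x)) s)
      (⟪gradf f (x + t • (y - x)) s, y - x⟫_ℝ) t := by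
    intro t
    rw [inner_gradf hd]
    have h1 : HasDerivAt (fun t : ℝ => x + t • (y - x)) ((1 : ℝ) • (y - x)) t :=
      ((hasDerivAt_id t).smul_const (y - x)).const_add x
    rw [one_smul] at h1
    exact (hd (x + t • (y - x))).hasFDerivAt.comp_hasDerivAt t h1
  simp only [inner_sub_left]
  rw [intervalIntegral.integral_sub (hc.intervalIntegrable _ _) intervalIntegrable_const,
    intervalIntegral.integral_eq_sub_of_hasDerivAt (fun t _ => hder t) (hc.intervalIntegrable _ _)]
  simp

variable [MeasurableSpace Ξ]

/-- Joint measurability: the coordinates of the gradient are limits of difference quotients. -/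
lemma measurable_gradf {f : E d → Ξ → ℝ} (hf : Measurable (Function.uncurry f))
    (hdiff : ∀ s, Differentiable ℝ fun x => f x s) :
    Measurable fun p : E d × Ξ => gradf f p.1 p.2 := by
  have hcoord : ∀ i, Measurable fun p : E d × Ξ => gradf f p.1 p.2 i := by
    intro i
    set e : E d := EuclideanSpace.single i 1 with he
    have hlim : ∀ p : E d × Ξ, Tendsto (fun n : ℕ => (1 / ((n : ℝ) + 1))⁻¹ •
        (f (p.1 + (1 / ((n : ℝ) + 1)) • e) p.2 - f p.1 p.2)) atTop (𝓝 (gradf f p.1 p.2 i)) := by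
      intro p
      have h1 := HasLineDerivAt.tendsto_slope_zero ((hdiff p.2 p.1).hasFDerivAt.hasLineDerivAt e)
      have h2 : Tendsto (fun n : ℕ => 1 / ((n : ℝ) + 1)) atTop (𝓝[≠] 0) :=
        tendsto_nhdsWithin_iff.2 ⟨tendsto_one_div_add_atTop_nhds_zero_nat,
          Eventually.of_forall fun n => by
            simp only [Set.mem_compl_iff, Set.mem_singleton_iff]; positivity⟩
      have h3 : gradf f p.1 p.2 i = fderiv ℝ (fun x => f x p.2) p.1 e := by
        rw [← inner_gradf (hdiff p.2), he, EuclideanSpace.inner_single_right]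
        simp
      rw [h3]
      exact h1.comp h2
    refine measurable_of_tendsto_metrizable (fun n => ?_) (tendsto_pi_nhds.2 hlim)
    have h1 : Measurable fun p : E d × Ξ => f (p.1 + (1 / ((n : ℝ) + 1)) • e) p.2 :=
      hf.comp ((measurable_fst.add_const _).prodMk measurable_snd)
    have h2 : Measurable fun p : E d × Ξ => f p.1 p.2 := hf
    exact Measurable.const_smul (g := fun p : E d × Ξ => f (p.1 + (1 / ((n : ℝ) + 1)) • e) p.2 -
      f p.1 p.2) (h1.sub h2) (1 / ((n : ℝ) + 1))⁻¹
  exact (WithLp.measurable_toLp 2 (Fin d → ℝ)).comp (measurable_pi_lambda _ hcoord)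

/-- The mean gradient `E ∇f(x, ξ)`, as a vector-valued integral against the law `μ` of `ξ`. -/
noncomputable def meanGrad (μ : Measure Ξ) (f : E d → Ξ → ℝ) (x : E d) : E d :=
  ∫ s, gradf f x s ∂μ

/-- The mean squared gradient, as an integral against the law `μ` of `ξ`. -/
noncomputable def meanSqGrad (μ : Measure Ξ) (f : E d → Ξ → ℝ) (x : E d) : E d :=
  WithLp.toLp 2 fun i => ∫ s, gradf f x s i ^ 2 ∂μ

/-- The regularity of the gradient, in terms of the law `μ` of `ξ` alone. -/
structure RegularGrad (μ : Measure Ξ) (f : E d → Ξ → ℝ) : Prop where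
  measurable : Measurable fun p : E d × Ξ => gradf f p.1 p.2
  memLp : ∀ x, MemLp (gradf f x) 2 μ
  bounded : ∀ K : Set (E d), IsCompact K → ∃ C : ℝ, 0 ≤ C ∧
    ∀ x ∈ K, ∫ s, ‖gradf f x s‖ ^ 2 ∂μ ≤ C
  lipschitz : ∀ K : Set (E d), IsCompact K → ∃ L : ℝ, 0 < L ∧ ∀ x ∈ K, ∀ y ∈ K,
    ∫ s, ‖gradf f x s - gradf f y s‖ ^ 2 ∂μ ≤ L ^ 2 * ‖x - y‖ ^ 2

lemma memLp_of_moments {μ : Measure Ξ} [IsProbabilityMeasure μ] {f : E d → Ξ → ℝ}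
    (hmeas : Measurable fun p : E d × Ξ => gradf f p.1 p.2) {q : ℝ} (hq : 2 < q) {x : E d}
    (h : ∫⁻ s, ‖gradf f x s‖ₑ ^ q ∂μ < ∞) : MemLp (gradf f x) 2 μ := by
  have h1 : MemLp (gradf f x) (ENNReal.ofReal q) μ := by
    refine ⟨(hmeas.comp measurable_prodMk_left).aestronglyMeasurable, ?_⟩
    rw [eLpNorm_lt_top_iff_lintegral_rpow_enorm_lt_top (by simp; linarith) (by simp),
      ENNReal.toReal_ofReal (by linarith)]
    exact h
  refine h1.mono_exponent ?_
  rw [show (2 : ℝ≥0∞) = ENNReal.ofReal 2 by simp]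
  exact ENNReal.ofReal_le_ofReal hq.le

lemma integral_sq_norm_le_of_lintegral {μ : Measure Ξ} {g : Ξ → E d} (hg : MemLp g 2 μ) {C : ℝ}
    (hC : 0 ≤ C) (h : ∫⁻ s, ‖g s‖ₑ ^ 2 ∂μ ≤ ENNReal.ofReal C) : ∫ s, ‖g s‖ ^ 2 ∂μ ≤ C := by
  rw [← ENNReal.ofReal_le_ofReal_iff hC, ofReal_integral_eq_lintegral_ofReal
    (hg.integrable_norm_pow two_ne_zero) (ae_of_all _ fun s => by positivity)]
  refine le_trans (le_of_eq ?_) h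
  refine lintegral_congr fun s => ?_
  rw [ENNReal.ofReal_pow (norm_nonneg _), ofReal_norm]

variable {μ : Measure Ξ} {f : E d → Ξ → ℝ}

lemma RegularGrad.memLp_apply (h : RegularGrad μ f) (x : E d) (i : Fin d) :
    MemLp (fun s => gradf f x s i) 2 μ := by
  refine (h.memLp x).of_le ?_ (ae_of_all _ fun s => abs_apply_le_norm _ i)
  have := h.measurable.comp (measurable_prodMk_left (x := x))
  exact Measurable.aestronglyMeasurable (by fun_prop)

variable [IsProbabilityMeasure μ]

lemma RegularGrad.meanGrad_apply (h : RegularGrad μ f) (x : E d) (i : Fin d) :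
    meanGrad μ f x i = ∫ s, gradf f x s i ∂μ :=
  ((EuclideanSpace.proj (𝕜 := ℝ) i : E d →L[ℝ] ℝ).integral_comp_comm
    ((h.memLp x).integrable one_le_two)).symm

lemma RegularGrad.integral_norm_sub_le {K : Set (E d)} {L : ℝ} (h : RegularGrad μ f)
    (hL0 : 0 ≤ L) (hL : ∀ x ∈ K, ∀ y ∈ K,
      ∫ s, ‖gradf f x s - gradf f y s‖ ^ 2 ∂μ ≤ L ^ 2 * ‖x - y‖ ^ 2) {x y : E d} (hx : x ∈ K)
    (hy : y ∈ K) : ∫ s, ‖gradf f x s - gradf f y s‖ ∂μ ≤ L * ‖x - y‖ := by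
  have h1 := sq_integral_mul_le (((h.memLp x).sub (h.memLp y)).norm)
    (memLp_const (μ := μ) (p := 2) (1 : ℝ))
  simp only [mul_one, one_pow, integral_const, probReal_univ, smul_eq_mul, Pi.sub_apply] at h1
  refine le_of_sq_le_sq ?_ (by positivity)
  rw [mul_pow]
  exact h1.trans (hL x hx y hy)

lemma RegularGrad.drift (h : RegularGrad μ f) (hS : ∀ x i, 0 < meanSqGrad μ f x i) :
    Drift (meanGrad μ f) (meanSqGrad μ f) where
  lipG K hK := by
    obtain ⟨L, hL0, hL⟩ := h.lipschitz K hK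
    refine ⟨L, hL0.le, fun x hx y hy => ?_⟩
    unfold meanGrad
    rw [← integral_sub ((h.memLp x).integrable one_le_two) ((h.memLp y).integrable one_le_two)]
    exact (norm_integral_le_integral_norm _).trans (h.integral_norm_sub_le hL0.le hL hx hy)
  lipS K hK := by
    obtain ⟨L, hL0, hL⟩ := h.lipschitz K hK
    obtain ⟨C, hC0, hC⟩ := h.bounded K hK
    refine ⟨d * (L * √(4 * C)), by positivity, fun x hx y hy => ?_⟩
    rw [mul_assoc]
    refine norm_le_mul_of_forall_abs_le fun i => ?_
    have hX := h.memLp_apply x i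
    have hY := h.memLp_apply y i
    have hnX := (h.memLp x).integrable_norm_pow two_ne_zero
    have hnY := (h.memLp y).integrable_norm_pow two_ne_zero
    have h1 : ∫ s, (gradf f x s i - gradf f y s i) ^ 2 ∂μ ≤ L ^ 2 * ‖x - y‖ ^ 2 := by
      refine le_trans (integral_mono (hX.sub hY).integrable_sq
        (((h.memLp x).sub (h.memLp y)).integrable_norm_pow two_ne_zero) fun s => ?_) (hL x hx y hy)
      exact sq_le_sq.2 (by simpa using abs_apply_le_norm (gradf f x s - gradf f y s) i)
    have h2 : ∫ s, (gradf f x s i + gradf f y s i) ^ 2 ∂μ ≤ 4 * C := by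
      have h3 : ∫ s, (gradf f x s i + gradf f y s i) ^ 2 ∂μ ≤
          ∫ s, (2 * ‖gradf f x s‖ ^ 2 + 2 * ‖gradf f y s‖ ^ 2) ∂μ := by
        refine integral_mono (hX.add hY).integrable_sq
          ((hnX.const_mul 2).add (hnY.const_mul 2)) fun s => ?_
        have h4 := sq_le_sq.2 ((abs_apply_le_norm (gradf f x s) i).trans (le_abs_self _))
        have h5 := sq_le_sq.2 ((abs_apply_le_norm (gradf f y s) i).trans (le_abs_self _))
        simp only
        nlinarith [sq_nonneg (gradf f x s i - gradf f y s i)]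
      rw [integral_add (hnX.const_mul 2) (hnY.const_mul 2), integral_const_mul,
        integral_const_mul] at h3
      linarith [hC x hx, hC y hy]
    have h3 := sq_integral_mul_le (hX.sub hY) (hX.add hY)
    have h4 : (meanSqGrad μ f x - meanSqGrad μ f y) i =
        ∫ s, (gradf f x s i - gradf f y s i) * (gradf f x s i + gradf f y s i) ∂μ := by
      simp only [meanSqGrad, PiLp.sub_apply]
      rw [← integral_sub hX.integrable_sq hY.integrable_sq]
      exact integral_congr_ae (ae_of_all _ fun s => by ring)
    rw [h4]
    refine abs_le_of_sq_le_sq ?_ (by positivity)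
    refine h3.trans ((mul_le_mul h1 h2 (integral_nonneg fun s => sq_nonneg _)
      (by positivity)).trans (le_of_eq ?_))
    rw [mul_pow, mul_pow, Real.sq_sqrt (by positivity)]
    ring
  pos := hS
  sq_le x i := by
    have := sq_integral_mul_le (h.memLp_apply x i) (memLp_const (μ := μ) (p := 2) (1 : ℝ))
    rw [h.meanGrad_apply]
    simpa [meanSqGrad] using this

/-- First-order Taylor estimate in mean, from the mean-square Lipschitz bound on the gradient. -/
lemma RegularGrad.lintegral_taylor_le (h : RegularGrad μ f)
    (hcd : ∀ᵐ s ∂μ, ContDiff ℝ 1 fun x => f x s) {K : Set (E d)} (hK : Convex ℝ K) {L : ℝ}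
    (hL0 : 0 ≤ L) (hL : ∀ x ∈ K, ∀ y ∈ K,
      ∫ s, ‖gradf f x s - gradf f y s‖ ^ 2 ∂μ ≤ L ^ 2 * ‖x - y‖ ^ 2) {x y : E d} (hx : x ∈ K)
    (hy : y ∈ K) :
    ∫⁻ s, ‖f y s - f x s - ⟪gradf f x s, y - x⟫_ℝ‖ₑ ∂μ ≤ ENNReal.ofReal (L * ‖y - x‖ ^ 2) := by
  have hm := h.measurable
  have hmx := hm.comp (measurable_prodMk_left (x := x))
  calc ∫⁻ s, ‖f y s - f x s - ⟪gradf f x s, y - x⟫_ℝ‖ₑ ∂μ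
      ≤ ∫⁻ s, (∫⁻ t in Set.Ioc (0 : ℝ) 1,
          ‖⟪gradf f (x + t • (y - x)) s - gradf f x s, y - x⟫_ℝ‖ₑ) ∂μ := by
        refine lintegral_mono_ae ?_
        filter_upwards [hcd] with s hs
        rw [gradf_contDiff_integral hs, intervalIntegral.integral_of_le zero_le_one]
        exact enorm_integral_le_lintegral_enorm _
    _ = ∫⁻ t in Set.Ioc (0 : ℝ) 1, ∫⁻ s,
          ‖⟪gradf f (x + t • (y - x)) s - gradf f x s, y - x⟫_ℝ‖ₑ ∂μ := by
        refine lintegral_lintegral_swap (Measurable.aemeasurable ?_)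
        have h1 : Measurable fun p : Ξ × ℝ => gradf f (x + p.2 • (y - x)) p.1 :=
          hm.comp (((measurable_snd.smul_const _).const_add x).prodMk measurable_fst)
        have h2 : Measurable fun p : Ξ × ℝ => gradf f x p.1 := hmx.comp measurable_fst
        exact ((h1.sub h2).inner_const).enorm
    _ ≤ ∫⁻ t in Set.Ioc (0 : ℝ) 1, ENNReal.ofReal (L * ‖y - x‖ ^ 2) := by
        refine setLIntegral_mono measurable_const fun t ht => ?_
        have hz : x + t • (y - x) ∈ K := hK.add_smul_sub_mem hx hy ⟨ht.1.le, ht.2⟩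
        have hi : Integrable (fun s => gradf f (x + t • (y - x)) s - gradf f x s) μ :=
          ((h.memLp _).sub (h.memLp _)).integrable one_le_two
        have h1 := h.integral_norm_sub_le hL0 hL hz hx
        rw [add_sub_cancel_left, norm_smul, Real.norm_of_nonneg ht.1.le] at h1
        calc ∫⁻ s, ‖⟪gradf f (x + t • (y - x)) s - gradf f x s, y - x⟫_ℝ‖ₑ ∂μ
            ≤ ∫⁻ s, ENNReal.ofReal (‖gradf f (x + t • (y - x)) s - gradf f x s‖ * ‖y - x‖) ∂μ := by
              refine lintegral_mono fun s => ?_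
              rw [← ofReal_norm]
              exact ENNReal.ofReal_le_ofReal (norm_inner_le_norm _ _)
          _ = ENNReal.ofReal (∫ s, ‖gradf f (x + t • (y - x)) s - gradf f x s‖ * ‖y - x‖ ∂μ) :=
              (ofReal_integral_eq_lintegral_ofReal (hi.norm.mul_const _)
                (ae_of_all _ fun s => by positivity)).symm
          _ ≤ ENNReal.ofReal (L * ‖y - x‖ ^ 2) := by
              refine ENNReal.ofReal_le_ofReal ?_
              rw [integral_mul_const]
              calc _ ≤ L * (t * ‖y - x‖) * ‖y - x‖ := by gcongr
                _ ≤ L * (1 * ‖y - x‖) * ‖y - x‖ := by gcongr; exact ht.2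
                _ = _ := by ring
    _ = ENNReal.ofReal (L * ‖y - x‖ ^ 2) := by simp

/-- Differentiation under the expectation: the gradient of `x ↦ E f(x, ξ)` is the mean gradient. -/
lemma RegularGrad.hasGradientAt (h : RegularGrad μ f) (hmeas : ∀ x, Measurable (f x))
    (hcd : ∀ᵐ s ∂μ, ContDiff ℝ 1 fun x => f x s) {x₁ : E d} (hx₁ : Integrable (f x₁) μ) (x : E d) :
    HasGradientAt (fun x => ∫ s, f x s ∂μ) (meanGrad μ f x) x := by
  have hin : ∀ x w : E d, Integrable (fun s => ⟪gradf f x s, w⟫_ℝ) μ := fun x w =>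
    ((h.memLp x).integrable one_le_two).inner_const w
  have hint : ∀ y, Integrable (f y) μ := by
    intro y
    obtain ⟨L, hL0, hL⟩ := h.lipschitz _ (isCompact_closedBall x₁ ‖y - x₁‖)
    have h1 := h.lintegral_taylor_le hcd (convex_closedBall _ _) hL0.le hL
      (Metric.mem_closedBall_self (norm_nonneg _)) (mem_closedBall_iff_norm.2 (le_refl ‖y - x₁‖))
    have h2 : Integrable (fun s => f y s - f x₁ s - ⟪gradf f x₁ s, y - x₁⟫_ℝ) μ :=
      ⟨(((hmeas y).sub (hmeas x₁)).aestronglyMeasurable).sub (hin _ _).aestronglyMeasurable,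
        h1.trans_lt ENNReal.ofReal_lt_top⟩
    refine ((h2.add (hin x₁ (y - x₁))).add hx₁).congr (ae_of_all _ fun s => ?_)
    simp
  obtain ⟨L, hL0, hL⟩ := h.lipschitz _ (isCompact_closedBall x 1)
  have hbound : ∀ y ∈ Metric.closedBall x 1,
      |(∫ s, f y s ∂μ) - (∫ s, f x s ∂μ) - ⟪meanGrad μ f x, y - x⟫_ℝ| ≤ L * ‖y - x‖ ^ 2 := by
    intro y hy
    have h1 := h.lintegral_taylor_le hcd (convex_closedBall _ _) hL0.le hL
      (Metric.mem_closedBall_self zero_le_one) hy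
    have h2 : (∫ s, f y s ∂μ) - (∫ s, f x s ∂μ) - ⟪meanGrad μ f x, y - x⟫_ℝ =
        ∫ s, (f y s - f x s - ⟪gradf f x s, y - x⟫_ℝ) ∂μ := by
      have hi : Integrable (fun s => f y s - f x s) μ := (hint y).sub (hint x)
      rw [integral_sub hi (hin _ _), integral_sub (hint y) (hint x)]
      congr 1
      simp only [real_inner_comm (y - x)]
      exact (integral_inner ((h.memLp x).integrable one_le_two) (y - x)).symm
    rw [h2, ← ENNReal.ofReal_le_ofReal_iff (by positivity), ← Real.norm_eq_abs, ofReal_norm]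
    exact (enorm_integral_le_lintegral_enorm _).trans h1
  rw [hasGradientAt_iff_isLittleO, Asymptotics.isLittleO_iff]
  intro c hc
  filter_upwards [Metric.ball_mem_nhds x (lt_min one_pos (div_pos hc hL0))] with y hy
  rw [mem_ball_iff_norm, lt_min_iff, lt_div_iff₀ hL0] at hy
  refine (hbound y (mem_closedBall_iff_norm.2 hy.1.le)).trans ?_
  nlinarith [norm_nonneg (y - x)]

end MeanGradient

section Model

variable {d : ℕ} {Ω Ξ : Type*} [MeasurableSpace Ω] [MeasurableSpace Ξ] {P : Measure Ω}
  {f : E d → Ξ → ℝ} {ξ : Ω → Ξ}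

lemma Model.regularGrad [IsProbabilityMeasure P] (h : Model P ξ f)
    (hf : Measurable (Function.uncurry f)) (hdiff : ∀ s, Differentiable ℝ fun x => f x s)
    (hξ : Measurable ξ) (hmom : MomentsAbove P ξ f 2) : RegularGrad (P.map ξ) f := by
  have : IsProbabilityMeasure (P.map ξ) := Measure.isProbabilityMeasure_map hξ.aemeasurable
  have hm := measurable_gradf hf hdiff
  have hmx : ∀ x, Measurable (gradf f x) := fun x => hm.comp measurable_prodMk_left
  have hmem : ∀ x, MemLp (gradf f x) 2 (P.map ξ) := by
    intro x
    obtain ⟨q, hq, hfin⟩ := hmom {x} isCompact_singleton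
    refine memLp_of_moments hm hq ?_
    rw [lintegral_map ((hmx x).enorm.pow_const q) hξ]
    simpa using hfin
  refine ⟨hm, hmem, fun K hK => ?_, fun K hK => ?_⟩
  · obtain ⟨q, hq, hfin⟩ := hmom K hK
    set A := ⨆ x ∈ K, ∫⁻ ω, ‖gradf f x (ξ ω)‖ₑ ^ q ∂P with hA
    refine ⟨(1 + A).toReal, ENNReal.toReal_nonneg, fun x hx => ?_⟩
    refine integral_sq_norm_le_of_lintegral (hmem x) ENNReal.toReal_nonneg ?_
    rw [ENNReal.ofReal_toReal (by finiteness), lintegral_map ((hmx x).enorm.pow_const 2) hξ]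
    calc ∫⁻ ω, ‖gradf f x (ξ ω)‖ₑ ^ 2 ∂P ≤ ∫⁻ ω, (1 + ‖gradf f x (ξ ω)‖ₑ ^ q) ∂P := by
          refine lintegral_mono fun ω => ?_
          simp only
          rcases le_total ‖gradf f x (ξ ω)‖ₑ 1 with h1 | h1
          · exact (pow_le_one₀ zero_le h1).trans le_self_add
          · rw [← ENNReal.rpow_natCast]
            exact (ENNReal.rpow_le_rpow_of_exponent_le h1 (by simpa using hq.le)).trans
              le_add_self
      _ = 1 + ∫⁻ ω, ‖gradf f x (ξ ω)‖ₑ ^ q ∂P := by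
          rw [lintegral_add_left measurable_const]; simp
      _ ≤ 1 + A := by gcongr; exact le_iSup₂_of_le x hx le_rfl
  · obtain ⟨L, hL0, hL⟩ := h.lipschitz K hK
    refine ⟨L, hL0, fun x hx y hy => ?_⟩
    refine integral_sq_norm_le_of_lintegral ((hmem x).sub (hmem y)) (by positivity) ?_
    rw [lintegral_map (((hmx x).sub (hmx y)).enorm.pow_const 2) hξ]
    exact hL x hx y hy

lemma S_eq_meanSqGrad (hξ : Measurable ξ)
    (hm : Measurable fun p : E d × Ξ => gradf f p.1 p.2) : S P ξ f = meanSqGrad (P.map ξ) f := by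
  funext x
  ext i
  have := hm.comp (measurable_prodMk_left (x := x))
  simp only [S, meanSqGrad]
  rw [integral_map hξ.aemeasurable]
  exact Measurable.aestronglyMeasurable (by fun_prop)

lemma Model.gradient_F [IsProbabilityMeasure P] (h : Model P ξ f) (hξ : Measurable ξ)
    (hreg : RegularGrad (P.map ξ) f) (x : E d) : gradient (F P ξ f) x = meanGrad (P.map ξ) f x := by
  have : IsProbabilityMeasure (P.map ξ) := Measure.isProbabilityMeasure_map hξ.aemeasurable
  obtain ⟨x₁, hx₁, -⟩ := h.moments
  have hint : Integrable (f x₁) (P.map ξ) :=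
    ⟨(h.measurable x₁).aestronglyMeasurable, by
      rw [HasFiniteIntegral, lintegral_map (h.measurable x₁).enorm hξ]; exact hx₁⟩
  have hF : F P ξ f = fun x => ∫ s, f x s ∂(P.map ξ) := by
    funext x
    rw [F, integral_map hξ.aemeasurable (h.measurable x).aestronglyMeasurable]
  rw [hF]
  exact (hreg.hasGradientAt h.measurable h.contDiff hint x).gradient

end Model

/-! ### Fluctuations of sums of centered innovations -/

section Truncation

variable {Ξ A : Type*}

/-- The part of `φ` above the truncation level `M`. -/
noncomputable def tail (M : ℝ) (φ : A → Ξ → ℝ) (x : A) (s : Ξ) : ℝ :=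
  if |φ x s| ≤ M then 0 else φ x s

lemma abs_sub_tail_le {M : ℝ} (hM : 0 ≤ M) (φ : A → Ξ → ℝ) (x : A) (s : Ξ) :
    |φ x s - tail M φ x s| ≤ M := by
  unfold tail
  split_ifs with h
  · simpa using h
  · simpa using hM

variable [MeasurableSpace Ξ] {μ : Measure Ξ}

/-- Moments of order `q > 1` make the tails uniformly small. -/
lemma exists_lintegral_tail_le {φ : A → Ξ → ℝ} {K : Set A} {q C : ℝ} (hq : 1 < q)
    (hC : ∀ x ∈ K, ∫⁻ s, ‖φ x s‖ₑ ^ q ∂μ ≤ ENNReal.ofReal C) {θ : ℝ} (hθ : 0 < θ) :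
    ∃ M, 0 < M ∧ ∀ x ∈ K, ∫⁻ s, ‖tail M φ x s‖ₑ ∂μ ≤ ENNReal.ofReal θ := by
  have hlim : Tendsto (fun M : ℝ => M ^ (-(q - 1)) * C) atTop (𝓝 0) := by
    simpa using (tendsto_rpow_neg_atTop (by linarith : 0 < q - 1)).mul_const C
  obtain ⟨M, hMθ, hM0⟩ := ((hlim.eventually_lt_const hθ).and (eventually_gt_atTop 0)).exists
  refine ⟨M, hM0, fun x hx => ?_⟩
  have hpt : ∀ s, ‖tail M φ x s‖ₑ ≤ ENNReal.ofReal (M ^ (-(q - 1))) * ‖φ x s‖ₑ ^ q := by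
    intro s
    unfold tail
    split_ifs with h
    · simp
    · push Not at h
      have h0 : 0 < |φ x s| := hM0.trans h
      rw [← ofReal_norm, ENNReal.ofReal_rpow_of_nonneg (norm_nonneg _) (by linarith),
        ← ENNReal.ofReal_mul (by positivity), Real.norm_eq_abs]
      refine ENNReal.ofReal_le_ofReal ?_
      have h1 : |φ x s| ^ (-(q - 1)) ≤ M ^ (-(q - 1)) :=
        Real.rpow_le_rpow_of_nonpos hM0 h.le (by linarith)
      calc |φ x s| = |φ x s| ^ (-(q - 1)) * |φ x s| ^ q := by
            rw [← Real.rpow_add h0]; simp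
        _ ≤ _ := by gcongr
  calc ∫⁻ s, ‖tail M φ x s‖ₑ ∂μ
      ≤ ∫⁻ s, ENNReal.ofReal (M ^ (-(q - 1))) * ‖φ x s‖ₑ ^ q ∂μ := lintegral_mono hpt
    _ = ENNReal.ofReal (M ^ (-(q - 1))) * ∫⁻ s, ‖φ x s‖ₑ ^ q ∂μ :=
        lintegral_const_mul' _ _ ENNReal.ofReal_ne_top
    _ ≤ ENNReal.ofReal (M ^ (-(q - 1))) * ENNReal.ofReal C := by gcongr; exact hC x hx
    _ = ENNReal.ofReal (M ^ (-(q - 1)) * C) := (ENNReal.ofReal_mul (by positivity)).symm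
    _ ≤ ENNReal.ofReal θ := ENNReal.ofReal_le_ofReal hMθ.le

lemma measurable_tail [MeasurableSpace A] (M : ℝ) {φ : A → Ξ → ℝ}
    (hφ : Measurable (Function.uncurry φ)) : Measurable (Function.uncurry (tail M φ)) := by
  have : Measurable fun p : A × Ξ => φ p.1 p.2 := hφ
  exact Measurable.ite (measurableSet_le this.abs measurable_const) measurable_const this

end Truncation

section Noise

variable {Ω Ξ A : Type*} [MeasurableSpace Ξ]

/-- The `σ`-algebra generated by `ζ 0, …, ζ (n - 1)`. -/
abbrev past (ζ : ℕ → Ω → Ξ) (n : ℕ) : MeasurableSpace Ω :=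
  ⨆ k ∈ Set.Iio n, MeasurableSpace.comap (ζ k) inferInstance

lemma past_mono (ζ : ℕ → Ω → Ξ) {m n : ℕ} (h : m ≤ n) : past ζ m ≤ past ζ n :=
  biSup_mono fun _ hk => lt_of_lt_of_le hk h

lemma measurable_past (ζ : ℕ → Ω → Ξ) {k n : ℕ} (h : k < n) : Measurable[past ζ n] (ζ k) :=
  measurable_iff_comap_le.2
    (le_iSup₂_of_le (f := fun k (_ : k ∈ Set.Iio n) => MeasurableSpace.comap (ζ k) inferInstance)
      k h le_rfl)

variable [mΩ : MeasurableSpace Ω]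

lemma past_le {ζ : ℕ → Ω → Ξ} (hζ : ∀ n, Measurable (ζ n)) (n : ℕ) : past ζ n ≤ mΩ :=
  iSup₂_le fun k _ => (hζ k).comap_le

variable [MeasurableSpace A] {P : Measure Ω} [IsProbabilityMeasure P] {μ : Measure Ξ}
  {ζ : ℕ → Ω → Ξ}

/-- Independent random variables with a common law. -/
structure IsIID (P : Measure Ω) (μ : Measure Ξ) (ζ : ℕ → Ω → Ξ) : Prop where
  measurable : ∀ n, Measurable (ζ n)
  indep : iIndepFun ζ P
  law : ∀ n, P.map (ζ n) = μ

/-- What is determined by the past is independent of the next innovation, so that their joint law is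
a product. -/
lemma IsIID.map_prodMk (h : IsIID P μ ζ) {β : Type*} [MeasurableSpace β] {n : ℕ} {W : Ω → β}
    (hW : Measurable[past ζ n] W) :
    P.map (fun ω => (W ω, ζ n ω)) = (P.map W).prod μ := by
  have h1 : Indep (⨆ k ∈ Set.Iio n, MeasurableSpace.comap (ζ k) inferInstance)
      (⨆ k ∈ ({n} : Set ℕ), MeasurableSpace.comap (ζ k) inferInstance) P :=
    indep_iSup_of_disjoint (fun k => (h.measurable k).comap_le) h.indep
      (Set.disjoint_singleton_right.2 (by simp))
  have h2 : IndepFun W (ζ n) P := by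
    refine indep_of_indep_of_le_left (indep_of_indep_of_le_right h1 ?_) hW.comap_le
    simp
  rw [(indepFun_iff_map_prod_eq_prod_map_map
    ((hW.mono (past_le h.measurable n) le_rfl).aemeasurable) (h.measurable n).aemeasurable).1 h2,
    h.law]

lemma IsIID.isProbabilityMeasure (h : IsIID P μ ζ) : IsProbabilityMeasure μ := by
  rw [← h.law 0]
  exact Measure.isProbabilityMeasure_map (h.measurable 0).aemeasurable

/-- A centered innovation is orthogonal to every bounded function of the past. -/
lemma IsIID.integral_mul_eq_zero (h : IsIID P μ ζ) {ψ : A → Ξ → ℝ}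
    (hψ : Measurable (Function.uncurry ψ)) {B : ℝ} (hB : ∀ x s, |ψ x s| ≤ B)
    (h0 : ∀ x, ∫ s, ψ x s ∂μ = 0) {n : ℕ} {W : Ω → ℝ} {Y : Ω → A} (hW : Measurable[past ζ n] W)
    (hY : Measurable[past ζ n] Y) {C : ℝ} (hC : ∀ ω, |W ω| ≤ C) :
    ∫ ω, W ω * ψ (Y ω) (ζ n ω) ∂P = 0 := by
  have := h.isProbabilityMeasure
  have hWY : Measurable[past ζ n] fun ω => (W ω, Y ω) := hW.prodMk hY
  have hWY' : Measurable fun ω => (W ω, Y ω) := hWY.mono (past_le h.measurable n) le_rfl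
  have hpair : Measurable fun ω => ((W ω, Y ω), ζ n ω) := hWY'.prodMk (h.measurable n)
  have hg : Measurable fun p : (ℝ × A) × Ξ => p.1.1 * ψ p.1.2 p.2 :=
    measurable_fst.fst.mul (hψ.comp (measurable_fst.snd.prodMk measurable_snd))
  have hint : Integrable (fun ω => W ω * ψ (Y ω) (ζ n ω)) P := by
    refine Integrable.of_bound (hg.comp hpair).aestronglyMeasurable (C * B)
      (ae_of_all _ fun ω => ?_)
    rw [norm_mul]
    exact mul_le_mul (hC ω) (hB _ _) (norm_nonneg _) ((abs_nonneg _).trans (hC ω))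
  have hint' : Integrable (fun p : (ℝ × A) × Ξ => p.1.1 * ψ p.1.2 p.2)
      ((P.map fun ω => (W ω, Y ω)).prod μ) := by
    rw [← h.map_prodMk hWY, integrable_map_measure hg.aestronglyMeasurable hpair.aemeasurable]
    exact hint
  have := Measure.isProbabilityMeasure_map (μ := P) hWY'.aemeasurable
  calc ∫ ω, W ω * ψ (Y ω) (ζ n ω) ∂P
      = ∫ p, p.1.1 * ψ p.1.2 p.2 ∂(P.map fun ω => ((W ω, Y ω), ζ n ω)) :=
        (integral_map hpair.aemeasurable hg.aestronglyMeasurable).symm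
    _ = 0 := by
        rw [h.map_prodMk hWY, integral_prod _ hint']
        simp [integral_const_mul, h0]

/-- Moments of a martingale with increments bounded by `B`, from `(N + η)⁴ ≤
N⁴ + 4 N³ η + 8 N² η² + 3 η⁴`. -/
lemma IsIID.integral_pow_four_le (h : IsIID P μ ζ) {ψ : A → Ξ → ℝ}
    (hψ : Measurable (Function.uncurry ψ)) {B : ℝ} (hB : ∀ x s, |ψ x s| ≤ B)
    (h0 : ∀ x, ∫ s, ψ x s ∂μ = 0) {X : ℕ → Ω → A} (hX : ∀ n, Measurable[past ζ n] (X n)) (n : ℕ) :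
    Integrable (fun ω => (∑ k ∈ Finset.range n, ψ (X k ω) (ζ k ω)) ^ 4) P ∧
    ∫ ω, (∑ k ∈ Finset.range n, ψ (X k ω) (ζ k ω)) ^ 4 ∂P ≤ 4 * n ^ 2 * B ^ 4 := by
  set M : ℕ → Ω → ℝ := fun n ω => ∑ k ∈ Finset.range n, ψ (X k ω) (ζ k ω) with hM
  have hMm : ∀ n, Measurable[past ζ n] (M n) := by
    intro n
    refine Finset.measurable_sum _ fun k hk => ?_
    have hk := Finset.mem_range.1 hk
    exact hψ.comp (((hX k).mono (past_mono ζ hk.le) le_rfl).prodMk (measurable_past ζ hk))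
  have hMm' : ∀ n, Measurable (M n) := fun n => (hMm n).mono (past_le h.measurable n) le_rfl
  have hMb : ∀ n ω, |M n ω| ≤ n * B := by
    intro n ω
    refine (Finset.abs_sum_le_sum_abs _ _).trans
      ((Finset.sum_le_sum fun k _ => hB (X k ω) (ζ k ω)).trans (by simp))
  have hpint : ∀ n p, Integrable (fun ω => M n ω ^ p) P := by
    intro n p
    refine Integrable.of_bound ((hMm' n).pow_const p).aestronglyMeasurable ((n * B) ^ p)
      (ae_of_all _ fun ω => ?_)
    rw [norm_pow]
    exact pow_le_pow_left₀ (norm_nonneg _) (hMb n ω) p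
  have hη : ∀ n, Measurable fun ω => ψ (X n ω) (ζ n ω) := fun n =>
    hψ.comp (((hX n).mono (past_le h.measurable n) le_rfl).prodMk (h.measurable n))
  have hcross : ∀ n p, Integrable (fun ω => M n ω ^ p * ψ (X n ω) (ζ n ω)) P ∧
      ∫ ω, M n ω ^ p * ψ (X n ω) (ζ n ω) ∂P = 0 := by
    intro n p
    refine ⟨(hpint n p).mul_bdd (c := B) (hη n).aestronglyMeasurable
      (ae_of_all _ fun ω => hB _ _), ?_⟩
    refine h.integral_mul_eq_zero hψ hB h0 ((hMm n).pow_const p) (hX n) (C := (n * B) ^ p)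
      fun ω => ?_
    rw [abs_pow]
    exact pow_le_pow_left₀ (abs_nonneg _) (hMb n ω) p
  have hsq : ∀ x s, ψ x s ^ 2 ≤ B ^ 2 := fun x s =>
    sq_le_sq.2 ((hB x s).trans (le_abs_self B))
  have h2 : ∀ n : ℕ, ∫ ω, M n ω ^ 2 ∂P ≤ n * B ^ 2 := by
    intro n
    induction n with
    | zero => simp [hM]
    | succ n ih =>
      have hi1 := (hcross n 1).1.const_mul 2
      have hi2 : Integrable (fun ω => M n ω ^ 2 + 2 * (M n ω ^ 1 * ψ (X n ω) (ζ n ω))) P :=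
        (hpint n 2).add hi1
      have hle : ∫ ω, M (n + 1) ω ^ 2 ∂P ≤
          ∫ ω, (M n ω ^ 2 + 2 * (M n ω ^ 1 * ψ (X n ω) (ζ n ω)) + B ^ 2) ∂P := by
        refine integral_mono (hpint _ _) (hi2.add (integrable_const _)) fun ω => ?_
        have e : M (n + 1) ω = M n ω + ψ (X n ω) (ζ n ω) := Finset.sum_range_succ _ _
        simp only [e]
        nlinarith [hsq (X n ω) (ζ n ω)]
      rw [integral_add hi2 (integrable_const _), integral_add (hpint n 2) hi1,
        integral_const_mul, (hcross n 1).2] at hle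
      simp only [integral_const, probReal_univ, smul_eq_mul] at hle
      push_cast
      linarith
  refine ⟨hpint n 4, ?_⟩
  change ∫ ω, M n ω ^ 4 ∂P ≤ _
  induction n with
  | zero => simp [hM]
  | succ n ih =>
    have hi1 := (hcross n 3).1.const_mul 4
    have hi2 : Integrable (fun ω => M n ω ^ 4 + 4 * (M n ω ^ 3 * ψ (X n ω) (ζ n ω))) P :=
      (hpint n 4).add hi1
    have hi3 := (hpint n 2).const_mul (8 * B ^ 2)
    have hi4 : Integrable (fun ω => M n ω ^ 4 + 4 * (M n ω ^ 3 * ψ (X n ω) (ζ n ω)) +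
        8 * B ^ 2 * M n ω ^ 2) P := hi2.add hi3
    have hle : ∫ ω, M (n + 1) ω ^ 4 ∂P ≤ ∫ ω, (M n ω ^ 4 +
        4 * (M n ω ^ 3 * ψ (X n ω) (ζ n ω)) + 8 * B ^ 2 * M n ω ^ 2 + 3 * B ^ 4) ∂P := by
      refine integral_mono (hpint _ _) (hi4.add (integrable_const _)) fun ω => ?_
      have e : M (n + 1) ω = M n ω + ψ (X n ω) (ζ n ω) := Finset.sum_range_succ _ _
      simp only [e]
      generalize M n ω = N
      have h3 := hsq (X n ω) (ζ n ω)
      generalize ψ (X n ω) (ζ n ω) = η at h3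
      have h4 : η ^ 4 ≤ B ^ 4 := by nlinarith [sq_nonneg η]
      have h5 : N ^ 2 * η ^ 2 ≤ N ^ 2 * B ^ 2 := mul_le_mul_of_nonneg_left h3 (sq_nonneg N)
      nlinarith [mul_nonneg (sq_nonneg η) (sq_nonneg (N - η))]
    rw [integral_add hi4 (integrable_const _), integral_add hi2 hi3,
      integral_add (hpint n 4) hi1, integral_const_mul, integral_const_mul, (hcross n 3).2] at hle
    simp only [integral_const, probReal_univ, smul_eq_mul] at hle
    have h5 := mul_le_mul_of_nonneg_left (h2 n) (by positivity : 0 ≤ 8 * B ^ 2)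
    push_cast
    have h6 : 0 ≤ B ^ 4 := by positivity
    nlinarith

/-- Maximal inequality by a union bound over the number of terms: the fourth moments are small
enough for their sum to be. -/
lemma IsIID.measureReal_exists_le (h : IsIID P μ ζ) {ψ : A → Ξ → ℝ}
    (hψ : Measurable (Function.uncurry ψ)) {B : ℝ} (hB : ∀ x s, |ψ x s| ≤ B)
    (h0 : ∀ x, ∫ s, ψ x s ∂μ = 0) {X : ℕ → Ω → A} (hX : ∀ n, Measurable[past ζ n] (X n)) (N : ℕ)
    {r : ℝ} (hr : 0 < r) :
    P.real {ω | ∃ n ≤ N, r ≤ |∑ k ∈ Finset.range n, ψ (X k ω) (ζ k ω)|} ≤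
      (N + 1) * (4 * N ^ 2 * B ^ 4 / r ^ 4) := by
  have hsub : {ω | ∃ n ≤ N, r ≤ |∑ k ∈ Finset.range n, ψ (X k ω) (ζ k ω)|} ⊆
      ⋃ n ∈ Finset.range (N + 1),
        {ω | r ^ 4 ≤ (∑ k ∈ Finset.range n, ψ (X k ω) (ζ k ω)) ^ 4} := by
    rintro ω ⟨n, hn, hω⟩
    simp only [Set.mem_iUnion, Finset.mem_range, Set.mem_ofPred_eq]
    refine ⟨n, by omega, ?_⟩
    rw [← Even.pow_abs (by decide : Even 4) (∑ k ∈ Finset.range n, ψ (X k ω) (ζ k ω))]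
    exact pow_le_pow_left₀ hr.le hω 4
  refine (measureReal_mono hsub (measure_ne_top _ _)).trans
    ((measureReal_biUnion_finset_le _ _).trans ?_)
  refine (Finset.sum_le_sum (g := fun _ => 4 * (N : ℝ) ^ 2 * B ^ 4 / r ^ 4) fun n hn => ?_).trans
    (by simp)
  have hn : n ≤ N := by simpa [Nat.lt_succ_iff] using hn
  obtain ⟨hi, h4⟩ := h.integral_pow_four_le hψ hB h0 hX n
  have := mul_meas_ge_le_integral_of_nonneg (ae_of_all _ fun ω => by positivity) hi (r ^ 4)
  rw [le_div_iff₀' (by positivity)]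
  refine this.trans (h4.trans ?_)
  gcongr

lemma IsIID.lintegral_comp_le (h : IsIID P μ ζ) {ρ : A → Ξ → ℝ≥0∞}
    (hρ : Measurable (Function.uncurry ρ)) {n : ℕ} {Y : Ω → A} (hY : Measurable[past ζ n] Y)
    {c : ℝ≥0∞} (hc : ∀ ω, ∫⁻ s, ρ (Y ω) s ∂μ ≤ c) : ∫⁻ ω, ρ (Y ω) (ζ n ω) ∂P ≤ c := by
  have := h.isProbabilityMeasure
  have hY' : Measurable Y := hY.mono (past_le h.measurable n) le_rfl
  calc ∫⁻ ω, ρ (Y ω) (ζ n ω) ∂P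
      = ∫⁻ p, Function.uncurry ρ p ∂(P.map fun ω => (Y ω, ζ n ω)) :=
        (lintegral_map hρ (hY'.prodMk (h.measurable n))).symm
    _ = ∫⁻ ω, ∫⁻ s, ρ (Y ω) s ∂μ ∂P := by
        rw [h.map_prodMk hY, lintegral_prod _ hρ.aemeasurable,
          lintegral_map hρ.lintegral_prod_right' hY']
        rfl
    _ ≤ ∫⁻ _, c ∂P := lintegral_mono hc
    _ = c := by simp

/-- Law of large numbers along an adapted sequence, uniformly over the number of terms and over the
sequence: the accumulated centered innovations, multiplied by the step size, vanish in probability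
with the step size.  The tails of `φ` are dealt with in the mean, the truncated part by fourth
moments and a union bound. -/
theorem IsIID.measure_exists_le (h : IsIID P μ ζ) {φ : A → Ξ → ℝ}
    (hφ : Measurable (Function.uncurry φ)) {K : Set A} {q C : ℝ} (hq : 1 < q)
    (hC : ∀ x ∈ K, ∫⁻ s, ‖φ x s‖ₑ ^ q ∂μ ≤ ENNReal.ofReal C) {T δ η : ℝ} (hT : 0 ≤ T)
    (hδ : 0 < δ) (hη : 0 < η) :
    ∀ᶠ γ : ℝ in 𝓝[>] 0, ∀ X : ℕ → Ω → A, (∀ n, Measurable[past ζ n] (X n)) →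
      (∀ (n : ℕ) ω, n * γ < T → X n ω ∈ K) →
      P {ω | ∃ n : ℕ, n * γ ≤ T ∧ δ < γ * |∑ k ∈ Finset.range n,
        (φ (X k ω) (ζ k ω) - ∫ s, φ (X k ω) s ∂μ)|} ≤ ENNReal.ofReal η := by
  have := h.isProbabilityMeasure
  -- The level `θ` bounds the mean tail: `T θ` controls both the bias caused by the truncation and,
  -- through Markov's inequality, the contribution of the large innovations.
  set θ : ℝ := min (δ / 3) (δ / 3 * (η / 2)) / (T + 1) with hθ
  have hθ0 : 0 < θ := by positivity
  have hTθ : T * θ ≤ min (δ / 3) (δ / 3 * (η / 2)) := by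
    rw [hθ, ← mul_div_assoc, div_le_iff₀ (by positivity), mul_comm]
    exact mul_le_mul_of_nonneg_left (by linarith) (by positivity)
  obtain ⟨M, hM0, hM⟩ := exists_lintegral_tail_le hq hC hθ0
  set ψ : A → Ξ → ℝ := fun x s => (φ x s - tail M φ x s) - ∫ s, (φ x s - tail M φ x s) ∂μ with hψd
  have htm := measurable_tail M hφ
  have hcm : Measurable fun p : A × Ξ => φ p.1 p.2 - tail M φ p.1 p.2 := hφ.sub htm
  have hcmx : ∀ x, Measurable fun s => φ x s - tail M φ x s := fun x =>
    hcm.comp measurable_prodMk_left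
  have hci : ∀ x, Integrable (fun s => φ x s - tail M φ x s) μ := fun x =>
    Integrable.of_bound (hcmx x).aestronglyMeasurable M
      (ae_of_all _ fun s => abs_sub_tail_le hM0.le φ x s)
  have hψm : Measurable (Function.uncurry ψ) := by
    have h1 : Measurable fun x => ∫ s, (φ x s - tail M φ x s) ∂μ :=
      (hcm.stronglyMeasurable.integral_prod_right).measurable
    exact hcm.sub (h1.comp measurable_fst)
  have hψB : ∀ x s, |ψ x s| ≤ 2 * M := by
    intro x s
    have h1 : |∫ s, (φ x s - tail M φ x s) ∂μ| ≤ M := by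
      have := norm_integral_le_of_norm_le_const (μ := μ) (f := fun s => φ x s - tail M φ x s)
        (C := M) (ae_of_all _ fun s => abs_sub_tail_le hM0.le φ x s)
      simpa using this
    have h2 := abs_sub (φ x s - tail M φ x s) (∫ s, (φ x s - tail M φ x s) ∂μ)
    linarith [abs_sub_tail_le hM0.le φ x s]
  have hψ0 : ∀ x, ∫ s, ψ x s ∂μ = 0 := by
    intro x
    simp only [hψd]
    rw [integral_sub (hci x) (integrable_const _)]
    simp
  have hti : ∀ x ∈ K, Integrable (tail M φ x) μ ∧ |∫ s, tail M φ x s ∂μ| ≤ θ := by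
    intro x hx
    refine ⟨⟨(htm.comp measurable_prodMk_left).aestronglyMeasurable,
      (hM x hx).trans_lt ENNReal.ofReal_lt_top⟩, ?_⟩
    rw [← ENNReal.ofReal_le_ofReal_iff hθ0.le, ← Real.norm_eq_abs, ofReal_norm]
    exact (enorm_integral_le_lintegral_enorm _).trans (hM x hx)
  have hdec : ∀ x ∈ K, ∀ s, φ x s - ∫ s, φ x s ∂μ =
      ψ x s + tail M φ x s - ∫ s, tail M φ x s ∂μ := by
    intro x hx s
    have : ∫ s, φ x s ∂μ = (∫ s, (φ x s - tail M φ x s) ∂μ) + ∫ s, tail M φ x s ∂μ := by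
      rw [← integral_add (hci x) (hti x hx).1]
      simp
    rw [this]
    simp only [hψd]
    ring
  have hγ : ∀ᶠ γ : ℝ in 𝓝[>] 0,
      γ * (T + 1) ^ 3 * (4 * (2 * M) ^ 4 / (δ / 3) ^ 4) < η / 2 := by
    have : Tendsto (fun γ : ℝ => γ * (T + 1) ^ 3 * (4 * (2 * M) ^ 4 / (δ / 3) ^ 4))
        (𝓝 0) (𝓝 0) := by
      have : Continuous fun γ : ℝ => γ * (T + 1) ^ 3 * (4 * (2 * M) ^ 4 / (δ / 3) ^ 4) := by
        fun_prop
      simpa using this.tendsto 0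
    exact (this.mono_left nhdsWithin_le_nhds).eventually_lt_const (by positivity)
  filter_upwards [hγ, Ioo_mem_nhdsGT one_pos] with γ hγη ⟨hγ0, hγ1⟩ X hX hXK
  set N : ℕ := ⌊T / γ⌋₊ with hN
  have hNγ : N * γ ≤ T := by
    rw [← le_div_iff₀ hγ0]; exact Nat.floor_le (by positivity)
  have hnN : ∀ n : ℕ, n * γ ≤ T → n ≤ N := fun n hn =>
    Nat.le_floor ((le_div_iff₀ hγ0).2 hn)
  -- Off `E₁` the truncated martingale is small, off `E₂` the accumulated tails are.
  set E₁ : Set Ω := {ω | ∃ n ≤ N, δ / 3 / γ ≤ |∑ k ∈ Finset.range n, ψ (X k ω) (ζ k ω)|} with hE₁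
  set E₂ : Set Ω := {ω | ENNReal.ofReal (δ / 3) ≤
    ∑ k ∈ Finset.range N, ENNReal.ofReal γ * ‖tail M φ (X k ω) (ζ k ω)‖ₑ} with hE₂
  have hsub : {ω | ∃ n : ℕ, n * γ ≤ T ∧ δ < γ * |∑ k ∈ Finset.range n,
      (φ (X k ω) (ζ k ω) - ∫ s, φ (X k ω) s ∂μ)|} ⊆ E₁ ∪ E₂ := by
    rintro ω ⟨n, hnT, hω⟩
    by_contra hcon
    simp only [Set.mem_union, not_or] at hcon
    obtain ⟨h1, h2⟩ := hcon
    have h1' : γ * |∑ k ∈ Finset.range n, ψ (X k ω) (ζ k ω)| < δ / 3 := by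
      by_contra hge
      exact h1 ⟨n, hnN n hnT, by rw [div_le_iff₀' hγ0]; linarith⟩
    have h2' : γ * ∑ k ∈ Finset.range n, |tail M φ (X k ω) (ζ k ω)| < δ / 3 := by
      have h3 : ∑ k ∈ Finset.range N, ENNReal.ofReal γ * ‖tail M φ (X k ω) (ζ k ω)‖ₑ =
          ENNReal.ofReal (γ * ∑ k ∈ Finset.range N, |tail M φ (X k ω) (ζ k ω)|) := by
        rw [← Finset.mul_sum, ENNReal.ofReal_mul hγ0.le,
          ENNReal.ofReal_sum_of_nonneg fun k _ => abs_nonneg _]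
        simp only [← Real.norm_eq_abs, ofReal_norm]
      rw [hE₂, Set.mem_ofPred_eq, h3, ENNReal.ofReal_le_ofReal_iff
        (mul_nonneg hγ0.le (Finset.sum_nonneg fun k _ => abs_nonneg _)), not_le] at h2
      refine lt_of_le_of_lt ?_ h2
      gcongr
      exact hnN n hnT
    have hkK : ∀ k ∈ Finset.range n, X k ω ∈ K := by
      intro k hk
      refine hXK k ω (lt_of_lt_of_le ?_ hnT)
      have : (k : ℝ) < n := by exact_mod_cast Finset.mem_range.1 hk
      exact mul_lt_mul_of_pos_right this hγ0
    have h4 : γ * ∑ k ∈ Finset.range n, |∫ s, tail M φ (X k ω) s ∂μ| ≤ δ / 3 := by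
      calc γ * ∑ k ∈ Finset.range n, |∫ s, tail M φ (X k ω) s ∂μ|
          ≤ γ * ∑ _k ∈ Finset.range n, θ := by
            gcongr with k hk; exact (hti _ (hkK k hk)).2
        _ = n * γ * θ := by simp; ring
        _ ≤ T * θ := by gcongr
        _ ≤ δ / 3 := hTθ.trans (min_le_left _ _)
    rw [Finset.sum_congr rfl fun k hk => hdec _ (hkK k hk) (ζ k ω), Finset.sum_sub_distrib,
      Finset.sum_add_distrib] at hω
    have h5 := (abs_sub (∑ k ∈ Finset.range n, ψ (X k ω) (ζ k ω) +
      ∑ k ∈ Finset.range n, tail M φ (X k ω) (ζ k ω))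
      (∑ k ∈ Finset.range n, ∫ s, tail M φ (X k ω) s ∂μ)).trans (add_le_add
        ((abs_add_le _ _).trans (add_le_add_right (Finset.abs_sum_le_sum_abs _ _) _))
        (Finset.abs_sum_le_sum_abs _ _))
    have h6 := mul_le_mul_of_nonneg_left h5 hγ0.le
    rw [mul_add, mul_add] at h6
    linarith
  have hP₁ : P E₁ ≤ ENNReal.ofReal (η / 2) := by
    rw [← ofReal_measureReal]
    refine ENNReal.ofReal_le_ofReal ?_
    refine (h.measureReal_exists_le hψm hψB hψ0 hX N (by positivity : 0 < δ / 3 / γ)).trans ?_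
    have h1 : (N * γ + γ) * (N * γ) ^ 2 ≤ (T + 1) * (T + 1) ^ 2 := by
      gcongr; linarith
    calc ((N : ℝ) + 1) * (4 * N ^ 2 * (2 * M) ^ 4 / (δ / 3 / γ) ^ 4)
        = γ * ((N * γ + γ) * (N * γ) ^ 2) * (4 * (2 * M) ^ 4 / (δ / 3) ^ 4) := by field_simp
      _ ≤ γ * ((T + 1) * (T + 1) ^ 2) * (4 * (2 * M) ^ 4 / (δ / 3) ^ 4) := by gcongr
      _ = γ * (T + 1) ^ 3 * (4 * (2 * M) ^ 4 / (δ / 3) ^ 4) := by ring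
      _ ≤ η / 2 := hγη.le
  have hP₂ : P E₂ ≤ ENNReal.ofReal (η / 2) := by
    have htk : ∀ k, Measurable fun ω => ‖tail M φ (X k ω) (ζ k ω)‖ₑ := fun k =>
      (htm.comp (((hX k).mono (past_le h.measurable k) le_rfl).prodMk (h.measurable k))).enorm
    have h1 := mul_meas_ge_le_lintegral (μ := P) (f := fun ω =>
      ∑ k ∈ Finset.range N, ENNReal.ofReal γ * ‖tail M φ (X k ω) (ζ k ω)‖ₑ)
      (Finset.measurable_sum _ fun k _ => (htk k).const_mul _) (ENNReal.ofReal (δ / 3))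
    rw [lintegral_finsetSum _ fun k _ => (htk k).const_mul _] at h1
    have h2 : ∑ k ∈ Finset.range N,
        ∫⁻ ω, ENNReal.ofReal γ * ‖tail M φ (X k ω) (ζ k ω)‖ₑ ∂P ≤
        ENNReal.ofReal (δ / 3) * ENNReal.ofReal (η / 2) := by
      calc _ ≤ ∑ _k ∈ Finset.range N, ENNReal.ofReal γ * ENNReal.ofReal θ := by
            refine Finset.sum_le_sum fun k hk => ?_
            rw [lintegral_const_mul _ (htk k)]
            gcongr
            refine h.lintegral_comp_le (ρ := fun x s => ‖tail M φ x s‖ₑ) htm.enorm (hX k)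
              fun ω => hM _ (hXK k ω ?_)
            have : (k : ℝ) < N := by exact_mod_cast Finset.mem_range.1 hk
            exact (mul_lt_mul_of_pos_right this hγ0).trans_le hNγ
        _ = ENNReal.ofReal (N * γ * θ) := by
            rw [Finset.sum_const, Finset.card_range, nsmul_eq_mul, ← ENNReal.ofReal_mul hγ0.le,
              ← ENNReal.ofReal_natCast, ← ENNReal.ofReal_mul (by positivity), mul_assoc]
        _ ≤ ENNReal.ofReal (δ / 3 * (η / 2)) := by
            refine ENNReal.ofReal_le_ofReal ?_
            calc N * γ * θ ≤ T * θ := by gcongr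
              _ ≤ _ := hTθ.trans (min_le_right _ _)
        _ = _ := ENNReal.ofReal_mul (by positivity)
    have h3 := h1.trans h2
    rwa [ENNReal.mul_le_mul_iff_right (by simpa using hδ) ENNReal.ofReal_ne_top] at h3
  calc _ ≤ P (E₁ ∪ E₂) := measure_mono hsub
    _ ≤ P E₁ + P E₂ := measure_union_le _ _
    _ ≤ ENNReal.ofReal (η / 2) + ENNReal.ofReal (η / 2) := add_le_add hP₁ hP₂
    _ = ENNReal.ofReal η := by
        rw [← ENNReal.ofReal_add (by positivity) (by positivity), add_halves]

end Noise

/-! ### Exponential moving averages -/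

section Ema

/-- The exponential moving average with decay `ρ` of the sequence `u`, started at `0`. -/
def ema (ρ : ℝ) (u : ℕ → ℝ) : ℕ → ℝ
  | 0 => 0
  | n + 1 => ρ * ema ρ u n + (1 - ρ) * u n

variable {ρ : ℝ} {u w : ℕ → ℝ}

lemma ema_mono (hρ : ρ ∈ Set.Ico (0 : ℝ) 1) {n : ℕ} (h : ∀ k < n, u k ≤ w k) :
    ema ρ u n ≤ ema ρ w n := by
  induction n with
  | zero => exact le_rfl
  | succ n ih =>
    have h1 := ih fun k hk => h k (hk.trans n.lt_succ_self)
    exact add_le_add (mul_le_mul_of_nonneg_left h1 hρ.1)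
      (mul_le_mul_of_nonneg_left (h n n.lt_succ_self) (by linarith [hρ.2]))

lemma ema_add (ρ : ℝ) (u w : ℕ → ℝ) (n : ℕ) :
    ema ρ (fun k => u k + w k) n = ema ρ u n + ema ρ w n := by
  induction n with
  | zero => simp [ema]
  | succ n ih => simp only [ema, ih]; ring

lemma ema_const_mul (ρ c : ℝ) (u : ℕ → ℝ) (n : ℕ) :
    ema ρ (fun k => c * u k) n = c * ema ρ u n := by
  induction n with
  | zero => simp [ema]
  | succ n ih => simp only [ema, ih]; ring

lemma ema_sub (ρ : ℝ) (u w : ℕ → ℝ) (n : ℕ) :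
    ema ρ (fun k => u k - w k) n = ema ρ u n - ema ρ w n := by
  induction n with
  | zero => simp [ema]
  | succ n ih => simp only [ema, ih]; ring

lemma ema_const (ρ c : ℝ) (n : ℕ) : ema ρ (fun _ => c) n = c * (1 - ρ ^ n) := by
  induction n with
  | zero => simp [ema]
  | succ n ih => simp only [ema, ih]; ring

lemma ema_nonneg (hρ : ρ ∈ Set.Ico (0 : ℝ) 1) (h : ∀ k, 0 ≤ u k) (n : ℕ) : 0 ≤ ema ρ u n := by
  have := ema_mono (n := n) hρ (u := fun _ => 0) (w := u) fun k _ => h k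
  simpa [ema_const] using this

lemma abs_ema_sub_le (hρ : ρ ∈ Set.Ico (0 : ℝ) 1) {n : ℕ} {D : ℝ}
    (h : ∀ k < n, |u k - w k| ≤ D) : |ema ρ u n - ema ρ w n| ≤ D * (1 - ρ ^ n) := by
  rw [← ema_sub, abs_le]
  constructor
  · rw [← neg_mul, ← ema_const]
    exact ema_mono hρ fun k hk => (abs_le.1 (h k hk)).1
  · rw [← ema_const]
    exact ema_mono hρ fun k hk => (abs_le.1 (h k hk)).2

/-- Summation by parts: a moving average is controlled by the partial sums. -/
lemma abs_ema_le_of_sum (hρ : ρ ∈ Set.Ico (0 : ℝ) 1) {n : ℕ} {κ : ℝ}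
    (h : ∀ j ≤ n, |∑ k ∈ Finset.range j, u k| ≤ κ) : |ema ρ u n| ≤ (1 - ρ) * (2 * κ) := by
  have key : ∀ j ≤ n, |ema ρ u j - (1 - ρ) * ∑ k ∈ Finset.range j, u k| ≤ (1 - ρ) * κ := by
    intro j
    induction j with
    | zero =>
      intro _
      have := (abs_nonneg _).trans (h 0 (Nat.zero_le n))
      simpa [ema] using mul_nonneg (by linarith [hρ.2]) this
    | succ j ih =>
      intro hj
      have h1 := ih (by omega)
      have e : ema ρ u (j + 1) - (1 - ρ) * ∑ k ∈ Finset.range (j + 1), u k =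
          ρ * (ema ρ u j - (1 - ρ) * ∑ k ∈ Finset.range j, u k) +
            (1 - ρ) * ((ρ - 1) * ∑ k ∈ Finset.range j, u k) := by
        rw [Finset.sum_range_succ, ema]; ring
      rw [e]
      refine (abs_add_le _ _).trans ?_
      have h2 : |(ρ - 1) * ∑ k ∈ Finset.range j, u k| ≤ (1 - ρ) * κ := by
        rw [abs_mul, abs_sub_comm, abs_of_pos (by linarith [hρ.2] : 0 < 1 - ρ)]
        exact mul_le_mul_of_nonneg_left (h j (by omega)) (by linarith [hρ.2])
      rw [abs_mul, abs_mul, abs_of_nonneg hρ.1, abs_of_pos (by linarith [hρ.2] : 0 < 1 - ρ)]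
      calc _ ≤ ρ * ((1 - ρ) * κ) + (1 - ρ) * ((1 - ρ) * κ) :=
            add_le_add (mul_le_mul_of_nonneg_left h1 hρ.1)
              (mul_le_mul_of_nonneg_left h2 (by linarith [hρ.2]))
        _ = _ := by ring
  have h1 := key n le_rfl
  have h2 : |(1 - ρ) * ∑ k ∈ Finset.range n, u k| ≤ (1 - ρ) * κ := by
    rw [abs_mul, abs_of_pos (by linarith [hρ.2] : 0 < 1 - ρ)]
    exact mul_le_mul_of_nonneg_left (h n le_rfl) (by linarith [hρ.2])
  have h3 := abs_add_le (ema ρ u n - (1 - ρ) * ∑ k ∈ Finset.range n, u k)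
    ((1 - ρ) * ∑ k ∈ Finset.range n, u k)
  rw [sub_add_cancel] at h3
  linarith

lemma one_sub_pow_pos (hρ : ρ ∈ Set.Ico (0 : ℝ) 1) {n : ℕ} (hn : n ≠ 0) : 0 < 1 - ρ ^ n := by
  linarith [pow_lt_one₀ hρ.1 hρ.2 hn]

/-- Jensen's inequality for the moving average, whose weights have total mass `1 - ρⁿ`. -/
lemma sq_ema_le (hρ : ρ ∈ Set.Ico (0 : ℝ) 1) {n : ℕ} (hn : n ≠ 0) :
    ema ρ u n ^ 2 ≤ (1 - ρ ^ n) * ema ρ (fun k => u k ^ 2) n := by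
  have hW := one_sub_pow_pos hρ hn
  set c := ema ρ u n / (1 - ρ ^ n) with hc
  have h0 : 0 ≤ ema ρ (fun k => u k ^ 2 + (-(2 * c) * u k + c ^ 2)) n :=
    ema_nonneg hρ (fun k => by nlinarith [sq_nonneg (u k - c)]) n
  rw [ema_add, ema_add ρ (fun k => -(2 * c) * u k), ema_const_mul, ema_const] at h0
  have h1 : c * (1 - ρ ^ n) = ema ρ u n := div_mul_cancel₀ _ hW.ne'
  rw [← h1] at h0 ⊢
  have h2 : c ^ 2 * (1 - ρ ^ n) ≤ ema ρ (fun k => u k ^ 2) n := by nlinarith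
  calc (c * (1 - ρ ^ n)) ^ 2 = (1 - ρ ^ n) * (c ^ 2 * (1 - ρ ^ n)) := by ring
    _ ≤ _ := mul_le_mul_of_nonneg_left h2 hW.le

/-- Moving averages of nonnegative sequences with different decays are comparable. -/
lemma ema_le_ema {α β : ℝ} (hα : α ∈ Set.Ico (0 : ℝ) 1) (hβ : β ∈ Set.Ico (0 : ℝ) 1)
    (hu : ∀ k, 0 ≤ u k) (n : ℕ) : β ^ n * ((1 - β) * ema α u n) ≤ (1 - α) * ema β u n := by
  induction n with
  | zero => simp [ema]
  | succ n ih =>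
    have hA := ema_nonneg hα hu n
    have hβn : β ^ (n + 1) ≤ 1 := pow_le_one₀ hβ.1 hβ.2.le
    have h1 : 0 ≤ β ^ n * ((1 - β) * ema α u n) :=
      mul_nonneg (pow_nonneg hβ.1 n) (mul_nonneg (by linarith [hβ.2]) hA)
    have h2 : 0 ≤ (1 - α) * (1 - β) * u n :=
      mul_nonneg (mul_nonneg (by linarith [hα.2]) (by linarith [hβ.2])) (hu n)
    calc β ^ (n + 1) * ((1 - β) * ema α u (n + 1))
        = α * (β * (β ^ n * ((1 - β) * ema α u n))) +
            β ^ (n + 1) * ((1 - α) * (1 - β) * u n) := by simp only [ema]; ring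
      _ ≤ 1 * (β * (β ^ n * ((1 - β) * ema α u n))) + 1 * ((1 - α) * (1 - β) * u n) :=
          add_le_add (mul_le_mul_of_nonneg_right hα.2.le (mul_nonneg hβ.1 h1))
            (mul_le_mul_of_nonneg_right hβn h2)
      _ ≤ β * ((1 - α) * ema β u n) + (1 - α) * (1 - β) * u n := by
          rw [one_mul, one_mul]
          exact add_le_add_left (mul_le_mul_of_nonneg_left ih hβ.1) _
      _ = (1 - α) * ema β u (n + 1) := by simp only [ema]; ring

/-- The normalized update of Adam is bounded whatever the gradients, as long as `αⁿ` and `βⁿ` stay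
away from `0`. -/
lemma abs_update_le {α β ε κ : ℝ} (hα : α ∈ Set.Ico (0 : ℝ) 1) (hβ : β ∈ Set.Ico (0 : ℝ) 1)
    (hε : 0 < ε) (hκ : 0 < κ) {n : ℕ} (hn : n ≠ 0) (hκα : κ ≤ α ^ n) (hκβ : κ ≤ β ^ n)
    (u : ℕ → ℝ) :
    |ema α u n / (1 - α ^ n) / (ε + √(ema β (fun k => u k ^ 2) n / (1 - β ^ n)))| ≤ 1 / κ := by
  have hWα := one_sub_pow_pos hα hn
  have hWβ := one_sub_pow_pos hβ hn
  have hα1 : 0 < 1 - α := by linarith [hα.2]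
  have hβ1 : 0 < 1 - β := by linarith [hβ.2]
  set V := ema β (fun k => u k ^ 2) n with hV
  set U := ema α (fun k => u k ^ 2) n with hU
  have hV0 : 0 ≤ V := ema_nonneg hβ (fun k => sq_nonneg _) n
  have h1 : κ * ((1 - β) * U) ≤ (1 - α) * V :=
    (mul_le_mul_of_nonneg_right hκβ
      (mul_nonneg hβ1.le (ema_nonneg hα (fun k => sq_nonneg _) n))).trans
      (ema_le_ema hα hβ (fun k => sq_nonneg _) n)
  have h2 : κ * ((1 - α) * (1 - β ^ n)) ≤ (1 - β) * (1 - α ^ n) := by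
    have := ema_le_ema (u := fun _ => 1) hβ hα (fun _ => zero_le_one) n
    rw [ema_const, ema_const, one_mul, one_mul] at this
    exact (mul_le_mul_of_nonneg_right hκα (by positivity)).trans this
  have h3 : U / (1 - α ^ n) ≤ (1 / κ) ^ 2 * (V / (1 - β ^ n)) := by
    rw [div_le_iff₀ hWα]
    have h4 : κ * ((1 - β) * U) * (κ * (1 - β ^ n)) ≤ (1 - β) * (1 - α ^ n) * V := by
      calc κ * ((1 - β) * U) * (κ * (1 - β ^ n)) ≤ (1 - α) * V * (κ * (1 - β ^ n)) := by gcongr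
        _ = κ * ((1 - α) * (1 - β ^ n)) * V := by ring
        _ ≤ _ := by gcongr
    have h5 : κ ^ 2 * (1 - β ^ n) * U ≤ (1 - α ^ n) * V := by
      refine le_of_mul_le_mul_left ?_ hβ1
      linarith
    have h6 : (1 / κ) ^ 2 * (V / (1 - β ^ n)) * (1 - α ^ n) =
        (1 - α ^ n) * V / (κ ^ 2 * (1 - β ^ n)) := by field_simp
    rw [h6, le_div_iff₀ (by positivity)]
    linarith
  have h4 : (ema α u n / (1 - α ^ n)) ^ 2 ≤ (1 / κ) ^ 2 * (V / (1 - β ^ n)) := by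
    refine le_trans ?_ h3
    rw [div_pow, div_le_div_iff₀ (by positivity) hWα, pow_two (1 - α ^ n)]
    have := mul_le_mul_of_nonneg_right (sq_ema_le (u := u) hα hn) hWα.le
    linarith
  have h5 := Real.abs_le_sqrt h4
  rw [Real.sqrt_mul (by positivity), Real.sqrt_sq (by positivity)] at h5
  have h6 := Real.sqrt_nonneg (V / (1 - β ^ n))
  rw [abs_div, abs_of_pos (by positivity : 0 < ε + √(V / (1 - β ^ n))),
    div_le_iff₀ (by positivity)]
  exact h5.trans (mul_le_mul_of_nonneg_left (by linarith) (by positivity))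

end Ema

/-! ### Moving averages in the limit of small step sizes -/

section EmaLimit

/-- First-order expansion of a `C¹` curve with an error that is uniform on `[0, T]`; the velocity
may be taken at any point of the interval. -/
lemma exists_taylor {V : Type*} [NormedAddCommGroup V] [NormedSpace ℝ V] [CompleteSpace V]
    {y w : ℝ → V} (hw : Continuous w)
    (hy : ∀ s t, 0 ≤ s → s ≤ t → y t - y s = ∫ r in s..t, w r) (T : ℝ) {η : ℝ} (hη : 0 < η) :
    ∃ δ, 0 < δ ∧ ∀ s t r, 0 ≤ s → s ≤ t → t ≤ T → t - s < δ → r ∈ Set.Icc s t →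
      ‖y t - y s - (t - s) • w r‖ ≤ η * (t - s) := by
  obtain ⟨δ, hδ, h⟩ := Metric.uniformContinuousOn_iff_le.1
    (isCompact_Icc.uniformContinuousOn_of_continuous (hw.continuousOn (s := Set.Icc 0 T))) η hη
  refine ⟨δ, hδ, fun s t r hs hst htT hd hr => ?_⟩
  have e : y t - y s - (t - s) • w r = ∫ q in s..t, (w q - w r) := by
    rw [intervalIntegral.integral_sub (hw.intervalIntegrable _ _) intervalIntegrable_const,
      hy s t hs hst, intervalIntegral.integral_const]
  rw [e, ← abs_of_nonneg (sub_nonneg.2 hst)]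
  refine intervalIntegral.norm_integral_le_of_norm_le_const fun q hq => ?_
  rw [Set.uIoc_of_le hst] at hq
  rw [← dist_eq_norm]
  refine h q ⟨hs.trans hq.1.le, hq.2.trans htT⟩ r ⟨hs.trans hr.1, hr.2.trans htT⟩ ?_
  rw [Real.dist_eq, abs_le]
  constructor <;> linarith [hq.1, hq.2, hr.1, hr.2]

/-- A decay rate `ρ(γ)` with `1 - ρ(γ) ~ c γ`. -/
structure DecayRate (ρ : ℝ → ℝ) (c : ℝ) : Prop where
  mem : ∀ γ, 0 < γ → ρ γ ∈ Set.Ico (0 : ℝ) 1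
  lim : Tendsto (fun γ => (1 - ρ γ) / γ) (𝓝[>] 0) (𝓝 c)
  pos : 0 < c

variable {ρ : ℝ → ℝ} {c : ℝ}

lemma continuous_relax (c : ℝ) {φ : ℝ → ℝ} (hφ : Continuous φ) : Continuous (relax c φ) :=
  continuous_iff_continuousAt.2 fun s => (hasDerivAt_relax c hφ s).continuousAt

lemma DecayRate.eventually_abs_le (h : DecayRate ρ c) {η : ℝ} (hη : 0 < η) :
    ∀ᶠ γ in 𝓝[>] 0, |1 - ρ γ - c * γ| ≤ η * γ := by
  have h1 : ∀ᶠ γ in 𝓝[>] 0, dist ((1 - ρ γ) / γ) c < η := h.lim (Metric.ball_mem_nhds c hη)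
  filter_upwards [h1, self_mem_nhdsWithin] with γ hγ hγ0
  have hγ0 : 0 < γ := hγ0
  have e : 1 - ρ γ - c * γ = ((1 - ρ γ) / γ - c) * γ := by field_simp
  rw [e, abs_mul, abs_of_pos hγ0]
  rw [Real.dist_eq] at hγ
  exact mul_le_mul_of_nonneg_right hγ.le hγ0.le

/-- The moving average is the Euler scheme of `m' = c (φ - m)`. -/
lemma DecayRate.ema_sub_relax_le (h : DecayRate ρ c) {φ : ℝ → ℝ} (hφ : Continuous φ) {T : ℝ}
    (hT : 0 ≤ T) {η : ℝ} (hη : 0 < η) :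
    ∀ᶠ γ in 𝓝[>] 0, ∀ n : ℕ, n * γ ≤ T →
      |ema (ρ γ) (fun k => φ (k * γ)) n - relax c φ (n * γ)| ≤ η := by
  have hy := continuous_relax c hφ
  have hw : Continuous fun t => c * (φ t - relax c φ t) := by fun_prop
  have hη' : 0 < η / (2 * (T + 1)) := by positivity
  obtain ⟨δ, hδ, htay⟩ := exists_taylor hw (fun s t _ _ =>
    (intervalIntegral.integral_eq_sub_of_hasDerivAt (fun r _ => hasDerivAt_relax c hφ r)
      (hw.intervalIntegrable _ _)).symm) T hη'
  obtain ⟨B, hB⟩ := (isCompact_Icc (a := 0) (b := T)).exists_bound_of_continuousOn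
    (f := fun t => φ t - relax c φ t) (by fun_prop)
  filter_upwards [h.eventually_abs_le (η := η / (2 * (T + 1)) / (|B| + 1)) (by positivity),
    Ioo_mem_nhdsGT hδ] with γ hγ ⟨hγ0, hγδ⟩ n
  have hρ := h.mem γ hγ0
  have key : ∀ n : ℕ, n * γ ≤ T →
      |ema (ρ γ) (fun k => φ (k * γ)) n - relax c φ (n * γ)| ≤ n * γ * (η / (T + 1)) := by
    intro n
    induction n with
    | zero => intro _; simp [ema, relax_zero]
    | succ n ih =>
      intro hn
      push_cast at hn ⊢
      have hn' : n * γ ≤ T := by linarith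
      have h0 : 0 ≤ n * γ := by positivity
      have h1 := htay (n * γ) ((n + 1) * γ) (n * γ) h0 (by linarith) hn (by linarith)
        ⟨le_rfl, by linarith⟩
      have h2 := hB (n * γ) ⟨h0, hn'⟩
      set y₀ := relax c φ (n * γ)
      set y₁ := relax c φ ((n + 1) * γ)
      set A := ema (ρ γ) (fun k => φ (k * γ)) n with hA
      -- Propagated error, error of the rate, and local truncation error of the scheme.
      have e : ema (ρ γ) (fun k => φ (k * γ)) (n + 1) - y₁ = ρ γ * (A - y₀) +
          (1 - ρ γ - c * γ) * (φ (n * γ) - y₀) -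
          (y₁ - y₀ - ((n + 1) * γ - n * γ) • (c * (φ (n * γ) - y₀))) := by
        simp only [ema, smul_eq_mul, ← hA]; ring
      have h3 : |ρ γ * (A - y₀)| ≤ n * γ * (η / (T + 1)) := by
        rw [abs_mul, abs_of_nonneg hρ.1]
        exact (mul_le_of_le_one_left (abs_nonneg _) hρ.2.le).trans (ih hn')
      have h4 : |(1 - ρ γ - c * γ) * (φ (n * γ) - y₀)| ≤ η / (2 * (T + 1)) * γ := by
        rw [abs_mul]
        calc _ ≤ η / (2 * (T + 1)) / (|B| + 1) * γ * (|B| + 1) := by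
              gcongr
              exact h2.trans ((le_abs_self B).trans (by linarith))
          _ = _ := by field_simp
      rw [e]
      refine (abs_sub _ _).trans ((add_le_add (abs_add_le _ _) h1).trans ?_)
      have h5 : η / (T + 1) = 2 * (η / (2 * (T + 1))) := by field_simp
      rw [h5] at h3 ⊢
      linarith
  intro hn
  refine (key n hn).trans ?_
  rw [← mul_div_assoc, div_le_iff₀ (by positivity)]
  nlinarith

lemma relax_one (c t : ℝ) : relax c (fun _ => 1) t = 1 - Real.exp (-c * t) := by
  rw [relax_eq_mul_expAvg, expAvg_const, mul_one]

/-- The bias corrections converge: this is the Euler scheme for the constant function `1`. -/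
lemma DecayRate.pow_sub_exp_le (h : DecayRate ρ c) {T : ℝ} (hT : 0 ≤ T) {η : ℝ} (hη : 0 < η) :
    ∀ᶠ γ in 𝓝[>] 0, ∀ n : ℕ, n * γ ≤ T →
      |(1 - ρ γ ^ n) - (1 - Real.exp (-c * (n * γ)))| ≤ η := by
  filter_upwards [h.ema_sub_relax_le (φ := fun _ => 1) continuous_const hT hη] with γ hγ n hn
  have := hγ n hn
  rwa [ema_const, relax_one, one_mul] at this

lemma DecayRate.exists_le_pow (h : DecayRate ρ c) {T : ℝ} (hT : 0 ≤ T) :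
    ∃ κ, 0 < κ ∧ ∀ᶠ γ in 𝓝[>] 0, ∀ n : ℕ, n * γ ≤ T → κ ≤ ρ γ ^ n := by
  refine ⟨Real.exp (-c * T) / 2, by positivity, ?_⟩
  filter_upwards [h.pow_sub_exp_le hT (η := Real.exp (-c * T) / 2) (by positivity)] with γ hγ n hn
  have h1 := (abs_le.1 (hγ n hn)).2
  have h2 : Real.exp (-c * T) ≤ Real.exp (-c * (n * γ)) :=
    Real.exp_le_exp.2 (by nlinarith [h.pos])
  linarith

/-- The moving average of a noisy sequence `u` is close to the solution of `m' = c (φ - m)`, if the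
partial sums of the noise `u - w` are small and `w` is close to `φ` on the grid. -/
lemma DecayRate.ema_noisy_sub_relax_le (h : DecayRate ρ c) {T : ℝ}
    (hT : 0 ≤ T) {η : ℝ} (hη : 0 < η) :
    ∃ κ, 0 < κ ∧ ∀ φ : ℝ → ℝ, Continuous φ → ∀ᶠ γ in 𝓝[>] 0, ∀ n : ℕ, n * γ ≤ T →
      ∀ (u w : ℕ → ℝ) (D : ℝ),
      (∀ j ≤ n, γ * |∑ k ∈ Finset.range j, (u k - w k)| ≤ κ) →
      (∀ k < n, |w k - φ (k * γ)| ≤ D) →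
      |ema (ρ γ) u n - relax c φ (n * γ)| ≤ D * (1 - ρ γ ^ n) + η := by
  have hc := h.pos
  refine ⟨η / (4 * (c + 1)), by positivity, fun φ hφ => ?_⟩
  filter_upwards [h.ema_sub_relax_le hφ hT (half_pos hη), h.eventually_abs_le one_pos,
    self_mem_nhdsWithin] with γ hγ hγ1 hγ0 n hn u w D hnoise hD
  have hγ0 : 0 < γ := hγ0
  have hρ := h.mem γ hγ0
  have h1 : |ema (ρ γ) (fun k => u k - w k) n| ≤ η / 2 := by
    have h2 := abs_ema_le_of_sum hρ (u := fun k => u k - w k) (n := n)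
      (κ := η / (4 * (c + 1)) / γ) fun j hj => by
        rw [le_div_iff₀' hγ0]; exact hnoise j hj
    refine h2.trans ?_
    have h3 : 1 - ρ γ ≤ (c + 1) * γ := by linarith [(abs_le.1 hγ1).2]
    calc (1 - ρ γ) * (2 * (η / (4 * (c + 1)) / γ))
        ≤ (c + 1) * γ * (2 * (η / (4 * (c + 1)) / γ)) := by gcongr
      _ = η / 2 := by field_simp; norm_num
  rw [ema_sub] at h1
  have h2 := abs_ema_sub_le hρ hD
  have h3 := hγ n hn
  rw [abs_le] at h1 h2 h3 ⊢
  constructor <;> linarith [h1.1, h1.2, h2.1, h2.2, h3.1, h3.2]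

/-- The bias-corrected version, for times bounded away from `0`. -/
lemma DecayRate.ema_div_sub_expAvg_le (h : DecayRate ρ c)
    {T t₀ : ℝ} (hT : 0 ≤ T) (ht₀ : 0 < t₀) {η : ℝ} (hη : 0 < η) :
    ∃ κ, 0 < κ ∧ ∀ φ : ℝ → ℝ, Continuous φ → ∀ᶠ γ in 𝓝[>] 0, ∀ n : ℕ, n * γ ≤ T →
      t₀ ≤ n * γ → ∀ (u w : ℕ → ℝ) (D : ℝ),
      (∀ j ≤ n, γ * |∑ k ∈ Finset.range j, (u k - w k)| ≤ κ) →
      (∀ k < n, |w k - φ (k * γ)| ≤ D) →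
      |ema (ρ γ) u n / (1 - ρ γ ^ n) - expAvg c φ (n * γ)| ≤ D + η := by
  have hw0 := one_sub_exp_pos h.pos ht₀
  -- After time `t₀` the discrete bias correction is at least half of its continuous value at `t₀`.
  set w₀ := (1 - Real.exp (-c * t₀)) / 2 with hw₀
  have hw₀0 : 0 < w₀ := by positivity
  obtain ⟨κ, hκ, hev⟩ := h.ema_noisy_sub_relax_le hT (η := η * w₀ / 2) (by positivity)
  refine ⟨κ, hκ, fun φ hφ => ?_⟩
  obtain ⟨B, hB⟩ := (isCompact_Icc (a := 0) (b := T)).exists_bound_of_continuousOn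
    (continuous_expAvg c hφ).continuousOn
  filter_upwards [hev φ hφ, h.pow_sub_exp_le hT hw₀0,
    h.pow_sub_exp_le hT (η := η * w₀ / 2 / (|B| + 1)) (by positivity)] with
    γ hγ hγ1 hγ2 n hn hnt u w D hnoise hD
  have h1 := hγ n hn u w D hnoise hD
  have h2 := (abs_le.1 (hγ1 n hn)).1
  have h3 := hγ2 n hn
  have h4 := hB (n * γ) ⟨ht₀.le.trans hnt, hn⟩
  have h5 : Real.exp (-c * (n * γ)) ≤ Real.exp (-c * t₀) :=
    Real.exp_le_exp.2 (by nlinarith [h.pos])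
  have hW : w₀ ≤ 1 - ρ γ ^ n := by linarith
  rw [relax_eq_mul_expAvg] at h1
  set W := 1 - ρ γ ^ n
  set W' := 1 - Real.exp (-c * (n * γ))
  set a := expAvg c φ (n * γ)
  set m := ema (ρ γ) u n
  have hW0 : 0 < W := hw₀0.trans_le hW
  have e : m / W - a = ((m - W' * a) - (W - W') * a) / W := by field_simp; ring
  have h6 : |(W - W') * a| ≤ η * w₀ / 2 := by
    rw [abs_mul]
    calc _ ≤ η * w₀ / 2 / (|B| + 1) * (|B| + 1) := by
          gcongr
          exact h4.trans ((le_abs_self B).trans (by linarith))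
      _ = _ := by field_simp
  rw [e, abs_div, abs_of_pos hW0, div_le_iff₀ hW0]
  refine (abs_sub _ _).trans ((add_le_add h1 h6).trans ?_)
  nlinarith

end EmaLimit

/-! ### The algorithm follows the differential equation when the noise is small -/

section Tracking

variable {d : ℕ}

/-- The normalized update `m̂ / (ε + √v̂)` produced by the first `n` gradients of the sequence
`g`. -/
noncomputable def update (ε α β : ℝ) (g : ℕ → E d) (n : ℕ) : E d :=
  WithLp.toLp 2 fun i => ema α (fun k => g k i) n / (1 - α ^ n) /
    (ε + √(ema β (fun k => g k i ^ 2) n / (1 - β ^ n)))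

/-- The positions `X` of the algorithm fed with the gradients `g`. -/
structure AdamPath (ε γ α β : ℝ) (x₀ : E d) (X g : ℕ → E d) : Prop where
  init : X 0 = x₀
  step : ∀ n, X (n + 1) = X n - γ • update ε α β g (n + 1)

/-- The partial sums of the noise up to time `T`, for the gradients and their squares, are at most
`κ` when scaled by the step size `γ`. -/
def SmallNoise (G S : E d → E d) (γ T κ : ℝ) (X g : ℕ → E d) : Prop :=
  ∀ i, ∀ n : ℕ, n * γ ≤ T → γ * |∑ k ∈ Finset.range n, (g k i - G (X k) i)| ≤ κ ∧
    γ * |∑ k ∈ Finset.range n, (g k i ^ 2 - S (X k) i)| ≤ κ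

variable {G S : E d → E d} {ε a b : ℝ} {α β : ℝ → ℝ} {x₀ : E d}

/-- The positions stay in a fixed ball up to time `T`, whatever the gradients. -/
lemma exists_confinement (hα : DecayRate α a) (hβ : DecayRate β b) (hε : 0 < ε) {T : ℝ}
    (hT : 0 ≤ T) : ∃ Λ, 0 ≤ Λ ∧ ∀ᶠ γ in 𝓝[>] 0, ∀ (x₀ : E d) (X g : ℕ → E d),
      AdamPath ε γ (α γ) (β γ) x₀ X g → ∀ n : ℕ, n * γ ≤ T →
        (n ≠ 0 → ‖update ε (α γ) (β γ) g n‖ ≤ Λ) ∧ ‖X n - x₀‖ ≤ Λ * T := by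
  obtain ⟨κ₁, hκ₁, h₁⟩ := hα.exists_le_pow hT
  obtain ⟨κ₂, hκ₂, h₂⟩ := hβ.exists_le_pow hT
  refine ⟨d * (1 / min κ₁ κ₂), by positivity, ?_⟩
  filter_upwards [h₁, h₂, self_mem_nhdsWithin] with γ h₁ h₂ hγ0 x₀ X g hX
  have hγ0 : 0 < γ := hγ0
  have hup : ∀ n : ℕ, n * γ ≤ T → n ≠ 0 →
      ‖update ε (α γ) (β γ) g n‖ ≤ d * (1 / min κ₁ κ₂) := fun n hn hn0 =>
    norm_le_mul_of_forall_abs_le fun i => abs_update_le (hα.mem γ hγ0) (hβ.mem γ hγ0) hε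
      (lt_min hκ₁ hκ₂) hn0 ((min_le_left _ _).trans (h₁ n hn)) ((min_le_right _ _).trans (h₂ n hn))
      fun k => g k i
  have hpos : ∀ n : ℕ, n * γ ≤ T → ‖X n - x₀‖ ≤ d * (1 / min κ₁ κ₂) * (n * γ) := by
    intro n
    induction n with
    | zero => intro _; simp [hX.init]
    | succ n ih =>
      intro hn
      have h3 := hup (n + 1) hn n.succ_ne_zero
      push_cast at hn ⊢
      have h4 := ih (by linarith)
      rw [hX.step, sub_right_comm]
      refine (norm_sub_le _ _).trans ?_
      rw [norm_smul, Real.norm_of_nonneg hγ0.le]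
      nlinarith
  intro n hn
  exact ⟨hup n hn, (hpos n hn).trans (mul_le_mul_of_nonneg_left hn (by positivity))⟩

/-- Away from time `0`, the update is close to the velocity of the limiting equation, up to the
distance `D` between the two paths.  The constant in front of `D` does not depend on `t₀`. -/
lemma Drift.exists_update_add_velocity_le (h : Drift G S) (hα : DecayRate α a) (hβ : DecayRate β b)
    (hε : 0 < ε) {x : ℝ → E d} (hx : Continuous x) {T : ℝ} (hT : 0 ≤ T) {K : Set (E d)}
    (hK : IsCompact K) (hxK : ∀ t ∈ Set.Icc 0 T, x t ∈ K) :
    ∃ L, 0 ≤ L ∧ ∀ t₀, 0 < t₀ → ∀ η, 0 < η → ∃ κ, 0 < κ ∧ ∀ᶠ γ in 𝓝[>] 0, ∀ n : ℕ, n * γ ≤ T →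
      t₀ ≤ n * γ → ∀ (X g : ℕ → E d) (D : ℝ), SmallNoise G S γ T κ X g → (∀ k < n, X k ∈ K) →
      (∀ k < n, ‖X k - x (k * γ)‖ ≤ D) →
      ‖update ε (α γ) (β γ) g n + velocity G S ε a b x (n * γ)‖ ≤ L * D + η := by
  obtain ⟨L₁, hL₁0, hL₁⟩ := h.lipG K hK
  obtain ⟨L₂, hL₂0, hL₂⟩ := h.lipS K hK
  obtain ⟨c, hc0, hc⟩ := h.exists_lower_bound hK
  obtain ⟨B, hB⟩ := hK.exists_bound_of_continuousOn h.lipG.continuous.continuousOn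
  set Q := |B| / (ε ^ 2 * √c) with hQ
  have hQ0 : 0 ≤ Q := by positivity
  refine ⟨d * (L₁ / ε + Q * L₂), by positivity, fun t₀ ht₀ η hη => ?_⟩
  set η' := η / ((d + 1) * (1 / ε + Q + 1)) with hη'
  have hη'0 : 0 < η' := by positivity
  obtain ⟨κ₁, hκ₁, h₁⟩ := hα.ema_div_sub_expAvg_le hT ht₀ hη'0
  obtain ⟨κ₂, hκ₂, h₂⟩ := hβ.ema_div_sub_expAvg_le hT ht₀ hη'0
  refine ⟨min κ₁ κ₂, lt_min hκ₁ hκ₂, ?_⟩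
  filter_upwards [eventually_all.2 fun i => h₁ _ (h.continuous_comp hx i).1,
    eventually_all.2 fun i => h₂ _ (h.continuous_comp hx i).2, self_mem_nhdsWithin] with
    γ h₁ h₂ hγ0 n hn hnt X g D hnoise hXK hD
  have hγ0 : 0 < γ := hγ0
  have ht0 : 0 ≤ n * γ := by positivity
  have hxK' : ∀ k < n, x (k * γ) ∈ K := fun k hk => hxK _ ⟨by positivity, by
    have : (k : ℝ) ≤ n := by exact_mod_cast hk.le
    nlinarith⟩
  have hjT : ∀ j ≤ n, j * γ ≤ T := fun j hj => by
    have : (j : ℝ) ≤ n := by exact_mod_cast hj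
    nlinarith
  have hn0 : n ≠ 0 := by
    rintro rfl
    simp at hnt
    linarith
  have key : ∀ i, |(update ε (α γ) (β γ) g n + velocity G S ε a b x (n * γ)) i| ≤
      (L₁ / ε + Q * L₂) * D + η / (d + 1) := by
    intro i
    have e₁ := h₁ i n hn hnt (fun k => g k i) (fun k => G (X k) i) (L₁ * D)
      (fun j hj => (hnoise i j (hjT j hj)).1.trans (min_le_left _ _)) fun k hk =>
        (abs_apply_le_norm (G (X k) - G (x (k * γ))) i).trans
          ((hL₁ _ (hXK k hk) _ (hxK' k hk)).trans (mul_le_mul_of_nonneg_left (hD k hk) hL₁0))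
    have e₂ := h₂ i n hn hnt (fun k => g k i ^ 2) (fun k => S (X k) i) (L₂ * D)
      (fun j hj => (hnoise i j (hjT j hj)).2.trans (min_le_right _ _)) fun k hk =>
        (abs_apply_le_norm (S (X k) - S (x (k * γ))) i).trans
          ((hL₂ _ (hXK k hk) _ (hxK' k hk)).trans (mul_le_mul_of_nonneg_left (hD k hk) hL₂0))
    have hsub : ∀ s ∈ Set.Icc 0 (n * γ), x s ∈ K := fun s hs => hxK s ⟨hs.1, hs.2.trans hn⟩
    have e₃ : |expAvg a (fun s => G (x s) i) (n * γ)| ≤ |B| := by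
      have := abs_expAvg_sub_le a (h.continuous_comp hx i).1 (continuous_const (y := (0 : ℝ))) ht0
        (D := |B|) fun s hs => by
          rw [sub_zero]
          exact (abs_apply_le_norm _ i).trans ((hB _ (hsub s hs)).trans (le_abs_self B))
      rwa [expAvg_const, sub_zero] at this
    have e₄ : c ≤ expAvg b (fun s => S (x s) i) (n * γ) := by
      have := expAvg_mono b (continuous_const (y := c)) (h.continuous_comp hx i).2 ht0
        fun s hs => hc _ (hsub s hs) i
      rwa [expAvg_const] at this
    have e₅ : 0 ≤ ema (β γ) (fun k => g k i ^ 2) n / (1 - β γ ^ n) :=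
      div_nonneg (ema_nonneg (hβ.mem γ hγ0) (fun k => sq_nonneg _) n)
        (one_sub_pow_pos (hβ.mem γ hγ0) hn0).le
    have e₆ := abs_div_sub_div_le (p := ema (α γ) (fun k => g k i) n / (1 - α γ ^ n))
      hε hc0 e₅ e₄ e₃
    simp only [PiLp.add_apply, update, velocity]
    rw [← sub_eq_add_neg]
    refine e₆.trans ?_
    rw [← hQ]
    have e₇ : η' * (1 / ε + Q) ≤ η / (d + 1) := by
      rw [hη', div_mul_eq_mul_div, div_le_div_iff₀ (by positivity) (by positivity)]
      have : 0 ≤ η * (d + 1) := by positivity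
      nlinarith
    calc _ ≤ (L₁ * D + η') / ε + Q * (L₂ * D + η') := by gcongr
      _ = (L₁ / ε + Q * L₂) * D + η' * (1 / ε + Q) := by ring
      _ ≤ _ := by gcongr
  refine (norm_le_mul_of_forall_abs_le key).trans ?_
  have : (d : ℝ) * (η / (d + 1)) ≤ η := by
    rw [mul_div_assoc', div_le_iff₀ (by positivity)]
    nlinarith
  calc (d : ℝ) * ((L₁ / ε + Q * L₂) * D + η / (d + 1))
      = d * (L₁ / ε + Q * L₂) * D + d * (η / (d + 1)) := by ring
    _ ≤ _ := by gcongr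

/-- The positions of the algorithm stay close to the solution.  Up to a small time `t₀` this holds
because both paths have bounded speed; afterwards a discrete Grönwall argument applies, whose rate
is independent of `t₀`. -/
lemma Drift.exists_norm_sub_le (h : Drift G S) (hα : DecayRate α a) (hβ : DecayRate β b)
    (hε : 0 < ε) {x : ℝ → E d} (hx : Continuous x)
    (hfix : ∀ t, x t = picard x₀ (velocity G S ε a b) x t) {T : ℝ} (hT : 0 ≤ T) {δ : ℝ}
    (hδ : 0 < δ) :
    ∃ κ, 0 < κ ∧ ∀ᶠ γ in 𝓝[>] 0, ∀ X g : ℕ → E d, AdamPath ε γ (α γ) (β γ) x₀ X g →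
      SmallNoise G S γ T κ X g → ∀ n : ℕ, n * γ ≤ T → ‖X n - x (n * γ)‖ ≤ δ := by
  have hvel := h.continuous_velocity (a := a) (b := b) hε hx
  obtain ⟨Λ, hΛ0, hΛ⟩ := exists_confinement (d := d) hα hβ hε hT
  obtain ⟨Λ', hΛ'⟩ := (isCompact_Icc (a := 0) (b := T)).exists_bound_of_continuousOn
    hvel.continuousOn
  obtain ⟨R, hR⟩ := (isCompact_Icc (a := 0) (b := T)).exists_bound_of_continuousOn
    (f := fun t => x t - x₀) (by fun_prop)
  have hK := isCompact_closedBall x₀ (max R (Λ * T))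
  have hxK : ∀ t ∈ Set.Icc 0 T, x t ∈ Metric.closedBall x₀ (max R (Λ * T)) := fun t ht =>
    mem_closedBall_iff_norm.2 ((hR t ht).trans (le_max_left _ _))
  obtain ⟨L, hL0, hL⟩ := h.exists_update_add_velocity_le hα hβ hε hx hT hK hxK
  -- `A` bounds the speed at which the two paths separate, so up to `t₀` their distance is at most
  -- `t₀ * A`.  This and the total error `T * r` each use half of `δ`, discounted by the Grönwall
  -- factor `exp (L * T)`.
  set A := Λ + |Λ'| + 1 with hA
  have hA0 : 0 < A := by positivity
  set r := δ / (2 * Real.exp (L * T) * (T + 1)) with hr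
  have hr0 : 0 < r := by positivity
  set t₀ := δ / (2 * Real.exp (L * T) * A) with ht₀
  obtain ⟨κ, hκ, hup⟩ := hL t₀ (by positivity) (r / 2) (by positivity)
  refine ⟨κ, hκ, ?_⟩
  have hint : ∀ s t, 0 ≤ s → s ≤ t → x t - x s = ∫ q in s..t, velocity G S ε a b x q := by
    intro s t hs hst
    rw [hfix t, hfix s, picard, picard, max_eq_left hs, max_eq_left (hs.trans hst),
      add_sub_add_left_eq_sub, intervalIntegral.integral_interval_sub_left
        (hvel.intervalIntegrable _ _) (hvel.intervalIntegrable _ _)]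
  obtain ⟨τ, hτ, htay⟩ := exists_taylor hvel hint T (η := min (r / 2) 1) (by positivity)
  filter_upwards [hΛ, hup, Ioo_mem_nhdsGT hτ] with γ hΛ hup ⟨hγ0, hγτ⟩ X g hX hnoise
  have hconf := hΛ x₀ X g hX
  have hstep : ∀ n : ℕ, ((n : ℝ) + 1) * γ ≤ T → ‖X (n + 1) - x ((n + 1) * γ)‖ ≤
      ‖X n - x (n * γ)‖ +
        γ * ‖update ε (α γ) (β γ) g (n + 1) + velocity G S ε a b x ((n + 1) * γ)‖ +
        min (r / 2) 1 * γ := by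
    intro n hn
    have h1 := htay (n * γ) ((n + 1) * γ) ((n + 1) * γ) (by positivity) (by linarith) hn
      (by linarith) ⟨by linarith, le_rfl⟩
    have e1 : ((n : ℝ) + 1) * γ - n * γ = γ := by ring
    rw [e1] at h1
    set v := velocity G S ε a b x ((n + 1) * γ)
    have e2 : X (n + 1) - x ((n + 1) * γ) = (X n - x (n * γ)) -
        γ • (update ε (α γ) (β γ) g (n + 1) + v) -
        (x ((n + 1) * γ) - x (n * γ) - γ • v) := by
      rw [hX.step, smul_add]; abel
    rw [e2]
    refine (norm_sub_le _ _).trans (add_le_add ((norm_sub_le _ _).trans ?_) h1)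
    rw [norm_smul, Real.norm_of_nonneg hγ0.le]
  have hcrude : ∀ n : ℕ, n * γ ≤ T → ‖X n - x (n * γ)‖ ≤ n * γ * A := by
    intro n
    induction n with
    | zero =>
      intro _
      have : x 0 = x₀ := by rw [hfix 0]; simp [picard]
      simp [hX.init, this]
    | succ n ih =>
      intro hn
      have h2 := (hconf (n + 1) hn).1 n.succ_ne_zero
      push_cast at hn ⊢
      have h1 := ih (by linarith)
      have h3 := (hΛ' ((n + 1) * γ) ⟨by positivity, hn⟩).trans (le_abs_self Λ')
      have h4 := (norm_add_le _ _).trans (add_le_add h2 h3)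
      have h5 := mul_le_mul_of_nonneg_left h4 hγ0.le
      have h6 := mul_le_mul_of_nonneg_right (min_le_right (r / 2) 1) hγ0.le
      have h7 := hstep n hn
      rw [hA] at h1 ⊢
      linarith
  have hgron : ∀ n : ℕ, n * γ ≤ T → ‖X n - x (n * γ)‖ ≤
      (t₀ * A + n * γ * r) * (1 + γ * L) ^ n := by
    intro n
    induction n using Nat.strong_induction_on with
    | _ n ih =>
      intro hn
      have hq : 1 ≤ 1 + γ * L := by linarith [mul_nonneg hγ0.le hL0]
      rcases le_total (n * γ) t₀ with hle | hge
      · calc ‖X n - x (n * γ)‖ ≤ n * γ * A := hcrude n hn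
          _ ≤ t₀ * A := by gcongr
          _ ≤ t₀ * A + n * γ * r := by linarith [(by positivity : 0 ≤ n * γ * r)]
          _ ≤ _ := le_mul_of_one_le_right (by positivity) (one_le_pow₀ hq)
      · cases n with
        | zero =>
          have : 0 < t₀ := by positivity
          simp at hge
          linarith
        | succ n =>
          set D := (t₀ * A + n * γ * r) * (1 + γ * L) ^ n with hD
          have hkT : ∀ k < n + 1, k * γ ≤ T := by
            intro k hk
            have : (k : ℝ) ≤ (n + 1 : ℕ) := by exact_mod_cast hk.le
            nlinarith
          have hkD : ∀ k < n + 1, ‖X k - x (k * γ)‖ ≤ D := by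
            intro k hk
            refine (ih k hk (hkT k hk)).trans ?_
            have h1 : k ≤ n := Nat.lt_succ_iff.1 hk
            have h2 : (k : ℝ) ≤ n := by exact_mod_cast h1
            rw [hD]
            gcongr
          have hkK : ∀ k < n + 1, X k ∈ Metric.closedBall x₀ (max R (Λ * T)) := fun k hk =>
            mem_closedBall_iff_norm.2 ((hconf k (hkT k hk)).2.trans (le_max_right _ _))
          have h1 := hup (n + 1) hn hge X g D hnoise hkK hkD
          push_cast at hn hge h1 ⊢
          have h2 := hstep n hn
          have h3 := hkD n n.lt_succ_self
          have h4 := mul_le_mul_of_nonneg_left h1 hγ0.le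
          have h5 := mul_le_mul_of_nonneg_right (min_le_left (r / 2) 1) hγ0.le
          calc ‖X (n + 1) - x ((n + 1) * γ)‖ ≤ D * (1 + γ * L) + γ * r * 1 := by nlinarith
            _ ≤ D * (1 + γ * L) + γ * r * (1 + γ * L) ^ (n + 1) := by
                gcongr
                exact one_le_pow₀ hq
            _ = _ := by rw [hD]; ring
  intro n hn
  refine (hgron n hn).trans ?_
  have h1 : (1 + γ * L) ^ n ≤ Real.exp (L * T) := by
    calc (1 + γ * L) ^ n ≤ Real.exp (γ * L) ^ n := by
          gcongr
          linarith [Real.add_one_le_exp (γ * L)]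
      _ = Real.exp (n * (γ * L)) := (Real.exp_nat_mul _ _).symm
      _ ≤ _ := Real.exp_le_exp.2 (by nlinarith)
  have h2 : t₀ * A * Real.exp (L * T) = δ / 2 := by rw [ht₀]; field_simp
  have h3 : T * r * Real.exp (L * T) ≤ δ / 2 := by
    rw [hr]
    have e : T * (δ / (2 * Real.exp (L * T) * (T + 1))) * Real.exp (L * T) =
        δ / 2 * (T / (T + 1)) := by field_simp
    rw [e]
    exact mul_le_of_le_one_right (by positivity) ((div_le_one (by positivity)).2 (by linarith))
  calc (t₀ * A + n * γ * r) * (1 + γ * L) ^ n ≤ (t₀ * A + T * r) * Real.exp (L * T) := by gcongr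
    _ ≤ δ := by rw [add_mul]; linarith

/-- The positions and both moment estimates stay close to the solution. -/
lemma Drift.exists_tracking (h : Drift G S) (hα : DecayRate α a) (hβ : DecayRate β b)
    (hε : 0 < ε) {x : ℝ → E d} (hx : Continuous x)
    (hfix : ∀ t, x t = picard x₀ (velocity G S ε a b) x t) {T : ℝ} (hT : 0 ≤ T) {δ : ℝ}
    (hδ : 0 < δ) :
    ∃ κ, 0 < κ ∧ ∀ᶠ γ in 𝓝[>] 0, ∀ X g : ℕ → E d, AdamPath ε γ (α γ) (β γ) x₀ X g →
      SmallNoise G S γ T κ X g → ∀ n : ℕ, n * γ ≤ T → ‖X n - x (n * γ)‖ ≤ δ ∧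
        ∀ i, |ema (α γ) (fun k => g k i) n - relax a (fun s => G (x s) i) (n * γ)| ≤ δ ∧
          |ema (β γ) (fun k => g k i ^ 2) n - relax b (fun s => S (x s) i) (n * γ)| ≤ δ := by
  obtain ⟨Λ, hΛ0, hΛ⟩ := exists_confinement (d := d) hα hβ hε hT
  obtain ⟨R, hR⟩ := (isCompact_Icc (a := 0) (b := T)).exists_bound_of_continuousOn
    (f := fun t => x t - x₀) (by fun_prop)
  have hK := isCompact_closedBall x₀ (max R (Λ * T))
  obtain ⟨L₁, hL₁0, hL₁⟩ := h.lipG _ hK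
  obtain ⟨L₂, hL₂0, hL₂⟩ := h.lipS _ hK
  set δ' := δ / (2 * (L₁ + L₂ + 1)) with hδ'
  have hδ'0 : 0 < δ' := by positivity
  have hδ'1 : L₁ * δ' ≤ δ / 2 ∧ L₂ * δ' ≤ δ / 2 ∧ δ' ≤ δ := by
    have e : (L₁ + L₂ + 1) * δ' = δ / 2 := by rw [hδ']; field_simp
    refine ⟨?_, ?_, ?_⟩ <;>
      nlinarith [mul_nonneg hL₁0 hδ'0.le, mul_nonneg hL₂0 hδ'0.le]
  obtain ⟨κ, hκ, hpos⟩ := h.exists_norm_sub_le hα hβ hε hx hfix hT hδ'0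
  obtain ⟨κ₁, hκ₁, h₁⟩ := hα.ema_noisy_sub_relax_le hT (half_pos hδ)
  obtain ⟨κ₂, hκ₂, h₂⟩ := hβ.ema_noisy_sub_relax_le hT (half_pos hδ)
  refine ⟨min κ (min κ₁ κ₂), by positivity, ?_⟩
  filter_upwards [hΛ, hpos, eventually_all.2 fun i => h₁ _ (h.continuous_comp hx i).1,
    eventually_all.2 fun i => h₂ _ (h.continuous_comp hx i).2, self_mem_nhdsWithin] with
    γ hΛ hpos h₁ h₂ hγ0 X g hX hnoise n hn
  have hγ0 : 0 < γ := hγ0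
  have hm₁ : min κ (min κ₁ κ₂) ≤ κ₁ := (min_le_right _ _).trans (min_le_left _ _)
  have hm₂ : min κ (min κ₁ κ₂) ≤ κ₂ := (min_le_right _ _).trans (min_le_right _ _)
  have hD := hpos X g hX fun i n hn => ⟨(hnoise i n hn).1.trans (min_le_left _ _),
    (hnoise i n hn).2.trans (min_le_left _ _)⟩
  have hkT : ∀ k ≤ n, k * γ ≤ T := by
    intro k hk
    have : (k : ℝ) ≤ n := by exact_mod_cast hk
    nlinarith
  have hXK : ∀ k ≤ n, X k ∈ Metric.closedBall x₀ (max R (Λ * T)) := fun k hk =>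
    mem_closedBall_iff_norm.2 ((hΛ x₀ X g hX k (hkT k hk)).2.trans (le_max_right _ _))
  have hxK : ∀ k ≤ n, x (k * γ) ∈ Metric.closedBall x₀ (max R (Λ * T)) := fun k hk =>
    mem_closedBall_iff_norm.2 ((hR _ ⟨by positivity, hkT k hk⟩).trans (le_max_left _ _))
  refine ⟨(hD n hn).trans hδ'1.2.2, fun i => ⟨?_, ?_⟩⟩
  · have e := h₁ i n hn (fun k => g k i) (fun k => G (X k) i) (δ / 2)
      (fun j hj => (hnoise i j (hkT j hj)).1.trans hm₁) fun k hk =>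
        (abs_apply_le_norm (G (X k) - G (x (k * γ))) i).trans
          ((hL₁ _ (hXK k hk.le) _ (hxK k hk.le)).trans
            ((mul_le_mul_of_nonneg_left (hD k (hkT k hk.le)) hL₁0).trans hδ'1.1))
    have := pow_nonneg (hα.mem γ hγ0).1 n
    refine e.trans ?_
    nlinarith
  · have e := h₂ i n hn (fun k => g k i ^ 2) (fun k => S (X k) i) (δ / 2)
      (fun j hj => (hnoise i j (hkT j hj)).2.trans hm₂) fun k hk =>
        (abs_apply_le_norm (S (X k) - S (x (k * γ))) i).trans
          ((hL₂ _ (hXK k hk.le) _ (hxK k hk.le)).trans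
            ((mul_le_mul_of_nonneg_left (hD k (hkT k hk.le)) hL₂0).trans hδ'1.2.1))
    have := pow_nonneg (hβ.mem γ hγ0).1 n
    refine e.trans ?_
    nlinarith

end Tracking

/-! ### The iterates of the algorithm -/

section Iterates

variable {d : ℕ} {Ξ : Type*} {f : E d → Ξ → ℝ} {ε γ α β : ℝ} {x₀ : E d}

/-- The gradients met along the trajectory of the algorithm. -/
noncomputable def gradients (f : E d → Ξ → ℝ) (ε γ α β : ℝ) (x₀ : E d) (s : ℕ → Ξ) (n : ℕ) : E d :=
  gradf f (iterates f ε γ α β x₀ s n).1 (s (n + 1))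

lemma iterates_moments (s : ℕ → Ξ) (n : ℕ) (i : Fin d) :
    (iterates f ε γ α β x₀ s n).2.1 i =
        ema α (fun k => gradients f ε γ α β x₀ s k i) n ∧
      (iterates f ε γ α β x₀ s n).2.2 i =
        ema β (fun k => gradients f ε γ α β x₀ s k i ^ 2) n := by
  induction n with
  | zero => simp [iterates, ema]
  | succ n ih => simp only [iterates, step, ema, ih.1, ih.2, gradients, and_self]

lemma adamPath_iterates (s : ℕ → Ξ) :
    AdamPath ε γ α β x₀ (fun n => (iterates f ε γ α β x₀ s n).1)
      (gradients f ε γ α β x₀ s) where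
  init := rfl
  step n := by
    ext i
    have h := iterates_moments (f := f) (ε := ε) (γ := γ) (α := α) (β := β) (x₀ := x₀) s (n + 1) i
    simp only [update, PiLp.sub_apply, PiLp.smul_apply, smul_eq_mul, ← h.1, ← h.2]
    simp only [iterates, step, mul_div_assoc]

lemma znorm_le (z : Z d) : znorm z ≤ 3 * ‖z‖ := by
  have h1 : ‖z.1‖ ≤ ‖z‖ := norm_fst_le z
  have h2 : ‖z.2.1‖ ≤ ‖z‖ := (norm_fst_le z.2).trans (norm_snd_le z)
  have h3 : ‖z.2.2‖ ≤ ‖z‖ := (norm_snd_le z.2).trans (norm_snd_le z)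
  refine Real.sqrt_le_iff.2 ⟨by positivity, ?_⟩
  have e1 := pow_le_pow_left₀ (norm_nonneg _) h1 2
  have e2 := pow_le_pow_left₀ (norm_nonneg _) h2 2
  have e3 := pow_le_pow_left₀ (norm_nonneg _) h3 2
  nlinarith [sq_nonneg ‖z‖]

/-- A sequence that follows a uniformly continuous curve on the grid does so after interpolation. -/
lemma norm_interp_sub_le (hγ0 : 0 < γ) (hγ1 : γ ≤ 1) {zs : ℕ → Z d} {z : ℝ → Z d} {T η : ℝ}
    (h : ∀ n : ℕ, n * γ ≤ T + 1 → ‖zs n - z (n * γ)‖ ≤ η)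
    (hz : ∀ s ∈ Set.Icc 0 (T + 1), ∀ t ∈ Set.Icc 0 (T + 1), |s - t| ≤ γ → ‖z s - z t‖ ≤ η) {t : ℝ}
    (ht : t ∈ Set.Icc 0 T) : ‖interp γ zs t - z t‖ ≤ 2 * η := by
  set n := ⌊t / γ⌋₊ with hn
  have h1 : n * γ ≤ t := by
    rw [← le_div_iff₀ hγ0]; exact Nat.floor_le (div_nonneg ht.1 hγ0.le)
  have h2 : t < (n + 1) * γ := by
    rw [← div_lt_iff₀ hγ0]; exact Nat.lt_floor_add_one _
  have h0 : 0 ≤ n * γ := by positivity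
  have htT : t ∈ Set.Icc 0 (T + 1) := ⟨ht.1, by linarith [ht.2]⟩
  set θ := (t - n * γ) / γ with hθ
  have hθ0 : 0 ≤ θ := div_nonneg (by linarith) hγ0.le
  have hθ1 : θ ≤ 1 := (div_le_one hγ0).2 (by linarith)
  have hA : ‖zs n - z t‖ ≤ 2 * η := by
    have e1 := h n (by linarith [ht.2])
    have e2 := hz (n * γ) ⟨h0, by linarith [ht.2]⟩ t htT (abs_le.2 ⟨by linarith, by linarith⟩)
    have e3 := norm_add_le (zs n - z (n * γ)) (z (n * γ) - z t)
    rw [sub_add_sub_cancel] at e3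
    linarith
  have hB : ‖zs (n + 1) - z t‖ ≤ 2 * η := by
    have e1 := h (n + 1) (by push_cast; linarith [ht.2])
    push_cast at e1
    have e2 := hz ((n + 1) * γ) ⟨by positivity, by linarith [ht.2]⟩ t htT
      (abs_le.2 ⟨by linarith, by linarith⟩)
    have e3 := norm_add_le (zs (n + 1) - z ((n + 1) * γ)) (z ((n + 1) * γ) - z t)
    rw [sub_add_sub_cancel] at e3
    linarith
  have e : interp γ zs t - z t = (1 - θ) • (zs n - z t) + θ • (zs (n + 1) - z t) := by
    simp only [interp, ← hn, ← hθ, sub_smul, one_smul, smul_sub]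
    abel
  rw [e]
  refine (norm_add_le _ _).trans ?_
  rw [norm_smul, norm_smul, Real.norm_of_nonneg hθ0, Real.norm_of_nonneg (sub_nonneg.2 hθ1)]
  nlinarith

variable [MeasurableSpace Ξ]

lemma measurable_step (hm : Measurable fun p : E d × Ξ => gradf f p.1 p.2) (n : ℕ) :
    Measurable fun p : Z d × Ξ => step f ε γ α β n p.1 p.2 := by
  have hg : Measurable fun p : Z d × Ξ => gradf f p.1.1 p.2 :=
    hm.comp (measurable_fst.fst.prodMk measurable_snd)
  have hco : ∀ {w : Z d × Ξ → E d}, Measurable w → ∀ i, Measurable fun p => w p i :=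
    fun hw i => by fun_prop
  have hx := fun i => hco (w := fun p => p.1.1) (measurable_fst.fst) i
  have hm1 := fun i => hco (w := fun p => p.1.2.1) (measurable_fst.snd.fst) i
  have hv1 := fun i => hco (w := fun p => p.1.2.2) (measurable_fst.snd.snd) i
  have hm' : ∀ i, Measurable fun p : Z d × Ξ =>
      α * p.1.2.1 i + (1 - α) * gradf f p.1.1 p.2 i := fun i =>
    ((hm1 i).const_mul α).add ((hco hg i).const_mul (1 - α))
  have hv' : ∀ i, Measurable fun p : Z d × Ξ =>
      β * p.1.2.2 i + (1 - β) * gradf f p.1.1 p.2 i ^ 2 := fun i =>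
    ((hv1 i).const_mul β).add (((hco hg i).pow_const 2).const_mul (1 - β))
  unfold step
  refine Measurable.prodMk ?_ (Measurable.prodMk ?_ ?_)
  · refine (WithLp.measurable_toLp 2 (Fin d → ℝ)).comp (measurable_pi_lambda _ fun i => ?_)
    exact (hx i).sub ((((hm' i).div_const _).const_mul γ).div
      ((((hv' i).div_const _).sqrt).const_add ε))
  · exact (WithLp.measurable_toLp 2 (Fin d → ℝ)).comp (measurable_pi_lambda _ hm')
  · exact (WithLp.measurable_toLp 2 (Fin d → ℝ)).comp (measurable_pi_lambda _ hv')

lemma measurable_iterates {Ω : Type*} (hm : Measurable fun p : E d × Ξ => gradf f p.1 p.2)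
    (ξs : ℕ → Ω → Ξ) (n : ℕ) : Measurable[past (fun n => ξs (n + 1)) n] fun ω =>
      iterates f ε γ α β x₀ (fun n => ξs n ω) n := by
  induction n with
  | zero => exact measurable_const
  | succ n ih =>
    exact (measurable_step hm (n + 1)).comp
      ((ih.mono (past_mono _ n.le_succ) le_rfl).prodMk
        (measurable_past (fun n => ξs (n + 1)) n.lt_succ_self))

/-- With probability close to one the noise met by the algorithm is small. -/
lemma eventually_measure_not_smallNoise_le {Ω : Type*} [MeasurableSpace Ω] {P : Measure Ω}
    [IsProbabilityMeasure P] {ξ : Ω → Ξ} {α β : ℝ → ℝ} {a b : ℝ}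
    (hξ : Measurable ξ) (hreg : RegularGrad (P.map ξ) f) (hmom : MomentsAbove P ξ f 2)
    (hα : DecayRate α a) (hβ : DecayRate β b) (hε : 0 < ε) {ξs : ℕ → Ω → Ξ}
    (hiid : IsIID P (P.map ξ) fun n => ξs (n + 1)) {T κ η : ℝ} (hT : 0 ≤ T) (hκ : 0 < κ)
    (hη : 0 < η) :
    ∀ᶠ γ in 𝓝[>] 0, P {ω | ¬ SmallNoise (meanGrad (P.map ξ) f) (meanSqGrad (P.map ξ) f) γ T κ
      (fun n => (iterates f ε γ (α γ) (β γ) x₀ (fun n => ξs n ω) n).1)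
      (gradients f ε γ (α γ) (β γ) x₀ fun n => ξs n ω)} ≤ ENNReal.ofReal η := by
  have := hiid.isProbabilityMeasure
  have hm := hreg.measurable
  obtain ⟨Λ, hΛ0, hΛ⟩ := exists_confinement (d := d) hα hβ hε hT
  obtain ⟨q, hq, hfin⟩ := hmom _ (isCompact_closedBall x₀ (Λ * T))
  set C := ⨆ x ∈ Metric.closedBall x₀ (Λ * T), ∫⁻ ω, ‖gradf f x (ξ ω)‖ₑ ^ q ∂P with hC
  have hCi : ∀ i, ∀ x ∈ Metric.closedBall x₀ (Λ * T),
      ∫⁻ s, ‖gradf f x s i‖ₑ ^ q ∂(P.map ξ) ≤ ENNReal.ofReal C.toReal := by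
    intro i x hx
    have hmx : Measurable (gradf f x) := hm.comp measurable_prodMk_left
    rw [ENNReal.ofReal_toReal hfin.ne]
    calc ∫⁻ s, ‖gradf f x s i‖ₑ ^ q ∂(P.map ξ) ≤ ∫⁻ s, ‖gradf f x s‖ₑ ^ q ∂(P.map ξ) := by
          refine lintegral_mono fun s => ?_
          refine ENNReal.rpow_le_rpow ?_ (by linarith)
          rw [enorm_le_iff_norm_le]
          exact PiLp.norm_apply_le _ i
      _ = ∫⁻ ω, ‖gradf f x (ξ ω)‖ₑ ^ q ∂P := lintegral_map (hmx.enorm.pow_const q) hξ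
      _ ≤ C := le_iSup₂_of_le (f := fun x (_ : x ∈ Metric.closedBall x₀ (Λ * T)) =>
          ∫⁻ ω, ‖gradf f x (ξ ω)‖ₑ ^ q ∂P) x hx le_rfl
  have hCi2 : ∀ i, ∀ x ∈ Metric.closedBall x₀ (Λ * T),
      ∫⁻ s, ‖gradf f x s i ^ 2‖ₑ ^ (q / 2) ∂(P.map ξ) ≤ ENNReal.ofReal C.toReal := by
    intro i x hx
    refine le_trans (le_of_eq (lintegral_congr fun s => ?_)) (hCi i x hx)
    rw [enorm_pow, ← ENNReal.rpow_natCast, ← ENNReal.rpow_mul]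
    congr 1
    push_cast
    ring
  have hφ₁ : ∀ i, Measurable (Function.uncurry fun x s => gradf f x s i) := fun i => by
    simp only [Function.uncurry_def]; fun_prop
  have hφ₂ : ∀ i, Measurable (Function.uncurry fun x s => gradf f x s i ^ 2) := fun i => by
    simp only [Function.uncurry_def]; fun_prop
  have hη' : 0 < η / (2 * (d + 1)) := by positivity
  have h₁ := eventually_all.2 fun i =>
    hiid.measure_exists_le (hφ₁ i) (by linarith : 1 < q) (hCi i) hT hκ hη'
  have h₂ := eventually_all.2 fun i =>
    hiid.measure_exists_le (hφ₂ i) (by linarith : 1 < q / 2) (hCi2 i) hT hκ hη'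
  filter_upwards [h₁, h₂, hΛ] with γ h₁ h₂ hΛ
  set X : ℕ → Ω → E d := fun n ω => (iterates f ε γ (α γ) (β γ) x₀ (fun n => ξs n ω) n).1 with hX
  have hXm : ∀ n, Measurable[past (fun n => ξs (n + 1)) n] (X n) := fun n =>
    measurable_fst.comp (measurable_iterates hm ξs n)
  have hXK : ∀ (n : ℕ) ω, n * γ < T → X n ω ∈ Metric.closedBall x₀ (Λ * T) := fun n ω hn =>
    mem_closedBall_iff_norm.2
      (hΛ x₀ (fun n => X n ω) _ (adamPath_iterates fun n => ξs n ω) n hn.le).2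
  set B₁ : Fin d → Set Ω := fun i => {ω | ∃ n : ℕ, n * γ ≤ T ∧ κ < γ * |∑ k ∈ Finset.range n,
    (gradf f (X k ω) (ξs (k + 1) ω) i - ∫ s, gradf f (X k ω) s i ∂(P.map ξ))|} with hB₁
  set B₂ : Fin d → Set Ω := fun i => {ω | ∃ n : ℕ, n * γ ≤ T ∧ κ < γ * |∑ k ∈ Finset.range n,
    (gradf f (X k ω) (ξs (k + 1) ω) i ^ 2 - ∫ s, gradf f (X k ω) s i ^ 2 ∂(P.map ξ))|} with hB₂
  calc _ ≤ P (⋃ i, (B₁ i ∪ B₂ i)) := by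
        refine measure_mono fun ω hω => ?_
        by_contra hcon
        simp only [Set.mem_iUnion, Set.mem_union, not_exists, not_or] at hcon
        refine hω fun i n hn => ⟨?_, ?_⟩
        · have h3 := (hcon i).1
          simp only [hB₁, Set.mem_ofPred_eq, not_exists, not_and, not_lt] at h3
          simpa only [hreg.meanGrad_apply, gradients] using h3 n hn
        · have h3 := (hcon i).2
          simp only [hB₂, Set.mem_ofPred_eq, not_exists, not_and, not_lt] at h3
          simpa only [meanSqGrad, gradients] using h3 n hn
    _ ≤ ∑ i, P (B₁ i ∪ B₂ i) := measure_iUnion_fintype_le _ _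
    _ ≤ ∑ _i : Fin d, ENNReal.ofReal (η / (d + 1)) := by
        refine Finset.sum_le_sum fun i _ => (measure_union_le _ _).trans ?_
        refine (add_le_add (h₁ i X hXm hXK) (h₂ i X hXm hXK)).trans (le_of_eq ?_)
        rw [← ENNReal.ofReal_add hη'.le hη'.le]
        congr 1
        field_simp
        norm_num
    _ = ENNReal.ofReal (d * (η / (d + 1))) := by
        rw [Finset.sum_const, Finset.card_univ, Fintype.card_fin, nsmul_eq_mul,
          ENNReal.ofReal_mul (by positivity), ENNReal.ofReal_natCast]
    _ ≤ ENNReal.ofReal η := by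
        refine ENNReal.ofReal_le_ofReal ?_
        rw [mul_div_assoc', div_le_iff₀ (by positivity)]
        nlinarith

end Iterates

end Adam

theorem mainTheorem3 {d : ℕ} {Ω Ξ : Type*} [MeasurableSpace Ω] [MeasurableSpace Ξ]
    (P : Measure Ω) [IsProbabilityMeasure P]
    (f : Adam.E d → Ξ → ℝ) (hf : Measurable (Function.uncurry f))
    (hdiff : ∀ s, Differentiable ℝ (fun x => f x s))
    (ξ : Ω → Ξ) (hξ : Measurable ξ)
    (hmodel : Adam.Model P ξ f)
    (hcoercive : Tendsto (Adam.F P ξ f) (cocompact (Adam.E d)) atTop)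
    (hS : ∀ x i, 0 < Adam.S P ξ f x i)
    (α β : ℝ → ℝ) (a b : ℝ) (hαβ : Adam.Regime α β a b)
    (ε : ℝ) (hε : 0 < ε)
    (ξs : ℕ → Ω → Ξ)
    (hξs : ∀ n, 1 ≤ n → Measurable (ξs n))
    (hindep : iIndepFun (fun n : ℕ => ξs (n + 1)) P)
    (hident : ∀ n, 1 ≤ n → P.map (ξs n) = P.map ξ)
    (hmoment : Adam.MomentsAbove P ξ f 2)
    (x₀ : Adam.E d) :
    ∃ z : ℝ → Adam.Z d,
      Adam.IsGlobalSolution (Adam.F P ξ f) (Adam.S P ξ f) ε a b x₀ z ∧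
      (∀ w : ℝ → Adam.Z d,
        Adam.IsGlobalSolution (Adam.F P ξ f) (Adam.S P ξ f) ε a b x₀ w → Set.EqOn w z (Set.Ici 0)) ∧
      ∀ T : ℝ, 0 < T → ∀ δ : ℝ, 0 < δ →
        Tendsto
          (fun γ : ℝ => P {ω | ENNReal.ofReal δ < ⨆ t ∈ Set.Icc (0 : ℝ) T,
            ENNReal.ofReal (Adam.znorm
              (Adam.interp γ
                (Adam.iterates f ε γ (α γ) (β γ) x₀ (fun n => ξs n ω)) t - z t))})
          (𝓝[>] 0) (𝓝 0) := by
  have : IsProbabilityMeasure (P.map ξ) := Measure.isProbabilityMeasure_map hξ.aemeasurable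
  have hreg := hmodel.regularGrad hf hdiff hξ hmoment
  have hSeq := Adam.S_eq_meanSqGrad (P := P) hξ hreg.measurable
  have hdrift : Adam.Drift (Adam.meanGrad (P.map ξ) f) (Adam.meanSqGrad (P.map ξ) f) :=
    hreg.drift fun x i => by rw [← hSeq]; exact hS x i
  have hF : ∀ x, gradient (Adam.F P ξ f) x = Adam.meanGrad (P.map ξ) f x :=
    hmodel.gradient_F hξ hreg
  have hα : Adam.DecayRate α a := ⟨hαβ.alpha_mem, hαβ.alpha_lim, hαβ.a_pos⟩
  have hβ : Adam.DecayRate β b := ⟨hαβ.beta_mem, hαβ.beta_lim, hαβ.b_pos⟩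
  have hiid : Adam.IsIID P (P.map ξ) fun n => ξs (n + 1) :=
    ⟨fun n => hξs _ (Nat.le_add_left 1 n), hindep, fun n => hident _ (Nat.le_add_left 1 n)⟩
  rw [hSeq]
  obtain ⟨x, hx, hfix, hsol, huniq⟩ :=
    hdrift.exists_unique_solution hε hαβ.a_pos hαβ.b_pos hF x₀
  refine ⟨_, hsol, huniq, fun T hT δ hδ => ?_⟩
  set z := Adam.lift (Adam.meanGrad (P.map ξ) f) (Adam.meanSqGrad (P.map ξ) f) a b x with hz
  have hzc : Continuous z := hdrift.continuous_lift hx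
  have hδ6 : 0 < δ / 6 := by positivity
  obtain ⟨τ, hτ, hunif⟩ := Metric.uniformContinuousOn_iff_le.1
    ((isCompact_Icc (a := 0) (b := T + 1)).uniformContinuousOn_of_continuous hzc.continuousOn) _ hδ6
  -- Times up to `T + 1` are needed since interpolation on `[0, T]` uses the next grid point.
  obtain ⟨κ, hκ, htrack⟩ := hdrift.exists_tracking hα hβ hε hx hfix
    (T := T + 1) (by linarith) (δ := δ / 6 / (d + 1)) (by positivity)
  rw [ENNReal.tendsto_nhds_zero]
  intro η hη
  obtain ⟨η', hη'0, hη'⟩ : ∃ η' : ℝ, 0 < η' ∧ ENNReal.ofReal η' ≤ η := by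
    obtain ⟨r, hr0, hr⟩ := ENNReal.lt_iff_exists_real_btwn.1 hη
    refine ⟨r, ?_, hr.2.le⟩
    simpa using hr.1
  filter_upwards [htrack, Adam.eventually_measure_not_smallNoise_le (ε := ε) (x₀ := x₀)
    hξ hreg hmoment hα hβ hε hiid (T := T + 1) (by linarith) hκ hη'0,
    Ioo_mem_nhdsGT (lt_min one_pos hτ)] with γ htrack hnoise ⟨hγ0, hγ1⟩
  rw [lt_min_iff] at hγ1
  refine (measure_mono fun ω hω => ?_).trans (hnoise.trans hη')
  intro hsmall
  refine absurd hω (not_lt.2 (iSup₂_le fun t ht => ENNReal.ofReal_le_ofReal ?_))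
  set zs := Adam.iterates f ε γ (α γ) (β γ) x₀ fun n => ξs n ω with hzs
  have hd : (0 : ℝ) < d + 1 := by positivity
  have hgrid : ∀ n : ℕ, n * γ ≤ T + 1 → ‖zs n - z (n * γ)‖ ≤ δ / 6 := by
    intro n hn
    obtain ⟨h1, h2⟩ := htrack _ _ (Adam.adamPath_iterates fun n => ξs n ω) hsmall n hn
    have h3 : δ / 6 / (d + 1) ≤ δ / 6 :=
      div_le_self hδ6.le (by linarith [Nat.cast_nonneg (α := ℝ) d])
    have h4 : d * (δ / 6 / (d + 1)) ≤ δ / 6 := by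
      rw [mul_div_assoc', div_le_iff₀ hd]; nlinarith
    refine norm_prod_le_iff.2 ⟨h1.trans h3, norm_prod_le_iff.2 ⟨?_, ?_⟩⟩
    · refine (Adam.norm_le_mul_of_forall_abs_le fun i => ?_).trans h4
      simpa [hzs, hz, Adam.lift, (Adam.iterates_moments (fun n => ξs n ω) n i).1] using (h2 i).1
    · refine (Adam.norm_le_mul_of_forall_abs_le fun i => ?_).trans h4
      simpa [hzs, hz, Adam.lift, (Adam.iterates_moments (fun n => ξs n ω) n i).2] using (h2 i).2
  have h5 := Adam.norm_interp_sub_le hγ0 hγ1.1.le hgrid (fun s hs t ht hst => by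
    rw [← dist_eq_norm]
    exact hunif s hs t ht (by rw [Real.dist_eq]; exact hst.trans hγ1.2.le)) ht
  have h6 := Adam.znorm_le (Adam.interp γ zs t - z t)
  linarith
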